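/- Let $SU(2)$ be the group of unit quaternions in $\mathbb H$. Let $\chi(F_2)$ be the space of homomorphisms $\pi_1(F_2)\to SU(2)$ up to conjugation, where $\pi_1(F_2)=\langle r_-,s_-,r_+,s_+\mid [r_-,s_-][r_+,s_+]=1\rangle$ is the fundamental group of the closed genus two surface; homomorphism spaces are topologized as subspaces of $SU(2)^g$ by evaluation on the generators, and orbit spaces carry the quotient topology. Write $\chi^*$, $\chi^{anc}$, $\chi^{cen}$ for the conjugacy classes of representations with non-abelian, abelian but non-central, and central image, respectively. Let $\chi(S^2,6)$ be the space of conjugacy classes of representations $\rho$ of $\langle x_1,\dots,x_6\mid x_1x_2x_3x_4x_5x_6=1\rangle$ in $SU(2)$ with $\operatorname{Re}\rho(x_i)=0$ for all $i$, and $\chi^*(S^2,6)$ its non-abelian part. Let $\nu$ be the involution of $\chi(S^2,6)$ given by $(\nu\rho)(x_i)=-\rho(x_i)$, and let $p^*:\chi(S^2,6)\to\chi(F_2)$ be given by $$p^*(\rho):\ r_-\mapsto\rho(x_1x_2),\quad s_-\mapsto\rho(x_3^{-1}x_2^{-1}),\quad r_+\mapsto\rho(x_4x_5),\quad s_+\mapsto\rho(x_6^{-1}x_5^{-1}).$$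 Then $\chi^{cen}(F_2)$ consists of exactly sixteen points, $\chi(F_2)\setminus\chi^{cen}(F_2)=\chi^*(F_2)\sqcup\chi^{anc}(F_2)$, and this space is a 6-manifold (Hausdorff, second countable, and homeomorphic to a smooth 6-manifold). More precisely: 1. The space of non-abelian traceless representations $\rho$ of $\langle x_1,\dots,x_6\mid x_1\cdots x_6=1\rangle$ is a smoothly embedded 9-dimensional submanifold of $\mathbb H^6$; its orbit space $\chi^*(S^2,6)$ is Hausdorff and second countable and is a smooth 6-manifold for which the orbit map is a smooth submersion. 2. $\nu$ restricts to a smooth involution of $\chi^*(S^2,6)$, whose fixed point set is a non-empty smooth submanifold of codimension two. 3. $p^*$ induces a homeomorphism $\chi^*(S^2,6)/\nu\to\chi(F_2)\setminus\chi^{cen}(F_2)$, and $\chi(F_2)\setminus\chi^{cen}(F_2)$ admits a smooth structure for which $p^*:\chi^*(S^2,6)\to\chi(F_2)\setminus\chi^{cen}(F_2)$ is smooth (so $p^*$ is a smooth double branched cover). -/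

import Mathlib

open scoped Quaternion Manifold ContDiff

noncomputable section

namespace SU2Char

/-- `SU(2)`, as the group of unit quaternions. -/
abbrev SU2 : Type := Metric.sphere (0 : ℍ[ℝ]) 1

instance : Group SU2 := Metric.unitSphere.instGroup

instance : Mul SU2 := (inferInstance : Group SU2).toMul

/-- For a group presented by generators `ι` and relators `rels`, and a set `S` of words in the
generators: the space of `SU(2)` representations for which the elements represented by the words
in `S` are traceless. A representation is given by its values on the generators, and the space has
the subspace topology of `SU(2)^ι`. The case `S = ∅` is `Hom(G, SU(2))`. -/
abbrev Rep {ι : Type} (rels S : Set (FreeGroup ι)) : Type :=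
  {A : ι → SU2 // (∀ r ∈ rels, FreeGroup.lift A r = 1) ∧
    ∀ w ∈ S, ((FreeGroup.lift A w : SU2) : ℍ[ℝ]).re = 0}

section General

variable {ι : Type} {rels S : Set (FreeGroup ι)}

/-- The group homomorphism determined by the values on the generators. -/
def Rep.hom (A : Rep rels S) : PresentedGroup rels →* SU2 :=
  PresentedGroup.toGroup (f := A.1) A.2.1

/-- The image is non-abelian. -/
def Rep.IsNonabelian (A : Rep rels S) : Prop :=
  ¬ ∀ a b : PresentedGroup rels, Commute (A.hom a) (A.hom b)

/-- The image lies in the center of `SU(2)`. -/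
def Rep.IsCentral (A : Rep rels S) : Prop :=
  ∀ a : PresentedGroup rels, A.hom a ∈ Subgroup.center SU2

/-- The image is abelian but not central. -/
def Rep.IsAbelianNoncentral (A : Rep rels S) : Prop :=
  (∀ a b : PresentedGroup rels, Commute (A.hom a) (A.hom b)) ∧ ¬ A.IsCentral

variable (rels S) in
/-- Simultaneous conjugation by an element of `SU(2)`. -/
def conjSetoid : Setoid (Rep rels S) where
  r A B := ∃ g : SU2, ∀ i, B.1 i = g * A.1 i * g⁻¹
  iseqv :=
    { refl := fun A => ⟨1, fun i => by simp⟩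
      symm := by
        rintro A B ⟨g, hg⟩
        exact ⟨g⁻¹, fun i => by rw [hg i]; group⟩
      trans := by
        rintro A B C ⟨g, hg⟩ ⟨k, hk⟩
        exact ⟨k * g, fun i => by rw [hk i, hg i]; group⟩ }

variable (rels S) in
/-- The (traceless) `SU(2)` character variety: the orbit space of the conjugation action, with the
quotient topology. -/
abbrev CharVar : Type := Quotient (conjSetoid rels S)

/-- The conjugacy class of a representation. -/
def Rep.cls (A : Rep rels S) : CharVar rels S := Quotient.mk (conjSetoid rels S) A

variable (rels S) in
/-- Conjugacy classes of representations with non-abelian image. -/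
def starLocus : Set (CharVar rels S) := {x | ∃ A : Rep rels S, A.IsNonabelian ∧ A.cls = x}

variable (rels S) in
/-- Conjugacy classes of representations with abelian, non-central image. -/
def ancLocus : Set (CharVar rels S) := {x | ∃ A : Rep rels S, A.IsAbelianNoncentral ∧ A.cls = x}

variable (rels S) in
/-- Conjugacy classes of representations with central image. -/
def cenLocus : Set (CharVar rels S) := {x | ∃ A : Rep rels S, A.IsCentral ∧ A.cls = x}

/-- A representation has non-abelian image iff two of its values on generators do not commute. -/
theorem Rep.isNonabelian_iff (A : Rep rels S) :
    A.IsNonabelian ↔ ∃ i j, ¬ Commute (A.1 i) (A.1 j) := by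
  have hof : ∀ i, A.hom (PresentedGroup.of i) = A.1 i := fun i =>
    PresentedGroup.toGroup.of A.2.1
  constructor
  · intro h
    by_contra hc
    push Not at hc
    apply h
    have key : A.hom.range ≤ Subgroup.closure (Set.range A.1) := by
      rw [MonoidHom.range_eq_map, ← PresentedGroup.closure_range_of, MonoidHom.map_closure,
        ← Set.range_comp]
      apply le_of_eq
      congr 2
      funext i
      exact hof i
    have hcomm := Subgroup.isMulCommutative_closure (k := Set.range A.1) (by
      rintro _ ⟨i, rfl⟩ _ ⟨j, rfl⟩
      exact hc i j)
    intro a b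
    have := hcomm.is_comm.comm ⟨A.hom a, key ⟨a, rfl⟩⟩ ⟨A.hom b, key ⟨b, rfl⟩⟩
    exact congrArg Subtype.val this
  · rintro ⟨i, j, hij⟩ h
    apply hij
    rw [← hof i, ← hof j]
    exact h _ _

end General

/-! ### The genus two surface and the six-punctured sphere -/

/-- `π₁(F₂) = ⟨r₋, s₋, r₊, s₊ ∣ [r₋, s₋][r₊, s₊]⟩`, with `r₋, s₋, r₊, s₊` numbered `0, 1, 2, 3`. -/
def relsF2 : Set (FreeGroup (Fin 4)) :=
  {(FreeGroup.of 0 * FreeGroup.of 1 * (FreeGroup.of 0)⁻¹ * (FreeGroup.of 1)⁻¹) *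
    (FreeGroup.of 2 * FreeGroup.of 3 * (FreeGroup.of 2)⁻¹ * (FreeGroup.of 3)⁻¹)}

/-- The fundamental group of the six-punctured sphere is generated by the meridians
`x₁, …, x₆` (numbered `0, …, 5`) with the relator `x₁ x₂ x₃ x₄ x₅ x₆`. -/
def relsS6 : Set (FreeGroup (Fin 6)) :=
  {FreeGroup.of 0 * FreeGroup.of 1 * FreeGroup.of 2 * FreeGroup.of 3 * FreeGroup.of 4 *
    FreeGroup.of 5}

/-- The meridians of the six punctures. -/
def meridians : Set (FreeGroup (Fin 6)) := Set.range FreeGroup.of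

/-- `Hom(π₁(F₂), SU(2))`. -/
abbrev RepF2 : Type := Rep relsF2 ∅

/-- Traceless representations of the fundamental group of the six-punctured sphere. -/
abbrev RepS6 : Type := Rep relsS6 meridians

/-- The character variety `χ(F₂)`. -/
abbrev ChiF2 : Type := CharVar relsF2 ∅

/-- The traceless character variety `χ(S², 6)`. -/
abbrev ChiS6 : Type := CharVar relsS6 meridians

/-- The non-abelian traceless representations. -/
abbrev RepS6Star : Type := {A : RepS6 // A.IsNonabelian}

/-- `χ*(S², 6)`. -/
abbrev ChiS6Star : Type := starLocus relsS6 meridians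

/-- `χ(F₂)` without the conjugacy classes of central representations. -/
abbrev ChiF2Noncentral : Type := ((cenLocus relsF2 ∅)ᶜ : Set ChiF2)

/-- The inclusion of the non-abelian traceless representations into `ℍ⁶`. -/
def RepS6Star.incl (A : RepS6Star) : Fin 6 → ℍ[ℝ] := fun i => (A.1.1 i : ℍ[ℝ])

/-- The orbit map onto `χ*(S², 6)`. -/
def RepS6Star.cls (A : RepS6Star) : ChiS6Star := ⟨A.1.cls, A.1, A.2, rfl⟩

theorem RepS6.re_eq_zero (A : RepS6) (i : Fin 6) : (A.1 i : ℍ[ℝ]).re = 0 := by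
  have := A.2.2 (FreeGroup.of i) ⟨i, rfl⟩
  simpa using this

theorem RepS6.prod_eq_one (A : RepS6) :
    A.1 0 * A.1 1 * A.1 2 * A.1 3 * A.1 4 * A.1 5 = 1 := by
  have := A.2.1 _ (Set.mem_singleton _)
  simpa using this

theorem inv_eq_neg_of_re_eq_zero {a : SU2} (h : (a : ℍ[ℝ]).re = 0) : a⁻¹ = -a := by
  have hn : ‖(a : ℍ[ℝ])‖ = 1 := by simp
  apply Subtype.ext
  have h1 : Quaternion.normSq (a : ℍ[ℝ]) = 1 := by
    rw [Quaternion.normSq_eq_norm_mul_self, hn, one_mul]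
  have h2 : ((a⁻¹ : SU2) : ℍ[ℝ]) = (a : ℍ[ℝ])⁻¹ := by simp
  rw [h2, Quaternion.inv_def, h1, inv_one, one_smul]
  ext <;> simp [h]

/-- The involution `ν` on representations: `(ν ρ)(xᵢ) = -ρ(xᵢ)`. -/
def nuRep (A : RepS6) : RepS6 :=
  ⟨fun i => -A.1 i, by
    refine ⟨?_, ?_⟩
    · rintro r rfl
      have := RepS6.prod_eq_one A
      simpa using this
    · rintro _ ⟨i, rfl⟩
      have := RepS6.re_eq_zero A i
      simp [this]⟩

/-- The involution `ν` of `χ(S², 6)`. -/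
def nu : ChiS6 → ChiS6 :=
  Quotient.map nuRep (by
    rintro A B ⟨g, hg⟩
    exact ⟨g, fun i => by simp [nuRep, hg i]⟩)

theorem nu_mem_star {x : ChiS6} (hx : x ∈ starLocus relsS6 meridians) :
    nu x ∈ starLocus relsS6 meridians := by
  obtain ⟨A, hA, rfl⟩ := hx
  refine ⟨nuRep A, ?_, rfl⟩
  rw [Rep.isNonabelian_iff] at hA ⊢
  obtain ⟨i, j, hij⟩ := hA
  refine ⟨i, j, fun h => hij ?_⟩
  simpa [nuRep, Commute, SemiconjBy] using h

theorem nu_nu (x : ChiS6) : nu (nu x) = x := by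
  induction x using Quotient.inductionOn with
  | h A =>
    change Quotient.mk _ (nuRep (nuRep A)) = _
    congr 1
    apply Subtype.ext
    funext i
    simp [nuRep]

/-- The restriction of `ν` to `χ*(S², 6)`. -/
def nuStar (x : ChiS6Star) : ChiS6Star := ⟨nu x.1, nu_mem_star x.2⟩

/-- The equivalence relation on `χ*(S², 6)` whose classes are the orbits of `ν`. -/
def nuSetoid : Setoid ChiS6Star where
  r x y := x = y ∨ nuStar x = y
  iseqv :=
    { refl := fun _ => Or.inl rfl
      symm := by
        rintro x y (rfl | rfl)
        · exact Or.inl rfl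
        · exact Or.inr (Subtype.ext (nu_nu x.1))
      trans := by
        rintro x y z (rfl | rfl) (rfl | rfl)
        · exact Or.inl rfl
        · exact Or.inr rfl
        · exact Or.inr rfl
        · exact Or.inl (Subtype.ext (nu_nu x.1).symm) }

theorem pStar_relation {a b c d e f : SU2} (ha : a⁻¹ = -a) (hb : b⁻¹ = -b) (hc : c⁻¹ = -c)
    (hd : d⁻¹ = -d) (he : e⁻¹ = -e) (hf : f⁻¹ = -f) (h : a * b * c * d * e * f = 1) :
    ((a * b) * (c⁻¹ * b⁻¹) * (a * b)⁻¹ * (c⁻¹ * b⁻¹)⁻¹) *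
      ((d * e) * (f⁻¹ * e⁻¹) * (d * e)⁻¹ * (f⁻¹ * e⁻¹)⁻¹) = 1 := by
  have key : ∀ {a b c : SU2}, a⁻¹ = -a → b⁻¹ = -b → c⁻¹ = -c →
      (a * b) * (c⁻¹ * b⁻¹) * (a * b)⁻¹ * (c⁻¹ * b⁻¹)⁻¹ = -((a * b * c) * (a * b * c)) := by
    intro a b c ha hb hc
    have hbb : b * b = -1 := by
      have h1 : b * b⁻¹ = 1 := mul_inv_cancel b
      rw [hb, mul_neg] at h1
      rw [← h1, neg_neg]
    calc (a * b) * (c⁻¹ * b⁻¹) * (a * b)⁻¹ * (c⁻¹ * b⁻¹)⁻¹ =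
          a * b * c⁻¹ * (b⁻¹ * b⁻¹) * a⁻¹ * b * c := by group
      _ = -((a * b * c) * (a * b * c)) := by
          rw [ha, hb, hc, neg_mul_neg, hbb]
          simp [mul_assoc]
  rw [key ha hb hc, key hd he hf, neg_mul_neg]
  have h2 : d * e * f = (a * b * c)⁻¹ := by
    rw [eq_inv_iff_mul_eq_one]
    have h3 : (a * b * c) * (d * e * f) = 1 := by simpa [mul_assoc] using h
    exact mul_eq_one_comm.mp h3
  rw [h2]
  group

/-- The map `p*` on representations:
`r₋ ↦ x₁x₂`, `s₋ ↦ x₃⁻¹x₂⁻¹`, `r₊ ↦ x₄x₅`, `s₊ ↦ x₆⁻¹x₅⁻¹`. -/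
def pRep (A : RepS6) : RepF2 :=
  ⟨![A.1 0 * A.1 1, (A.1 2)⁻¹ * (A.1 1)⁻¹, A.1 3 * A.1 4, (A.1 5)⁻¹ * (A.1 4)⁻¹], by
    refine ⟨?_, by simp⟩
    rintro r rfl
    have hi := fun i => inv_eq_neg_of_re_eq_zero (RepS6.re_eq_zero A i)
    have := pStar_relation (hi 0) (hi 1) (hi 2) (hi 3) (hi 4) (hi 5) (RepS6.prod_eq_one A)
    simp only [map_mul, map_inv, FreeGroup.lift_apply_of]
    exact this⟩

/-- The map `p* : χ(S², 6) → χ(F₂)`. -/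
def pStar : ChiS6 → ChiF2 :=
  Quotient.map pRep (by
    rintro A B ⟨g, hg⟩
    refine ⟨g, fun i => ?_⟩
    fin_cases i <;> simp [pRep, hg, mul_assoc])

/-! ### Submanifolds -/

/-- `Z` is a smooth submanifold of codimension `c` of the `n`-manifold `X`: around each of its
points there is a chart in the smooth structure in which `Z` is the subset where the last `c`
coordinates vanish. -/
def IsSubmanifoldOfCodim (n c : ℕ) {X : Type} [TopologicalSpace X]
    [ChartedSpace (EuclideanSpace ℝ (Fin n)) X] (Z : Set X) : Prop :=
  ∀ x ∈ Z, ∃ φ ∈ IsManifold.maximalAtlas (𝓡 n) ∞ X, x ∈ φ.source ∧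
    φ '' (φ.source ∩ Z) = φ.target ∩ {y | ∀ i : Fin n, n ≤ (i : ℕ) + c → y i = 0}

end SU2Char

end

open scoped Quaternion Manifold ContDiff

noncomputable section

open Set Filter Topology Function

/-! Smooth structure upstairs. Near a non-abelian traceless tuple, the representations are the zero
set in `ℍ⁶` of the 15 real equations `con`. They are regular there (`fderiv_con_surjective`): a
covector annihilating the image of the derivative of the product on tangent vectors is an imaginary
quaternion commuting with every value, and a non-abelian tuple commutes only with real quaternions.
For the same reason conjugation has stabiliser `±1`, and compactness of `SU(2)` shows that nearby
conjugate tuples are conjugate by an element that acts like one near `1` (`exists_nhds_conj`). This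
gives slices (`exists_sliceChart`): ambient charts that straighten the zero set and the orbits at
once. The structures on the representations and on their orbit space, together with the embedding
and the submersion, are read off from such charts.

Fibres of `p*`. Put `y = x₁x₂x₃`. A tuple is recovered from `y` and its `p*`-values (`eq_tupleOf`),
`ν` replaces `y` by `-y`, and `y² = -[r₋, s₋]` depends only on the image. If `Re y ≠ 0` this
determines `y` up to sign. If `Re y = 0`, two choices of `y` that are not opposite are conjugate by
an element commuting with the whole image (`cls_eq_or_of_pRep_eq`). Conversely a suitable `y` exists
over every representation: the normalisation of `1 - [r₋, s₋]`, or, when this vanishes, an imaginary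
unit orthogonal to the axes of the two commuting pairs (`exists_balanced`). As the character
varieties are compact and Hausdorff, the induced bijection is a homeomorphism.

Smoothness of the quotient. The quotient by `(w, z) ↦ (w, -z)` has coordinates `(w, z²)`, but an
arbitrary equivariant change of coordinates need not be smooth in terms of `z²`. It is if it acts on
`z` by an orthogonal matrix depending on `w` alone: then `z' = αz + βz̄` with `αβ = 0`, hence `z'² =
α²z² + β² conj(z²)` (`exists_smooth_branched_quotient`).

Charts with such transitions come from a normal form. A class fixed by `ν` has a representative
orthogonal to `i`, say `xₖ = uₖ j` with `uₖ` a unit complex number (`exists_planar_lift`). Nearby,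
one asks that `i` be an eigenvector of `∑ xₖ xₖᵀ` (`mixed = 0`) with strictly smallest eigenvalue
(`Gap`). Such a representative is unique up to rotations about `i` and half-turns exchanging `i` and
`-i` (`normal_position_unique`). The coordinate `w` records the angles between consecutive planar
parts. The coordinate `z` records the components of the vector of `i`-coordinates along an
orthonormal frame of the plane of infinitesimal normal deformations of the planar configuration at
`w`. In these coordinates `ν` is exactly `z ↦ -z` (`FoldFrame.coord_flip`), and two frames of the
same plane differ by an orthogonal matrix (`FoldFrame.Compat.alpha_mul_beta`). -/

namespace SliceManifold

/-! ### Manifolds from families of charts -/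

section Atlas

variable {E M S : Type} [NormedAddCommGroup E] [NormedSpace ℝ E] [TopologicalSpace M]

/-- The charted space with a given covering family of charts. -/
abbrev chartedSpaceOf (c : S → OpenPartialHomeomorph M E) (hc : ∀ x, ∃ s, x ∈ (c s).source) :
    ChartedSpace E M where
  atlas := range c
  chartAt x := c (hc x).choose
  mem_chart_source x := (hc x).choose_spec
  chart_mem_atlas x := ⟨_, rfl⟩

theorem isManifold_chartedSpaceOf (c : S → OpenPartialHomeomorph M E)
    (hc : ∀ x, ∃ s, x ∈ (c s).source)
    (h : ∀ s t, ∀ x ∈ (c s).source, x ∈ (c t).source →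
      ContDiffAt ℝ ∞ (fun y => c t ((c s).symm y)) (c s x)) :
    letI := chartedSpaceOf c hc
    IsManifold 𝓘(ℝ, E) ∞ M := by
  letI := chartedSpaceOf c hc
  refine isManifold_of_contDiffOn _ _ _ ?_
  rintro _ _ ⟨s, rfl⟩ ⟨t, rfl⟩ y hy
  have hy' : y ∈ (c s).target ∧ (c s).symm y ∈ (c t).source := by simpa using hy
  have := h s t _ ((c s).map_target hy'.1) hy'.2
  rw [(c s).right_inv hy'.1] at this
  exact this.contDiffWithinAt

end Atlas

theorem contMDiffAt_of_charts {E E' M N : Type} [NormedAddCommGroup E] [NormedSpace ℝ E]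
    [NormedAddCommGroup E'] [NormedSpace ℝ E'] [TopologicalSpace M] [TopologicalSpace N]
    [ChartedSpace E M] [ChartedSpace E' N] [IsManifold 𝓘(ℝ, E) ∞ M] [IsManifold 𝓘(ℝ, E') ∞ N]
    {e : OpenPartialHomeomorph M E} {e' : OpenPartialHomeomorph N E'}
    (he : e ∈ IsManifold.maximalAtlas 𝓘(ℝ, E) ∞ M)
    (he' : e' ∈ IsManifold.maximalAtlas 𝓘(ℝ, E') ∞ N) {f : M → N} {x : M} (hx : x ∈ e.source)
    (hfx : f x ∈ e'.source) (hf : ContinuousAt f x)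
    (h : ContDiffAt ℝ ∞ (fun y => e' (f (e.symm y))) (e x)) :
    ContMDiffAt 𝓘(ℝ, E) 𝓘(ℝ, E') ∞ f x := by
  rw [ContMDiffAt, contMDiffWithinAt_iff_of_mem_maximalAtlas he he' hx hfx]
  refine ⟨hf.continuousWithinAt, ?_⟩
  exact h.contDiffWithinAt

/-! ### Slice charts -/

variable {X E G K L R M : Type} [NormedAddCommGroup X] [NormedSpace ℝ X]
  [NormedAddCommGroup E] [NormedSpace ℝ E] [NormedAddCommGroup G] [NormedSpace ℝ G]
  [NormedAddCommGroup K] [NormedSpace ℝ K] [NormedAddCommGroup L] [NormedSpace ℝ L]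

/-- An ambient chart which straightens both the image of `ι` and the fibres of `q`. -/
structure SliceChart (E G K : Type) [NormedAddCommGroup E] [NormedSpace ℝ E]
    [NormedAddCommGroup G] [NormedSpace ℝ G] [NormedAddCommGroup K] [NormedSpace ℝ K]
    (ι : R → X) (q : R → M) where
  /-- the underlying chart -/
  Θ : OpenPartialHomeomorph X ((E × G) × K)
  contDiffOn : ContDiffOn ℝ ∞ Θ Θ.source
  contDiffOn_symm : ContDiffOn ℝ ∞ Θ.symm Θ.target
  mem_range_iff : ∀ x ∈ Θ.source, x ∈ range ι ↔ (Θ x).2 = 0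
  orbit_iff : ∀ a b, ι a ∈ Θ.source → ι b ∈ Θ.source →
    (q a = q b ↔ (Θ (ι a)).1.1 = (Θ (ι b)).1.1)
  -- This lets the points with `t = 0` serve as representatives of all classes met by the chart, so
  -- that the quotient chart has an inverse on its whole target.
  box : ∀ v t, ((v, t), 0) ∈ Θ.target → ((v, 0), 0) ∈ Θ.target

namespace SliceChart

variable {ι : R → X} {q : R → M}

section Basic

variable (S : SliceChart E G K ι q)

theorem exists_lift {p : E × G} (hp : (p, 0) ∈ S.Θ.target) :
    ∃ a, ι a = S.Θ.symm (p, 0) := by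
  have h := S.mem_range_iff _ (S.Θ.map_target hp)
  rw [S.Θ.right_inv hp] at h
  exact h.mpr rfl

theorem apply_eq {a : R} (ha : ι a ∈ S.Θ.source) : S.Θ (ι a) = ((S.Θ (ι a)).1, 0) := by
  have := (S.mem_range_iff _ ha).mp ⟨a, rfl⟩
  exact Prod.ext rfl this

variable [Nonempty R]

theorem invFun_lift {p : E × G} (hp : (p, 0) ∈ S.Θ.target) :
    ι (invFun ι (S.Θ.symm (p, 0))) = S.Θ.symm (p, 0) :=
  invFun_eq (S.exists_lift hp)

variable [TopologicalSpace R]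

/-- The chart of the source of `ι` given by a slice chart. -/
def repChart (hι : IsEmbedding ι) (e : L ≃L[ℝ] E × G) : OpenPartialHomeomorph R L where
  toFun a := e.symm (S.Θ (ι a)).1
  invFun y := invFun ι (S.Θ.symm (e y, 0))
  source := ι ⁻¹' S.Θ.source
  target := {y | (e y, 0) ∈ S.Θ.target}
  map_source' a ha := by
    simp only [mem_ofPred_eq, e.apply_symm_apply]
    rw [← S.apply_eq ha]
    exact S.Θ.map_source ha
  map_target' y hy := by
    rw [mem_preimage, S.invFun_lift hy]
    exact S.Θ.map_target hy
  left_inv' a ha := by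
    apply hι.injective
    simp only [e.apply_symm_apply]
    rw [← S.apply_eq ha, S.Θ.left_inv ha]
    exact invFun_eq ⟨a, rfl⟩
  right_inv' y hy := by
    rw [S.invFun_lift hy, S.Θ.right_inv hy]
    exact e.symm_apply_apply y
  open_source := S.Θ.open_source.preimage hι.continuous
  open_target := S.Θ.open_target.preimage (by fun_prop)
  continuousOn_toFun := by
    refine e.symm.continuous.comp_continuousOn (continuous_fst.comp_continuousOn ?_)
    exact S.Θ.continuousOn.comp hι.continuous.continuousOn fun a ha => ha
  continuousOn_invFun := by
    rw [hι.continuousOn_iff]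
    have : ContinuousOn (fun y => S.Θ.symm (e y, 0)) {y | (e y, (0 : K)) ∈ S.Θ.target} :=
      S.Θ.symm.continuousOn.comp (by fun_prop) fun y hy => hy
    exact this.congr fun y hy => S.invFun_lift hy

variable [TopologicalSpace M]

open Classical in
/-- The invariant coordinates, as a function on the target of `q`. -/
def quotFun (S : SliceChart E G K ι q) (m : M) : E :=
  if h : ∃ a, ι a ∈ S.Θ.source ∧ q a = m then (S.Θ (ι h.choose)).1.1 else 0

theorem quotFun_apply {a : R} (ha : ι a ∈ S.Θ.source) : S.quotFun (q a) = (S.Θ (ι a)).1.1 := by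
  have h : ∃ b, ι b ∈ S.Θ.source ∧ q b = q a := ⟨a, ha, rfl⟩
  rw [quotFun, dif_pos h]
  exact (S.orbit_iff _ _ h.choose_spec.1 ha).mp h.choose_spec.2

/-- The chart of the target of `q` given by a slice chart. -/
def quotChart (hι : IsEmbedding ι) (hq : IsOpenQuotientMap q) : OpenPartialHomeomorph M E where
  toFun := S.quotFun
  invFun v := q (invFun ι (S.Θ.symm ((v, 0), 0)))
  source := q '' (ι ⁻¹' S.Θ.source)
  target := {v | ((v, 0), 0) ∈ S.Θ.target}
  map_source' := by
    rintro _ ⟨a, ha, rfl⟩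
    rw [mem_ofPred_eq, S.quotFun_apply ha]
    have := S.Θ.map_source ha
    rw [S.apply_eq ha] at this
    exact S.box _ _ this
  map_target' v hv := ⟨_, by
    rw [mem_preimage, S.invFun_lift hv]
    exact S.Θ.map_target hv, rfl⟩
  left_inv' := by
    rintro _ ⟨a, ha, rfl⟩
    have h := S.Θ.map_source ha
    rw [S.apply_eq ha] at h
    have h' := S.box _ _ h
    rw [S.quotFun_apply ha, S.orbit_iff _ _ _ ha, S.invFun_lift h', S.Θ.right_inv h']
    rw [S.invFun_lift h']
    exact S.Θ.map_target h'
  right_inv' v hv := by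
    rw [S.quotFun_apply, S.invFun_lift hv, S.Θ.right_inv hv]
    rw [S.invFun_lift hv]
    exact S.Θ.map_target hv
  open_source := hq.isOpenMap _ (S.Θ.open_source.preimage hι.continuous)
  open_target := S.Θ.open_target.preimage (by fun_prop)
  continuousOn_toFun := by
    rintro _ ⟨a, ha, rfl⟩
    refine ContinuousAt.continuousWithinAt ?_
    -- For an open quotient map, neighbourhoods of `q a` are images of neighbourhoods of `a`, so
    -- continuity can be tested upstairs.
    rw [ContinuousAt, ← hq.map_nhds_eq, tendsto_map'_iff, S.quotFun_apply ha]
    have h1 : ContinuousAt (fun b => (S.Θ (ι b)).1.1) a :=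
      (continuous_fst.comp continuous_fst).continuousAt.comp
        ((S.Θ.continuousAt ha).comp hι.continuous.continuousAt)
    refine Tendsto.congr' ?_ h1
    filter_upwards [(S.Θ.open_source.preimage hι.continuous).mem_nhds ha] with b hb
    exact (S.quotFun_apply hb).symm
  continuousOn_invFun := by
    refine hq.continuous.comp_continuousOn ?_
    rw [hι.continuousOn_iff]
    have : ContinuousOn (fun v : E => S.Θ.symm ((v, 0), 0))
        {v | ((v, (0 : G)), (0 : K)) ∈ S.Θ.target} :=
      S.Θ.symm.continuousOn.comp (by fun_prop) fun y hy => hy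
    exact this.congr fun y hy => S.invFun_lift hy

theorem quotChart_apply (hι : IsEmbedding ι) (hq : IsOpenQuotientMap q) {a : R}
    (ha : ι a ∈ S.Θ.source) : S.quotChart hι hq (q a) = (S.Θ (ι a)).1.1 :=
  S.quotFun_apply ha

theorem contDiffAt_slice {v : E} (hv : ((v, 0), 0) ∈ S.Θ.target) :
    ContDiffAt ℝ ∞ (fun v : E => S.Θ.symm ((v, 0), 0)) v := by
  have h1 : ContDiffAt ℝ ∞ S.Θ.symm ((v, 0), 0) :=
    S.contDiffOn_symm.contDiffAt (S.Θ.open_target.mem_nhds hv)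
  exact h1.comp v (by fun_prop)

end Basic

variable [Nonempty R] [TopologicalSpace R] [TopologicalSpace M]
  {hι : IsEmbedding ι} {hq : IsOpenQuotientMap q}

/-- An induced map between quotients is smooth in slice charts if it is induced by a smooth
ambient map near a lift of the given point. -/
theorem contDiffAt_induced (S T : SliceChart E G K ι q) {f : M → M} {m : M}
    (hm : m ∈ (S.quotChart hι hq).source) {a b : R} (ha : ι a = S.Θ.symm ((S.quotChart hι hq m, 0), 0))
    {g : X → X} (hg : ContDiff ℝ ∞ g) (hgb : g (ι a) = ι b) (hb : ι b ∈ T.Θ.source)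
    (h : ∀ a', ∃ b', ι b' = g (ι a') ∧ q b' = f (q a')) :
    ContDiffAt ℝ ∞ (fun v => T.quotChart hι hq (f ((S.quotChart hι hq).symm v)))
      (S.quotChart hι hq m) := by
  set v₀ := S.quotChart hι hq m with hv₀
  have hvt : ((v₀, 0), 0) ∈ S.Θ.target := (S.quotChart hι hq).map_source hm
  have hs : ContDiffAt ℝ ∞ (fun v : E => g (S.Θ.symm ((v, 0), 0))) v₀ :=
    hg.contDiffAt.comp v₀ (S.contDiffAt_slice hvt)
  have hmem : g (S.Θ.symm ((v₀, 0), 0)) ∈ T.Θ.source := by rw [← ha, hgb]; exact hb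
  have hT : ContDiffAt ℝ ∞ T.Θ (g (S.Θ.symm ((v₀, 0), 0))) :=
    T.contDiffOn.contDiffAt (T.Θ.open_source.mem_nhds hmem)
  have hc : ContDiffAt ℝ ∞ (fun v : E => (T.Θ (g (S.Θ.symm ((v, 0), 0)))).1.1) v₀ :=
    (contDiff_fst.comp contDiff_fst).contDiffAt.comp v₀ (hT.comp v₀ hs)
  refine hc.congr_of_eventuallyEq ?_
  have e1 : ∀ᶠ v in 𝓝 v₀, ((v, (0 : G)), (0 : K)) ∈ S.Θ.target :=
    (S.quotChart hι hq).open_target.mem_nhds hvt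
  have e2 : ∀ᶠ v in 𝓝 v₀, g (S.Θ.symm ((v, 0), 0)) ∈ T.Θ.source :=
    hs.continuousAt.preimage_mem_nhds (T.Θ.open_source.mem_nhds hmem)
  filter_upwards [e1, e2] with v h1 h2
  obtain ⟨b', hb', hqb'⟩ := h (invFun ι (S.Θ.symm ((v, 0), 0)))
  rw [S.invFun_lift h1] at hb'
  change T.quotChart hι hq (f (q _)) = _
  rw [← hqb', T.quotChart_apply hι hq (by rwa [hb']), hb']

theorem contDiffAt_repChart (S T : SliceChart E G K ι q) (e : L ≃L[ℝ] E × G) {a : R}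
    (ha : ι a ∈ S.Θ.source) (hb : ι a ∈ T.Θ.source) :
    ContDiffAt ℝ ∞ (fun y => T.repChart hι e ((S.repChart hι e).symm y)) (S.repChart hι e a) := by
  set y₀ := S.repChart hι e a with hy₀
  have hyt : (e y₀, 0) ∈ S.Θ.target := (S.repChart hι e).map_source ha
  have hinv : S.Θ.symm (e y₀, 0) = ι a := by
    rw [hy₀]
    change S.Θ.symm (e (e.symm _), 0) = _
    rw [e.apply_symm_apply, ← S.apply_eq ha, S.Θ.left_inv ha]
  have hs : ContDiffAt ℝ ∞ (fun y : L => S.Θ.symm (e y, 0)) y₀ :=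
    (S.contDiffOn_symm.contDiffAt (S.Θ.open_target.mem_nhds hyt)).comp y₀
      (e.contDiff.contDiffAt.prodMk contDiffAt_const)
  have hT : ContDiffAt ℝ ∞ T.Θ (S.Θ.symm (e y₀, 0)) :=
    T.contDiffOn.contDiffAt (T.Θ.open_source.mem_nhds (by rwa [hinv]))
  have hc : ContDiffAt ℝ ∞ (fun y : L => e.symm (T.Θ (S.Θ.symm (e y, 0))).1) y₀ :=
    (e.symm.contDiff.comp contDiff_fst).contDiffAt.comp y₀ (hT.comp y₀ hs)
  refine hc.congr_of_eventuallyEq ?_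
  filter_upwards [(S.repChart hι e).open_target.mem_nhds hyt] with y hy
  change e.symm (T.Θ (ι (invFun ι (S.Θ.symm (e y, 0))))).1 = _
  rw [S.invFun_lift hy]

variable (hι hq)

/-- The smooth structure on the target of `q`. -/
abbrev quotCharted (hcov : ∀ a, ∃ S : SliceChart E G K ι q, ι a ∈ S.Θ.source) :
    ChartedSpace E M :=
  chartedSpaceOf (fun S : SliceChart E G K ι q => S.quotChart hι hq) fun m => by
    obtain ⟨a, rfl⟩ := hq.surjective m
    obtain ⟨S, hS⟩ := hcov a
    exact ⟨S, a, hS, rfl⟩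

/-- The smooth structure on the source of `ι`. -/
abbrev repCharted (e : L ≃L[ℝ] E × G)
    (hcov : ∀ a, ∃ S : SliceChart E G K ι q, ι a ∈ S.Θ.source) : ChartedSpace L R :=
  chartedSpaceOf (fun S : SliceChart E G K ι q => S.repChart hι e) fun a => hcov a

variable (hcov : ∀ a, ∃ S : SliceChart E G K ι q, ι a ∈ S.Θ.source)
  (hG : ∀ a b, q a = q b → ∃ g : X → X, ContDiff ℝ ∞ g ∧ g (ι a) = ι b ∧
    ∀ a', ∃ b', ι b' = g (ι a') ∧ q b' = q a')

-- Two lifts of one point of the quotient may lie far apart in the ambient space; composing with a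
-- translation from `hG` moves the lift produced by `g₀` onto the prescribed one.
include hG in
theorem exists_translate {f : M → M} {g₀ : X → X} (hg₀ : ContDiff ℝ ∞ g₀)
    (h₀ : ∀ a', ∃ b', ι b' = g₀ (ι a') ∧ q b' = f (q a')) {a b : R} (hab : f (q a) = q b) :
    ∃ g : X → X, ContDiff ℝ ∞ g ∧ g (ι a) = ι b ∧
      ∀ a', ∃ b', ι b' = g (ι a') ∧ q b' = f (q a') := by
  obtain ⟨c, hc, hqc⟩ := h₀ a
  obtain ⟨g, hg, hga, hgq⟩ := hG c b (hqc.trans hab)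
  refine ⟨g ∘ g₀, hg.comp hg₀, by simp [← hc, hga], fun a' => ?_⟩
  obtain ⟨c', hc', hqc'⟩ := h₀ a'
  obtain ⟨b', hb', hqb'⟩ := hgq c'
  exact ⟨b', by simp [hb', ← hc'], hqb'.trans hqc'⟩

-- The lift supplied by the slice of `S` need not lie in the domain of `T`. It is first carried
-- there by an ambient symmetry, after which `contDiffAt_induced` applies. With `f = id` this is the
-- compatibility of quotient charts.
include hG in
theorem contDiffAt_quotChart_comp {f : M → M} {g₀ : X → X} (hg₀ : ContDiff ℝ ∞ g₀)
    (h₀ : ∀ a', ∃ b', ι b' = g₀ (ι a') ∧ q b' = f (q a')) (S T : SliceChart E G K ι q) {m : M}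
    (hm : m ∈ (S.quotChart hι hq).source) (hfm : f m ∈ (T.quotChart hι hq).source) :
    ContDiffAt ℝ ∞ (fun v => T.quotChart hι hq (f ((S.quotChart hι hq).symm v)))
      (S.quotChart hι hq m) := by
  obtain ⟨b, hb, hqb⟩ := hfm
  have hvt : ((S.quotChart hι hq m, 0), 0) ∈ S.Θ.target := (S.quotChart hι hq).map_source hm
  obtain ⟨a, ha⟩ := S.exists_lift hvt
  have hqa : q a = m := by
    have h1 : (S.quotChart hι hq).symm (S.quotChart hι hq m) = m := (S.quotChart hι hq).left_inv hm
    rw [← h1]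
    change q a = q (invFun ι _)
    rw [← ha, leftInverse_invFun hι.injective]
  obtain ⟨g, hg, hga, hgq⟩ := exists_translate hG hg₀ h₀ (a := a) (b := b) (by rw [hqa, hqb])
  exact contDiffAt_induced S T hm ha hg hga hb hgq

include hG in
theorem isManifold_quotCharted :
    letI := quotCharted hι hq hcov
    IsManifold 𝓘(ℝ, E) ∞ M :=
  isManifold_chartedSpaceOf _ _ fun S T _ hm hm' =>
    contDiffAt_quotChart_comp hι hq hG (f := id) (g₀ := id) contDiff_id
      (fun a' => ⟨a', rfl, rfl⟩) S T hm hm'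

theorem isManifold_repCharted (e : L ≃L[ℝ] E × G) :
    letI := repCharted hι e hcov
    IsManifold 𝓘(ℝ, L) ∞ R :=
  isManifold_chartedSpaceOf _ _ fun S T _ hm hm' => contDiffAt_repChart S T e hm hm'

include hG in
theorem quotChart_mem_maximalAtlas (S : SliceChart E G K ι q) :
    letI := quotCharted hι hq hcov
    S.quotChart hι hq ∈ IsManifold.maximalAtlas 𝓘(ℝ, E) ∞ M := by
  let _ := quotCharted hι hq hcov
  have := isManifold_quotCharted hι hq hcov hG
  exact IsManifold.subset_maximalAtlas ⟨S, rfl⟩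

theorem repChart_mem_maximalAtlas (e : L ≃L[ℝ] E × G) (S : SliceChart E G K ι q) :
    letI := repCharted hι e hcov
    S.repChart hι e ∈ IsManifold.maximalAtlas 𝓘(ℝ, L) ∞ R := by
  letI := repCharted hι e hcov
  haveI := isManifold_repCharted hι hcov e
  exact IsManifold.subset_maximalAtlas ⟨S, rfl⟩

include hG in
theorem contMDiff_induced {f : M → M} (hf : Continuous f) {g₀ : X → X} (hg₀ : ContDiff ℝ ∞ g₀)
    (h₀ : ∀ a', ∃ b', ι b' = g₀ (ι a') ∧ q b' = f (q a')) :
    letI := quotCharted hι hq hcov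
    ContMDiff 𝓘(ℝ, E) 𝓘(ℝ, E) ∞ f := by
  let _ := quotCharted hι hq hcov
  have := isManifold_quotCharted hι hq hcov hG
  intro m
  obtain ⟨a, ha⟩ := hq.surjective m
  obtain ⟨b, hb⟩ := hq.surjective (f m)
  obtain ⟨S, hS⟩ := hcov a
  obtain ⟨T, hT⟩ := hcov b
  exact contMDiffAt_of_charts (quotChart_mem_maximalAtlas hι hq hcov hG S)
    (quotChart_mem_maximalAtlas hι hq hcov hG T) ⟨a, hS, ha⟩ ⟨b, hT, hb⟩ hf.continuousAt
    (contDiffAt_quotChart_comp hι hq hG hg₀ h₀ S T ⟨a, hS, ha⟩ ⟨b, hT, hb⟩)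

-- In slice charts the quotient map is the projection `E × G → E`; the complement is the space of
-- orbit directions.
include hG in
theorem isSubmersion_quotient (e : L ≃L[ℝ] E × G) :
    letI := quotCharted hι hq hcov
    letI := repCharted hι e hcov
    Manifold.IsSubmersion 𝓘(ℝ, L) 𝓘(ℝ, E) ∞ q := by
  letI := quotCharted hι hq hcov
  letI := repCharted hι e hcov
  refine ⟨Shrink.{0} G, inferInstance, inferInstance, fun a => ?_⟩
  obtain ⟨S, hS⟩ := hcov a
  let e' : L ≃L[ℝ] E × Shrink.{0} G :=
    e.trans ((ContinuousLinearEquiv.refl ℝ E).prodCongr (Shrink.continuousLinearEquiv ℝ G).symm)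
  refine Manifold.IsSubmersionAtOfComplement.mk_of_charts e' (S.repChart hι e)
    (S.quotChart hι hq) hS ⟨a, hS, rfl⟩ (repChart_mem_maximalAtlas hι hcov e S)
    (quotChart_mem_maximalAtlas hι hq hcov hG S) (fun b hb => ⟨b, hb, rfl⟩) ?_
  intro y hy
  have hy' : (e y, 0) ∈ S.Θ.target := by
      rw [OpenPartialHomeomorph.extend_target] at hy
      exact hy.1
  change S.quotFun (q (invFun ι (S.Θ.symm (e y, 0)))) = (e y).1
  have hl := S.invFun_lift hy'
  rw [S.quotFun_apply (by rw [hl]; exact S.Θ.map_target hy'), hl, S.Θ.right_inv hy']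

/-- In slice charts the inclusion is `p ↦ (p, 0)`; the complement is the space `K` of values of the
equations. -/
theorem isSmoothEmbedding_incl (e : L ≃L[ℝ] E × G) (eX : ((E × G) × K) ≃L[ℝ] X) :
    letI := repCharted hι e hcov
    Manifold.IsSmoothEmbedding 𝓘(ℝ, L) 𝓘(ℝ, X) ∞ ι := by
  letI := repCharted hι e hcov
  refine ⟨⟨K, inferInstance, inferInstance, fun a => ?_⟩, hι⟩
  obtain ⟨S, hS⟩ := hcov a
  let e' : (L × K) ≃L[ℝ] X := (e.prodCongr (ContinuousLinearEquiv.refl ℝ K)).trans eX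
  refine Manifold.IsImmersionAtOfComplement.mk_of_charts e' (S.repChart hι e)
    (S.Θ.trans eX.toHomeomorph.toOpenPartialHomeomorph) hS (by simpa using hS)
    (repChart_mem_maximalAtlas hι hcov e S) ?_ (fun b hb => ⟨hb, mem_univ _⟩) ?_
  · apply StructureGroupoid.mem_maximalAtlas_of_mem_groupoid
    rw [contDiffGroupoid, mem_groupoid_of_pregroupoid]
    constructor
    · have : ContDiffOn ℝ ∞ (fun x => eX (S.Θ x)) S.Θ.source :=
        eX.contDiff.comp_contDiffOn S.contDiffOn
      simpa [contDiffPregroupoid, comp_def] using this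
    · have : ContDiffOn ℝ ∞ (fun x => S.Θ.symm (eX.symm x)) (eX.symm ⁻¹' S.Θ.target) :=
        S.contDiffOn_symm.comp eX.symm.contDiff.contDiffOn fun x hx => hx
      simpa [contDiffPregroupoid, comp_def] using this
  · intro y hy
    have hy' : (e y, 0) ∈ S.Θ.target := by
      rw [OpenPartialHomeomorph.extend_target] at hy
      exact hy.1
    change eX (S.Θ (ι (invFun ι (S.Θ.symm (e y, 0))))) = eX (e y, 0)
    rw [S.invFun_lift hy', S.Θ.right_inv hy']

end SliceChart

end SliceManifold

namespace SliceManifold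

/-! ### Quotients of manifolds by folding charts -/

section Fold

variable {E M Y : Type} [NormedAddCommGroup E] [NormedSpace ℝ E] [TopologicalSpace M]
  [TopologicalSpace Y]

/-- A chart `κ` of `M` together with an open map `s` of the model space, such that the fibres of
`π` in the domain of `κ` are the fibres of `s`. -/
structure FoldChart (E : Type) [NormedAddCommGroup E] [NormedSpace ℝ E] (π : M → Y) where
  /-- the chart of the total space -/
  κ : OpenPartialHomeomorph M E
  /-- the folding map -/
  s : E → E
  isOpenMap : IsOpenMap s
  contDiff : ContDiff ℝ ∞ s
  eq_iff : ∀ x ∈ κ.source, ∀ x' ∈ κ.source, π x = π x' ↔ s (κ x) = s (κ x')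

namespace FoldChart

variable {π : M → Y} (C : FoldChart E π)

/-- Germs at `s p` are tested on germs at `p`. This replaces local sections, which the folding map
lacks at branch points. -/
theorem map_nhds (p : E) : map C.s (𝓝 p) = 𝓝 (C.s p) :=
  C.isOpenMap.map_nhds_eq C.contDiff.continuous.continuousAt

open Classical in
/-- The coordinates on the quotient. -/
def quotFun (y : Y) : E := if h : ∃ x ∈ C.κ.source, π x = y then C.s (C.κ h.choose) else 0

theorem quotFun_apply {x : M} (hx : x ∈ C.κ.source) : C.quotFun (π x) = C.s (C.κ x) := by
  have h : ∃ x' ∈ C.κ.source, π x' = π x := ⟨x, hx, rfl⟩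
  rw [quotFun, dif_pos h]
  exact (C.eq_iff _ h.choose_spec.1 _ hx).mp h.choose_spec.2

variable [Nonempty E]

open Classical in
/-- The inverse of the coordinates on the quotient. -/
def quotInv (u : E) : Y :=
  π (C.κ.symm (if h : ∃ p ∈ C.κ.target, C.s p = u then h.choose else 0))

theorem quotInv_apply {p : E} (hp : p ∈ C.κ.target) : C.quotInv (C.s p) = π (C.κ.symm p) := by
  have h : ∃ p' ∈ C.κ.target, C.s p' = C.s p := ⟨p, hp, rfl⟩
  rw [quotInv, dif_pos h, C.eq_iff _ (C.κ.map_target h.choose_spec.1) _ (C.κ.map_target hp),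
    C.κ.right_inv h.choose_spec.1, C.κ.right_inv hp]
  exact h.choose_spec.2

/-- The chart of the quotient. -/
def chart (hπ : IsOpenQuotientMap π) : OpenPartialHomeomorph Y E where
  toFun := C.quotFun
  invFun := C.quotInv
  source := π '' C.κ.source
  target := C.s '' C.κ.target
  map_source' := by
    rintro _ ⟨x, hx, rfl⟩
    exact ⟨C.κ x, C.κ.map_source hx, (C.quotFun_apply hx).symm⟩
  map_target' := by
    rintro _ ⟨p, hp, rfl⟩
    exact ⟨_, C.κ.map_target hp, (C.quotInv_apply hp).symm⟩
  left_inv' := by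
    rintro _ ⟨x, hx, rfl⟩
    rw [C.quotFun_apply hx, C.quotInv_apply (C.κ.map_source hx), C.κ.left_inv hx]
  right_inv' := by
    rintro _ ⟨p, hp, rfl⟩
    rw [C.quotInv_apply hp, C.quotFun_apply (C.κ.map_target hp), C.κ.right_inv hp]
  open_source := hπ.isOpenMap _ C.κ.open_source
  open_target := C.isOpenMap _ C.κ.open_target
  continuousOn_toFun := by
    rintro _ ⟨x, hx, rfl⟩
    refine ContinuousAt.continuousWithinAt ?_
    rw [ContinuousAt, ← hπ.map_nhds_eq, tendsto_map'_iff, C.quotFun_apply hx]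
    refine Tendsto.congr' ?_ (C.contDiff.continuous.continuousAt.comp (C.κ.continuousAt hx))
    filter_upwards [C.κ.open_source.mem_nhds hx] with x' hx'
    exact (C.quotFun_apply hx').symm
  continuousOn_invFun := by
    rintro _ ⟨p, hp, rfl⟩
    refine ContinuousAt.continuousWithinAt ?_
    rw [ContinuousAt, ← C.map_nhds, tendsto_map'_iff, C.quotInv_apply hp]
    refine Tendsto.congr' ?_ (hπ.continuous.continuousAt.comp (C.κ.symm.continuousAt hp))
    filter_upwards [C.κ.open_target.mem_nhds hp] with p' hp'
    exact (C.quotInv_apply hp').symm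

/-- The smoothness of coordinate changes may be checked before folding. -/
theorem contDiffAt_chart {hπ : IsOpenQuotientMap π} (D : FoldChart E π) {x : M}
    (hx : x ∈ C.κ.source) {T : E → E} (hT : ContDiffAt ℝ ∞ T (C.s (C.κ x)))
    (h : ∀ᶠ p in 𝓝 (C.κ x), D.chart hπ (π (C.κ.symm p)) = T (C.s p)) :
    ContDiffAt ℝ ∞ (fun u => D.chart hπ ((C.chart hπ).symm u)) (C.chart hπ (π x)) := by
  have h0 : C.chart hπ (π x) = C.s (C.κ x) := C.quotFun_apply hx
  rw [h0]
  refine hT.congr_of_eventuallyEq ?_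
  rw [EventuallyEq, ← C.map_nhds, eventually_map]
  filter_upwards [h, C.κ.open_target.mem_nhds (C.κ.map_source hx)] with p hp hp'
  rw [← hp]
  congr 1
  exact C.quotInv_apply hp'

/-- If the folding map has a smooth local section, coordinate changes are smooth. -/
theorem contDiffAt_chart_of_section [ChartedSpace E M] [IsManifold 𝓘(ℝ, E) ∞ M]
    {hπ : IsOpenQuotientMap π} (D : FoldChart E π)
    (hC : C.κ ∈ IsManifold.maximalAtlas 𝓘(ℝ, E) ∞ M)
    (hD : D.κ ∈ IsManifold.maximalAtlas 𝓘(ℝ, E) ∞ M)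
    {g : M → M} (hg : ContMDiff 𝓘(ℝ, E) 𝓘(ℝ, E) ∞ g) (hgπ : ∀ x, π (g x) = π x) {x : M}
    (hx : x ∈ C.κ.source) (hgx : g x ∈ D.κ.source) {r : E → E}
    (hr : ContDiffAt ℝ ∞ r (C.s (C.κ x)))
    (hrs : ∀ᶠ p in 𝓝 (C.κ x), r (C.s p) = p) :
    ContDiffAt ℝ ∞ (fun u => D.chart hπ ((C.chart hπ).symm u)) (C.chart hπ (π x)) := by
  have h1 : ContDiffAt ℝ ∞ (fun p => D.κ (g (C.κ.symm p))) (C.κ x) := by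
    have h2 := (contMDiffWithinAt_iff_of_mem_maximalAtlas hC hD hx hgx).mp (hg x)
    have h3 := h2.2
    simpa [contDiffWithinAt_univ, comp_def] using h3
  have hrx : r (C.s (C.κ x)) = C.κ x := hrs.self_of_nhds
  refine C.contDiffAt_chart D hx (T := fun u => D.s (D.κ (g (C.κ.symm (r u))))) ?_ ?_
  · refine D.contDiff.contDiffAt.comp _ (ContDiffAt.comp (C.s (C.κ x))
      (g := fun p => D.κ (g (C.κ.symm p))) ?_ hr)
    rwa [hrx]
  · have h4 : ∀ᶠ p in 𝓝 (C.κ x), g (C.κ.symm p) ∈ D.κ.source := by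
      have : ContinuousAt (fun p => g (C.κ.symm p)) (C.κ x) :=
        hg.continuous.continuousAt.comp (C.κ.symm.continuousAt (C.κ.map_source hx))
      refine this.preimage_mem_nhds (D.κ.open_source.mem_nhds ?_)
      rwa [C.κ.left_inv hx]
    filter_upwards [hrs, h4] with p hp hp'
    rw [hp, ← hgπ]
    exact D.quotFun_apply hp'

/-- Between the chart upstairs and its folded chart, `π` reads as the smooth map `s`. -/
theorem contMDiffAt_of_compatible [ChartedSpace E M] [ChartedSpace E Y]
    [IsManifold 𝓘(ℝ, E) ∞ M] [IsManifold 𝓘(ℝ, E) ∞ Y]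
    {hπ : IsOpenQuotientMap π}
    (hC : C.κ ∈ IsManifold.maximalAtlas 𝓘(ℝ, E) ∞ M)
    (hC' : C.chart hπ ∈ IsManifold.maximalAtlas 𝓘(ℝ, E) ∞ Y) {x : M} (hx : x ∈ C.κ.source) :
    ContMDiffAt 𝓘(ℝ, E) 𝓘(ℝ, E) ∞ π x := by
  refine contMDiffAt_of_charts hC hC' hx ⟨x, hx, rfl⟩ hπ.continuous.continuousAt ?_
  refine C.contDiff.contDiffAt.congr_of_eventuallyEq ?_
  filter_upwards [C.κ.open_target.mem_nhds (C.κ.map_source hx)] with p hp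
  change C.quotFun _ = _
  rw [C.quotFun_apply (C.κ.map_target hp), C.κ.right_inv hp]

end FoldChart

end Fold

/-! ### Branched double quotients -/

/-- The splitting of the last two coordinates of `ℝ⁶` as a complex number. -/
def splitC : EuclideanSpace ℝ (Fin 6) ≃L[ℝ] (Fin 4 → ℝ) × ℂ :=
  LinearEquiv.toContinuousLinearEquiv
    { toFun := fun y => (![y 0, y 1, y 2, y 3], ⟨y 4, y 5⟩)
      invFun := fun p => WithLp.toLp 2 ![p.1 0, p.1 1, p.1 2, p.1 3, p.2.re, p.2.im]
      map_add' := fun y y' => by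
        ext i
        · fin_cases i <;> simp
        · rfl
      map_smul' := fun c y => by
        ext i
        · fin_cases i <;> simp
        · simpa using Complex.ext (by simp) (by simp)
      left_inv := fun y => by ext i; fin_cases i <;> simp
      right_inv := fun p => by
        ext i
        · fin_cases i <;> simp
        · simp }

theorem splitC_apply (y : EuclideanSpace ℝ (Fin 6)) :
    splitC y = (![y 0, y 1, y 2, y 3], ⟨y 4, y 5⟩) := rfl

/-- The reflection `(w, z) ↦ (w, -z)`. -/
def reflectC (y : EuclideanSpace ℝ (Fin 6)) : EuclideanSpace ℝ (Fin 6) :=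
  splitC.symm ((splitC y).1, -(splitC y).2)

/-- The folding map `(w, z) ↦ (w, z ^ 2)`. -/
def squareC (y : EuclideanSpace ℝ (Fin 6)) : EuclideanSpace ℝ (Fin 6) :=
  splitC.symm ((splitC y).1, (splitC y).2 ^ 2)

theorem splitC_squareC (y : EuclideanSpace ℝ (Fin 6)) :
    splitC (squareC y) = ((splitC y).1, (splitC y).2 ^ 2) := splitC.apply_symm_apply _

theorem splitC_reflectC (y : EuclideanSpace ℝ (Fin 6)) :
    splitC (reflectC y) = ((splitC y).1, -(splitC y).2) := splitC.apply_symm_apply _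

theorem squareC_eq_iff (y y' : EuclideanSpace ℝ (Fin 6)) :
    squareC y = squareC y' ↔ y' = y ∨ y' = reflectC y := by
  rw [← splitC.injective.eq_iff, splitC_squareC, splitC_squareC,
    ← splitC.injective.eq_iff (a := y'), ← splitC.injective.eq_iff (a := y'), splitC_reflectC,
    Prod.ext_iff, Prod.ext_iff, Prod.ext_iff, sq_eq_sq_iff_eq_or_eq_neg]
  constructor
  · rintro ⟨h, h' | h'⟩
    · exact Or.inl ⟨h.symm, h'.symm⟩
    · exact Or.inr ⟨h.symm, by rw [h', neg_neg]⟩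
  · rintro (⟨h, h'⟩ | ⟨h, h'⟩)
    · exact ⟨h.symm, Or.inl h'.symm⟩
    · exact ⟨h.symm, Or.inr (by rw [h', neg_neg])⟩

theorem reflectC_eq_self_iff (y : EuclideanSpace ℝ (Fin 6)) :
    reflectC y = y ↔ (splitC y).2 = 0 := by
  rw [← splitC.injective.eq_iff, splitC_reflectC, Prod.ext_iff]
  simp [neg_eq_self]

theorem contDiff_squareC : ContDiff ℝ ∞ squareC := by
  refine splitC.symm.contDiff.comp (ContDiff.prodMk ?_ ?_)
  · exact contDiff_fst.comp splitC.contDiff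
  · exact (contDiff_snd.comp splitC.contDiff).pow 2

/-- The open mapping theorem for a non-constant analytic function; the values at `0` and `1` exclude
the constant case. -/
theorem isOpenMap_sq_complex : IsOpenMap (fun z : ℂ => z ^ 2) := by
  have h : AnalyticOnNhd ℂ (fun z : ℂ => z ^ 2) univ := fun z _ => analyticAt_id.pow 2
  rcases h.is_constant_or_isOpen isPreconnected_univ with ⟨w, hw⟩ | h
  · have h0 := hw 0 (mem_univ _)
    have h1 := hw 1 (mem_univ _)
    rw [← h0] at h1
    norm_num at h1
  · exact fun s hs => h s (subset_univ _) hs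

theorem isOpenMap_squareC : IsOpenMap squareC :=
  splitC.symm.toHomeomorph.isOpenMap.comp
    ((IsOpenMap.id.prodMap isOpenMap_sq_complex).comp splitC.toHomeomorph.isOpenMap)

/-- Away from the branch locus, the folding map has smooth local sections. -/
theorem exists_section_squareC {y : EuclideanSpace ℝ (Fin 6)} (hy : (splitC y).2 ≠ 0) :
    ∃ r : EuclideanSpace ℝ (Fin 6) → EuclideanSpace ℝ (Fin 6),
      ContDiffAt ℝ ∞ r (squareC y) ∧ ∀ᶠ p in 𝓝 y, r (squareC p) = p := by
  set z₀ := (splitC y).2 with hz₀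
  -- the branch of the square root through `z₀`
  let ρ : ℂ → ℂ := fun ζ => z₀ * Complex.exp (Complex.log (ζ / z₀ ^ 2) / 2)
  have hρ : ContDiffAt ℝ ∞ ρ (z₀ ^ 2) := by
    have h1 : ContDiffAt ℂ ∞ Complex.log (z₀ ^ 2 / z₀ ^ 2) := by
      rw [div_self (pow_ne_zero 2 hy)]
      exact Complex.contDiffAt_log (by simp)
    have h2 : ContDiffAt ℂ ∞ ρ (z₀ ^ 2) := by
      refine contDiffAt_const.mul (ContDiffAt.cexp (ContDiffAt.div_const ?_ 2))
      exact ContDiffAt.comp (z₀ ^ 2) (f := fun ζ => ζ / z₀ ^ 2) h1 (contDiffAt_id.div_const _)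
    exact h2.restrict_scalars ℝ
  have hρs : ∀ᶠ z in 𝓝 z₀, ρ (z ^ 2) = z := by
    have hc : ContinuousAt (fun z : ℂ => z / z₀) z₀ := continuousAt_id.div_const _
    have hpos : ∀ᶠ z in 𝓝 z₀, 0 < (z / z₀).re := by
      refine (Complex.continuous_re.continuousAt.comp hc).eventually (lt_mem_nhds ?_)
      simp [div_self hy]
    filter_upwards [hpos] with z hz
    have hne : z / z₀ ≠ 0 := by
      intro h
      rw [h] at hz
      simp at hz
    have harg : Complex.arg (z / z₀) ∈ Ioo (-(Real.pi / 2)) (Real.pi / 2) := by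
      rw [mem_Ioo, ← abs_lt, Complex.abs_arg_lt_pi_div_two_iff]
      exact Or.inl hz
    have hπ := Real.pi_pos
    -- For `z / z₀` in the right half-plane, doubling the argument stays within `(-π, π)`, so the
    -- principal logarithm doubles as well.
    have hlog : Complex.log (z ^ 2 / z₀ ^ 2) = 2 * Complex.log (z / z₀) := by
      rw [← div_pow, ← Complex.exp_log hne, ← Complex.exp_nat_mul, Complex.log_exp,
        Complex.log_exp]
      · norm_num
      · rw [Complex.log_im]; linarith [harg.1]
      · rw [Complex.log_im]; linarith [harg.2]
      · simp only [Complex.mul_im, Complex.log_im, Nat.cast_ofNat, Complex.re_ofNat,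
          Complex.im_ofNat, zero_mul, add_zero]; linarith [harg.1]
      · simp only [Complex.mul_im, Complex.log_im, Nat.cast_ofNat, Complex.re_ofNat,
          Complex.im_ofNat, zero_mul, add_zero]; linarith [harg.2]
    change z₀ * Complex.exp (Complex.log (z ^ 2 / z₀ ^ 2) / 2) = z
    rw [hlog, mul_div_cancel_left₀ _ two_ne_zero, Complex.exp_log hne, mul_div_cancel₀ _ hy]
  refine ⟨fun u => splitC.symm ((splitC u).1, ρ (splitC u).2), ?_, ?_⟩
  · refine splitC.symm.contDiff.contDiffAt.comp _ (ContDiffAt.prodMk ?_ ?_)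
    · exact (contDiff_fst.comp splitC.contDiff).contDiffAt
    · refine ContDiffAt.comp (squareC y) (g := ρ) ?_ (contDiff_snd.comp splitC.contDiff).contDiffAt
      change ContDiffAt ℝ ∞ ρ (splitC (squareC y)).2
      rw [splitC_squareC]
      exact hρ
  · have hc : ContinuousAt (fun p => (splitC p).2) y :=
      (continuous_snd.comp splitC.continuous).continuousAt
    filter_upwards [hc.eventually hρs] with p hp
    rw [splitC_squareC, hp]
    exact splitC.symm_apply_apply p

section Branched

variable {M Y : Type} [TopologicalSpace M] [TopologicalSpace Y] [T2Space M]
  [ChartedSpace (EuclideanSpace ℝ (Fin 6)) M] [IsManifold (𝓡 6) ∞ M]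

/-- The quotient of a 6-manifold by a smooth involution is smoothable, and the quotient map is
smooth, if near the fixed points there are charts in which the involution is `(w, z) ↦ (w, -z)`,
and which are related by coordinate changes that are isometric in `z`. -/
theorem exists_smooth_branched_quotient {ν : M → M} (hν : ContMDiff (𝓡 6) (𝓡 6) ∞ ν)
    (hνν : Involutive ν) {π : M → Y} (hπ : IsOpenQuotientMap π)
    (hfib : ∀ x x', π x = π x' ↔ x' = x ∨ x' = ν x)
    (A : Set (OpenPartialHomeomorph M (EuclideanSpace ℝ (Fin 6))))
    (hA : ∀ κ ∈ A, κ ∈ IsManifold.maximalAtlas (𝓡 6) ∞ M)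
    (hAcov : ∀ x, ν x = x → ∃ κ ∈ A, x ∈ κ.source)
    (hAν : ∀ κ ∈ A, ∀ x ∈ κ.source, ν x ∈ κ.source ∧ κ (ν x) = reflectC (κ x))
    (hAcompat : ∀ κ ∈ A, ∀ κ' ∈ A, ∀ x ∈ κ.source, x ∈ κ'.source → ν x = x →
      ∃ (f : (Fin 4 → ℝ) → (Fin 4 → ℝ)) (α β : (Fin 4 → ℝ) → ℂ),
        ContDiffAt ℝ ∞ f (splitC (κ x)).1 ∧ ContDiffAt ℝ ∞ α (splitC (κ x)).1 ∧
        ContDiffAt ℝ ∞ β (splitC (κ x)).1 ∧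
        ∀ᶠ x' in 𝓝 x, (splitC (κ' x')).1 = f (splitC (κ x')).1 ∧
          α (splitC (κ x')).1 * β (splitC (κ x')).1 = 0 ∧
          (splitC (κ' x')).2 = α (splitC (κ x')).1 * (splitC (κ x')).2 +
            β (splitC (κ x')).1 * (starRingEnd ℂ) (splitC (κ x')).2) :
    ∃ _ : ChartedSpace (EuclideanSpace ℝ (Fin 6)) Y,
      IsManifold (𝓡 6) ∞ Y ∧ ContMDiff (𝓡 6) (𝓡 6) ∞ π := by
  -- Two kinds of charts: unfolded ones containing no fixed point, and squared ones from the family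
  -- `A`.
  let 𝒞 : Type := {C : FoldChart (EuclideanSpace ℝ (Fin 6)) π //
    C.κ ∈ IsManifold.maximalAtlas (𝓡 6) ∞ M ∧
    ((C.s = id ∧ ∀ x ∈ C.κ.source, ν x ≠ x) ∨ (C.s = squareC ∧ C.κ ∈ A))}
  have hcov : ∀ x, ∃ C : 𝒞, x ∈ C.1.κ.source := by
    intro x
    by_cases hx : ν x = x
    · obtain ⟨κ, hκ, hxκ⟩ := hAcov x hx
      refine ⟨⟨⟨κ, squareC, isOpenMap_squareC, contDiff_squareC, fun a ha b hb => ?_⟩, hA κ hκ,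
        Or.inr ⟨rfl, hκ⟩⟩, hxκ⟩
      rw [hfib, squareC_eq_iff, ← (hAν κ hκ a ha).2, κ.injOn.eq_iff hb ha,
        κ.injOn.eq_iff hb (hAν κ hκ a ha).1]
    -- Points of `V` that `ν` sends into `U` form a neighbourhood of `x` disjoint from its image
    -- under `ν`, so `π` is injective on it.
    · obtain ⟨U, V, hU, hV, hxU, hxV, hUV⟩ := t2_separation hx
      have hO : IsOpen (V ∩ ν ⁻¹' U) := hV.inter (hU.preimage hν.continuous)
      let κ := (chartAt (EuclideanSpace ℝ (Fin 6)) x).restr (V ∩ ν ⁻¹' U)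
      have hsrc : ∀ a ∈ κ.source, a ∈ V ∧ ν a ∈ U := by
        intro a ha
        rw [OpenPartialHomeomorph.restr_source, hO.interior_eq] at ha
        exact ha.2
      have hne : ∀ a ∈ κ.source, ∀ b ∈ κ.source, b ≠ ν a := by
        rintro a ha b hb rfl
        exact disjoint_left.mp hUV (hsrc a ha).2 (hsrc _ hb).1
      refine ⟨⟨⟨κ, id, IsOpenMap.id, contDiff_id, fun a ha b hb => ?_⟩,
        restr_mem_maximalAtlas (contDiffGroupoid ∞ (𝓡 6))
          (IsManifold.chart_mem_maximalAtlas x) hO, Or.inl ⟨rfl, fun a ha h => ?_⟩⟩, ?_⟩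
      · rw [hfib, id, id]
        constructor
        · rintro (h | h)
          · rw [h]
          · exact absurd h (hne a ha b hb)
        · intro h
          exact Or.inl (κ.injOn ha hb h).symm
      · exact hne a ha a ha h.symm
      · change x ∈ κ.source
        rw [OpenPartialHomeomorph.restr_source, hO.interior_eq]
        exact ⟨mem_chart_source _ x, hxV, hxU⟩
  have hcovY : ∀ y, ∃ C : 𝒞, y ∈ (C.1.chart hπ).source := by
    intro y
    obtain ⟨x, rfl⟩ := hπ.surjective y
    obtain ⟨C, hC⟩ := hcov x
    exact ⟨C, x, hC, rfl⟩
  let inst := chartedSpaceOf (fun C : 𝒞 => C.1.chart hπ) hcovY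
  have hM : IsManifold (𝓡 6) ∞ Y := by
    refine isManifold_chartedSpaceOf _ _ ?_
    rintro ⟨C, hC, hC'⟩ ⟨D, hD, hD'⟩ y ⟨x, hx, rfl⟩ ⟨x', hx', hxx'⟩
    -- a smooth map commuting with `π` and mapping `x` to `x'`
    obtain ⟨g, hg, hgπ, hgx⟩ : ∃ g : M → M, ContMDiff (𝓡 6) (𝓡 6) ∞ g ∧ (∀ x, π (g x) = π x) ∧
        g x = x' := by
      rcases (hfib x x').mp hxx'.symm with h | h
      · exact ⟨id, contMDiff_id, fun _ => rfl, h.symm⟩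
      · exact ⟨ν, hν, fun x => ((hfib x (ν x)).mpr (Or.inr rfl)).symm, h.symm⟩
    replace hx : x ∈ C.κ.source := hx
    replace hx' : g x ∈ D.κ.source := by rw [hgx]; exact hx'
    rcases hC' with ⟨hs, -⟩ | ⟨hs, hCA⟩
    · exact C.contDiffAt_chart_of_section D hC hD hg hgπ hx hx' (r := id) contDiffAt_id
        (by simp [hs])
    -- Off the branch locus the square has a smooth local section. On it, `x` is a fixed point, so
    -- the second chart must be a squared one too and the special form of the transition is needed.
    · by_cases h0 : (splitC (C.κ x)).2 = 0
      · have hfix : ν x = x := by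
          have h1 := hAν _ hCA x hx
          rw [(reflectC_eq_self_iff _).mpr h0] at h1
          exact C.κ.injOn h1.1 hx h1.2
        have hgx : g x = x := by
          rcases (hfib x (g x)).mp (hgπ x).symm with h | h
          · exact h
          · rw [h, hfix]
        rw [hgx] at hx'
        rcases hD' with ⟨-, hD'⟩ | ⟨hs', hDA⟩
        · exact absurd hfix (hD' x hx')
        · obtain ⟨f, α, β, hf, hα, hβ, hev⟩ := hAcompat _ hCA _ hDA x hx hx' hfix
          -- The square of `αz + βz̄` written in terms of `z²`; the mixed term `2αβ|z|²`, not smooth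
          -- in `z²`, disappears because `αβ = 0`.
          let T : EuclideanSpace ℝ (Fin 6) → EuclideanSpace ℝ (Fin 6) := fun u =>
            splitC.symm (f (splitC u).1, α (splitC u).1 ^ 2 * (splitC u).2 +
              β (splitC u).1 ^ 2 * Complex.conjCLE (splitC u).2)
          have h1 : (splitC (C.s (C.κ x))).1 = (splitC (C.κ x)).1 := by
            rw [hs, splitC_squareC]
          have hfst : ContDiffAt ℝ ∞ (fun u => (splitC u).1) (C.s (C.κ x)) :=
            (contDiff_fst.comp splitC.contDiff).contDiffAt
          have hsnd : ContDiffAt ℝ ∞ (fun u => (splitC u).2) (C.s (C.κ x)) :=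
            (contDiff_snd.comp splitC.contDiff).contDiffAt
          rw [← h1] at hf hα hβ
          refine C.contDiffAt_chart D hx (T := T) ?_ ?_
          · refine splitC.symm.contDiff.contDiffAt.comp _ (ContDiffAt.prodMk ?_ ?_)
            · exact hf.comp (C.s (C.κ x)) hfst
            · refine ContDiffAt.add (ContDiffAt.mul ?_ hsnd) (ContDiffAt.mul ?_ ?_)
              · exact (hα.comp (C.s (C.κ x)) hfst).pow 2
              · exact (hβ.comp (C.s (C.κ x)) hfst).pow 2
              · exact Complex.conjCLE.contDiff.contDiffAt.comp _ hsnd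
          · have hcont : ContinuousAt C.κ.symm (C.κ x) :=
              C.κ.symm.continuousAt (C.κ.map_source hx)
            have hev' := hcont.eventually (by rwa [C.κ.left_inv hx])
            have hD'' := hcont.eventually
              (show ∀ᶠ a in 𝓝 (C.κ.symm (C.κ x)), a ∈ D.κ.source by
                rw [C.κ.left_inv hx]
                exact D.κ.open_source.mem_nhds hx')
            filter_upwards [hev', hD'', C.κ.open_target.mem_nhds (C.κ.map_source hx)]
              with p hp hpD hpC
            rw [C.κ.right_inv hpC] at hp
            have hq : D.chart hπ (π (C.κ.symm p)) = D.s (D.κ (C.κ.symm p)) := D.quotFun_apply hpD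
            rw [hq, hs', hs, ← splitC.injective.eq_iff, splitC_squareC]
            change _ = splitC (splitC.symm _)
            rw [splitC.apply_symm_apply, splitC_squareC, hp.1, hp.2.2]
            refine Prod.ext rfl ?_
            simp only [Complex.conjCLE_apply, map_pow]
            linear_combination 2 * (splitC p).2 * (starRingEnd ℂ) (splitC p).2 * hp.2.1
      · obtain ⟨r, hr, hrs⟩ := exists_section_squareC h0
        exact C.contDiffAt_chart_of_section D hC hD hg hgπ hx hx' (r := r) (by rwa [hs])
          (by rwa [hs])
  refine ⟨inst, hM, fun x => ?_⟩
  obtain ⟨C, hC⟩ := hcov x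
  exact C.1.contMDiffAt_of_compatible C.2.1 (hπ := hπ)
    (IsManifold.subset_maximalAtlas (mem_range_self C)) hC

end Branched

end SliceManifold

/-! ### The inverse function theorem on an open domain -/

namespace SliceManifold

/-- The inverse function theorem, with smoothness in both directions on the whole domain. -/
theorem exists_local_diffeo {E F : Type} [NormedAddCommGroup E] [NormedSpace ℝ E]
    [FiniteDimensional ℝ E] [NormedAddCommGroup F] [NormedSpace ℝ F] [FiniteDimensional ℝ F]
    {f : E → F} {U : Set E} (hU : IsOpen U) (hf : ContDiffOn ℝ ∞ f U) {x : E} (hx : x ∈ U)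
    (hinj : ∀ v, fderiv ℝ f x v = 0 → v = 0)
    (hfin : Module.finrank ℝ E = Module.finrank ℝ F) :
    ∃ e : OpenPartialHomeomorph E F, x ∈ e.source ∧ e.source ⊆ U ∧ (e : E → F) = f ∧
      ContDiffOn ℝ ∞ e e.source ∧ ContDiffOn ℝ ∞ e.symm e.target := by
  let L : E ≃L[ℝ] F := ContinuousLinearEquiv.ofBijective (fderiv ℝ f x)
    (LinearMap.ker_eq_bot'.mpr hinj)
    (LinearMap.range_eq_top.mpr ((LinearMap.injective_iff_surjective_of_finrank_eq_finrank hfin).mp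
      (LinearMap.ker_eq_bot.mp (LinearMap.ker_eq_bot'.mpr hinj))))
  have hL : (L : E →L[ℝ] F) = fderiv ℝ f x := ContinuousLinearMap.ext fun v => rfl
  have hfx : ContDiffAt ℝ ∞ f x := hf.contDiffAt (hU.mem_nhds hx)
  have hd : HasFDerivAt f (L : E →L[ℝ] F) x := by
    rw [hL]
    exact (hfx.differentiableAt (by simp)).hasFDerivAt
  let e₀ := hfx.toOpenPartialHomeomorph f hd (by simp)
  have he₀ : (e₀ : E → F) = f := ContDiffAt.toOpenPartialHomeomorph_coe hfx hd (by simp)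
  have hcont : ContinuousOn (fderiv ℝ f) U := hf.continuousOn_fderiv_of_isOpen hU (by simp)
  -- Invertibility of the derivative is an open condition; restricting to it makes the inverse
  -- smooth on the whole target and not only at one point.
  have hV : IsOpen (U ∩ fderiv ℝ f ⁻¹' range ((↑) : (E ≃L[ℝ] F) → E →L[ℝ] F)) :=
    hcont.isOpen_inter_preimage hU ContinuousLinearEquiv.isOpen
  refine ⟨e₀.restrOpen _ hV, ?_, ?_, he₀, ?_, ?_⟩
  · exact ⟨ContDiffAt.mem_toOpenPartialHomeomorph_source hfx hd (by simp), hx, L, hL⟩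
  · exact fun y hy => hy.2.1
  · change ContDiffOn ℝ ∞ e₀ _
    rw [he₀]
    exact hf.mono fun y hy => hy.2.1
  · intro y hy
    refine ContDiffAt.contDiffWithinAt ?_
    have hy' := (e₀.restrOpen _ hV).map_target hy
    obtain ⟨hy1, hy2, L', hL'⟩ := hy'
    have hyt : y ∈ e₀.target := by
      have := e₀.map_source hy1
      rwa [show (e₀.restrOpen _ hV).symm y = e₀.symm y from rfl, e₀.right_inv] at this
      have h := hy
      rw [OpenPartialHomeomorph.restrOpen] at h
      exact h.1
    have h1 : ContDiffAt ℝ ∞ f (e₀.symm y) := hf.contDiffAt (hU.mem_nhds hy2)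
    refine e₀.contDiffAt_symm (f₀' := L') hyt ?_ (by rwa [he₀])
    rw [hL', he₀]
    exact (h1.differentiableAt (by simp)).hasFDerivAt

end SliceManifold

namespace SU2Char

/-- The ambient space `ℍ⁶`. -/
abbrev Amb : Type := Fin 6 → ℍ[ℝ]

/-! ### Unit quaternions -/

theorem SU2.normSq (g : SU2) : Quaternion.normSq (g : ℍ[ℝ]) = 1 := by
  have hn : ‖(g : ℍ[ℝ])‖ = 1 := by simp
  rw [Quaternion.normSq_eq_norm_mul_self, hn, one_mul]

theorem SU2.coe_inv (g : SU2) : ((g⁻¹ : SU2) : ℍ[ℝ]) = star (g : ℍ[ℝ]) := by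
  have h2 : ((g⁻¹ : SU2) : ℍ[ℝ]) = (g : ℍ[ℝ])⁻¹ := by simp
  rw [h2, Quaternion.inv_def, SU2.normSq, inv_one, one_smul]

/-- The unit quaternion with a given value. -/
def SU2.mk (x : ℍ[ℝ]) (hx : Quaternion.normSq x = 1) : SU2 :=
  ⟨x, by
    rw [mem_sphere_zero_iff_norm]
    have h := Quaternion.normSq_eq_norm_mul_self x
    rw [hx] at h
    nlinarith [norm_nonneg x]⟩

theorem quaternion_ext_iff' {x y : ℍ[ℝ]} :
    x = y ↔ x.re = y.re ∧ x.imI = y.imI ∧ x.imJ = y.imJ ∧ x.imK = y.imK := by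
  constructor
  · rintro rfl
    exact ⟨rfl, rfl, rfl, rfl⟩
  · rintro ⟨h1, h2, h3, h4⟩
    ext <;> assumption

/-- Two quaternions commute iff the cross product of their imaginary parts vanishes. -/
theorem commute_iff_cross {x y : ℍ[ℝ]} : Commute x y ↔
    x.imJ * y.imK = x.imK * y.imJ ∧ x.imK * y.imI = x.imI * y.imK ∧
      x.imI * y.imJ = x.imJ * y.imI := by
  rw [Commute, SemiconjBy, quaternion_ext_iff']
  simp only [Quaternion.re_mul, Quaternion.imI_mul, Quaternion.imJ_mul, Quaternion.imK_mul]
  constructor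
  · rintro ⟨-, h2, h3, h4⟩
    refine ⟨?_, ?_, ?_⟩ <;> linarith
  · rintro ⟨h2, h3, h4⟩
    refine ⟨?_, ?_, ?_, ?_⟩ <;> linarith

/-- Commuting is transitive away from the real quaternions. -/
theorem commute_of_commute_nonreal {m x y : ℍ[ℝ]} (hm : ¬ (m.imI = 0 ∧ m.imJ = 0 ∧ m.imK = 0))
    (hx : Commute m x) (hy : Commute m y) : Commute x y := by
  rw [commute_iff_cross] at *
  obtain ⟨a1, a2, a3⟩ := hx
  obtain ⟨b1, b2, b3⟩ := hy
  by_cases h1 : m.imI = 0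
  · by_cases h2 : m.imJ = 0
    · have h3 : m.imK ≠ 0 := fun h3 => hm ⟨h1, h2, h3⟩
      simp only [h1, h2, zero_mul, zero_eq_mul, h3, false_or, mul_eq_zero] at a1 a2 b1 b2
      simp [a1, a2, b1, b2]
    · refine ⟨?_, ?_, ?_⟩ <;> apply mul_left_cancel₀ h2 <;> grind
  · refine ⟨?_, ?_, ?_⟩ <;> apply mul_left_cancel₀ h1 <;> grind

theorem SU2.commute_coe_iff {a b : SU2} : Commute a b ↔ Commute (a : ℍ[ℝ]) (b : ℍ[ℝ]) := by
  rw [Commute, SemiconjBy, Commute, SemiconjBy, Subtype.ext_iff]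
  rfl

/-! ### The space of non-abelian traceless representations in `ℍ⁶` -/

/-- The product of the six values. -/
def prod6 (x : Amb) : ℍ[ℝ] := x 0 * x 1 * x 2 * x 3 * x 4 * x 5

/-- The space in which the defining equations take their values. -/
abbrev ConSpace : Type := (Fin 6 → ℝ) × (Fin 6 → ℝ) × (Fin 3 → ℝ)

/-- The imaginary part, as a vector. -/
def imVec : ℍ[ℝ] →ₗ[ℝ] (Fin 3 → ℝ) where
  toFun x := ![x.imI, x.imJ, x.imK]
  map_add' x y := by ext i; fin_cases i <;> simp
  map_smul' c x := by ext i; fin_cases i <;> simp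

theorem imVec_eq_zero {x : ℍ[ℝ]} : imVec x = 0 ↔ x.imI = 0 ∧ x.imJ = 0 ∧ x.imK = 0 := by
  constructor
  · intro h
    exact ⟨congrFun h 0, congrFun h 1, congrFun h 2⟩
  · rintro ⟨h1, h2, h3⟩
    ext i; fin_cases i <;> simp [imVec, h1, h2, h3]

/-- The defining equations of the representation space. -/
def con (x : Amb) : ConSpace :=
  (fun k => (x k).re, fun k => Quaternion.normSq (x k) - 1, imVec (prod6 x))

theorem con_eq_zero_iff {x : Amb} : con x = 0 ↔ (∀ k, (x k).re = 0) ∧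
    (∀ k, Quaternion.normSq (x k) = 1) ∧ imVec (prod6 x) = 0 := by
  simp [con, Prod.ext_iff, funext_iff, sub_eq_zero]

/-- A product of unit quaternions is a unit, so vanishing of its imaginary part leaves only `±1`,
and the sign of the real part selects `1`. Three equations therefore replace the four of `prod6 x =
1`, which is what makes a regular value possible. -/
theorem mem_range_incl_iff {x : Amb} : x ∈ range RepS6Star.incl ↔
    con x = 0 ∧ 0 < (prod6 x).re ∧ ∃ i j, ¬ Commute (x i) (x j) := by
  rw [con_eq_zero_iff]
  constructor
  · rintro ⟨A, rfl⟩
    have hp : prod6 A.incl = 1 := by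
      have := congrArg (Subtype.val) (RepS6.prod_eq_one A.1)
      exact this
    refine ⟨⟨fun k => RepS6.re_eq_zero A.1 k, fun k => SU2.normSq _, ?_⟩, ?_, ?_⟩
    · rw [hp, imVec_eq_zero]; simp
    · rw [hp]; simp
    · obtain ⟨i, j, hij⟩ := (Rep.isNonabelian_iff A.1).mp A.2
      exact ⟨i, j, fun h => hij (SU2.commute_coe_iff.mpr h)⟩
  · rintro ⟨⟨h1, h2, h3⟩, h4, i, j, hij⟩
    rw [imVec_eq_zero] at h3
    have hn : Quaternion.normSq (prod6 x) = 1 := by simp [prod6, h2]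
    have hp : prod6 x = 1 := by
      rw [Quaternion.normSq_def'] at hn
      have : (prod6 x).re = 1 := by
        rw [h3.1, h3.2.1, h3.2.2] at hn
        nlinarith
      rw [quaternion_ext_iff']
      simp [this, h3]
    let a : Fin 6 → SU2 := fun k => SU2.mk (x k) (h2 k)
    have ha : a 0 * a 1 * a 2 * a 3 * a 4 * a 5 = 1 := Subtype.ext hp
    let A : RepS6 := ⟨a, by
      refine ⟨?_, ?_⟩
      · rintro r rfl
        simpa using ha
      · rintro _ ⟨k, rfl⟩
        rw [FreeGroup.lift_apply_of]
        exact h1 k⟩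
    refine ⟨⟨A, (Rep.isNonabelian_iff A).mpr ⟨i, j, fun h => hij ?_⟩⟩, rfl⟩
    exact SU2.commute_coe_iff.mp h

theorem contDiff_component (k : Fin 6) : ContDiff ℝ ∞ (fun x : Amb => x k) :=
  contDiff_apply ℝ ℍ[ℝ] k

theorem contDiff_prod6 : ContDiff ℝ ∞ prod6 := by
  unfold prod6
  have h := contDiff_component
  exact (((((h 0).mul (h 1)).mul (h 2)).mul (h 3)).mul (h 4)).mul (h 5)

theorem contDiff_linear {V W : Type} [NormedAddCommGroup V] [NormedSpace ℝ V]
    [FiniteDimensional ℝ V] [NormedAddCommGroup W] [NormedSpace ℝ W] (f : V →ₗ[ℝ] W) :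
    ContDiff ℝ ∞ f :=
  (LinearMap.toContinuousLinearMap f).contDiff

/-- The four real coordinates of a quaternion. -/
def reL : ℍ[ℝ] →ₗ[ℝ] ℝ where
  toFun x := x.re
  map_add' _ _ := rfl
  map_smul' _ _ := rfl

theorem contDiff_re : ContDiff ℝ ∞ (fun x : ℍ[ℝ] => x.re) := contDiff_linear reL

theorem contDiff_normSq : ContDiff ℝ ∞ (fun x : ℍ[ℝ] => Quaternion.normSq x) := by
  have : (fun x : ℍ[ℝ] => Quaternion.normSq x) = fun x => ‖x‖ ^ 2 := by
    ext x
    rw [Quaternion.normSq_eq_norm_mul_self, sq]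
  rw [this]
  exact contDiff_norm_sq ℝ

theorem contDiff_con : ContDiff ℝ ∞ con := by
  refine ContDiff.prodMk ?_ (ContDiff.prodMk ?_ ?_)
  · exact contDiff_pi.mpr fun k => contDiff_re.comp (contDiff_component k)
  · exact contDiff_pi.mpr fun k =>
      (contDiff_normSq.comp (contDiff_component k)).sub contDiff_const
  · exact (contDiff_linear imVec).comp contDiff_prod6

/-- Positivity of the real part and non-commutation are open conditions, so locally only the
equations remain. -/
theorem eventually_mem_range_iff (A : RepS6Star) :
    ∀ᶠ x in 𝓝 A.incl, x ∈ range RepS6Star.incl ↔ con x = 0 := by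
  obtain ⟨-, h1, i, j, hij⟩ := mem_range_incl_iff.mp ⟨A, rfl⟩
  have e1 : ∀ᶠ x in 𝓝 A.incl, 0 < (prod6 x).re :=
    ((contDiff_re.comp contDiff_prod6).continuous.continuousAt (x := A.incl)).eventually
      (lt_mem_nhds h1)
  have e2 : ∀ᶠ x : Amb in 𝓝 A.incl, x i * x j ≠ x j * x i := by
    have hc : Continuous fun x : Amb => x i * x j - x j * x i := by fun_prop
    have := hc.continuousAt.eventually_ne (x := A.incl) (sub_ne_zero.mpr hij)
    filter_upwards [this] with x hx
    exact sub_ne_zero.mp hx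
  filter_upwards [e1, e2] with x h1 h2
  rw [mem_range_incl_iff]
  exact ⟨fun h => h.1, fun h => ⟨h, h1, i, j, h2⟩⟩

/-! ### The conjugation action -/

/-- Simultaneous conjugation of a tuple, for a unit quaternion `g`. -/
def conjAmb (g : ℍ[ℝ]) (x : Amb) : Amb := fun k => g * x k * star g

theorem contDiff_conjAmb (g : ℍ[ℝ]) : ContDiff ℝ ∞ (conjAmb g) :=
  contDiff_pi.mpr fun k => (contDiff_const.mul (contDiff_component k)).mul contDiff_const

theorem cls_eq_iff {a b : RepS6Star} :
    a.cls = b.cls ↔ ∃ g : SU2, b.incl = conjAmb g a.incl := by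
  have h1 : a.cls = b.cls ↔ a.1.cls = b.1.cls := Subtype.ext_iff
  rw [h1, Rep.cls, Rep.cls, Quotient.eq]
  refine exists_congr fun g => ?_
  rw [funext_iff]
  refine forall_congr' fun i => ?_
  rw [Subtype.ext_iff]
  simp only [RepS6Star.incl, conjAmb, ← SU2.coe_inv]
  rfl

theorem exists_conj (g : SU2) (a : RepS6Star) :
    ∃ b : RepS6Star, b.incl = conjAmb g a.incl ∧ b.cls = a.cls := by
  have key : conjAmb g a.incl ∈ range RepS6Star.incl := by
    have hs : star (g : ℍ[ℝ]) * g = 1 := by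
      rw [← SU2.coe_inv]
      exact congrArg Subtype.val (inv_mul_cancel g)
    have hs' : (g : ℍ[ℝ]) * star (g : ℍ[ℝ]) = 1 := by
      rw [← SU2.coe_inv]
      exact congrArg Subtype.val (mul_inv_cancel g)
    obtain ⟨h, hp, i, j, hij⟩ := mem_range_incl_iff.mp ⟨a, rfl⟩
    have hprod : prod6 (conjAmb g a.incl) = g * prod6 a.incl * star (g : ℍ[ℝ]) := by
      simp only [prod6, conjAmb]
      have : ∀ x y : ℍ[ℝ], (g : ℍ[ℝ]) * x * star (g : ℍ[ℝ]) * (g * y * star (g : ℍ[ℝ])) =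
          g * (x * y) * star (g : ℍ[ℝ]) := fun x y => by
        calc _ = (g : ℍ[ℝ]) * x * (star (g : ℍ[ℝ]) * g) * y * star (g : ℍ[ℝ]) := by
              simp only [mul_assoc]
          _ = _ := by rw [hs]; simp only [mul_assoc, one_mul]
      rw [this, this, this, this, this]
    have hone : prod6 a.incl = 1 := congrArg (Subtype.val) (RepS6.prod_eq_one a.1)
    rw [hone, mul_one, hs'] at hprod
    rw [con_eq_zero_iff] at h
    refine mem_range_incl_iff.mpr ⟨con_eq_zero_iff.mpr ⟨fun k => ?_, fun k => ?_, ?_⟩, ?_,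
      i, j, fun hc => hij ?_⟩
    · have h0 := h.1 k
      have hn := SU2.normSq g
      simp only [conjAmb, Quaternion.re_mul, Quaternion.imI_mul, Quaternion.imJ_mul,
        Quaternion.imK_mul, Quaternion.re_star, Quaternion.imI_star, Quaternion.imJ_star,
        Quaternion.imK_star, h0]
      ring
    · simp [conjAmb, h.2.1 k, SU2.normSq]
    · rw [hprod, imVec_eq_zero]; simp
    · rw [hprod]; simp
    · have h2 := congrArg (fun z => star (g : ℍ[ℝ]) * z * g) hc
      simp only [conjAmb] at h2
      have h3 : ∀ x y : ℍ[ℝ], star (g : ℍ[ℝ]) * (g * x * star (g : ℍ[ℝ]) *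
          (g * y * star (g : ℍ[ℝ]))) * g = x * y := fun x y => by
        calc _ = (star (g : ℍ[ℝ]) * g) * x * (star (g : ℍ[ℝ]) * g) * y *
              (star (g : ℍ[ℝ]) * g) := by simp only [mul_assoc]
          _ = _ := by rw [hs]; simp
      rwa [h3, h3] at h2
  obtain ⟨b, hb⟩ := key
  exact ⟨b, hb, (cls_eq_iff.mpr ⟨g, hb⟩).symm⟩

theorem exists_smooth_translate (a b : RepS6Star) (hab : a.cls = b.cls) :
    ∃ g : Amb → Amb, ContDiff ℝ ∞ g ∧ g a.incl = b.incl ∧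
      ∀ a' : RepS6Star, ∃ b' : RepS6Star, b'.incl = g a'.incl ∧ b'.cls = a'.cls := by
  obtain ⟨g, hg⟩ := cls_eq_iff.mp hab
  exact ⟨conjAmb g, contDiff_conjAmb g, hg.symm, fun a' => exists_conj g a'⟩

end SU2Char

/-! ### Local structure of the conjugation action -/

namespace SU2Char

open SliceManifold

/-- The quaternion with given coordinates. -/
def qmk (a b c d : ℝ) : ℍ[ℝ] := ⟨a, b, c, d⟩

@[simp] theorem qmk_re (a b c d : ℝ) : (qmk a b c d).re = a := rfl
@[simp] theorem qmk_imI (a b c d : ℝ) : (qmk a b c d).imI = b := rfl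
@[simp] theorem qmk_imJ (a b c d : ℝ) : (qmk a b c d).imJ = c := rfl
@[simp] theorem qmk_imK (a b c d : ℝ) : (qmk a b c d).imK = d := rfl

/-- The purely imaginary quaternion with given coordinates. -/
def imQuat : (Fin 3 → ℝ) →ₗ[ℝ] ℍ[ℝ] where
  toFun t := qmk 0 (t 0) (t 1) (t 2)
  map_add' s t := by ext <;> simp
  map_smul' c t := by ext <;> simp

@[simp] theorem imQuat_re (t : Fin 3 → ℝ) : (imQuat t).re = 0 := rfl
@[simp] theorem imQuat_imI (t : Fin 3 → ℝ) : (imQuat t).imI = t 0 := rfl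
@[simp] theorem imQuat_imJ (t : Fin 3 → ℝ) : (imQuat t).imJ = t 1 := rfl
@[simp] theorem imQuat_imK (t : Fin 3 → ℝ) : (imQuat t).imK = t 2 := rfl

theorem star_imQuat (t : Fin 3 → ℝ) : star (imQuat t) = -imQuat t := by
  ext <;> simp

/-- Conjugation by the unit quaternion proportional to `1 + t`. -/
def act (t : Fin 3 → ℝ) (x : Amb) : Amb := fun k =>
  (1 + t ⬝ᵥ t)⁻¹ • ((1 + imQuat t) * x k * (1 - imQuat t))

theorem one_add_dotProduct_pos (t : Fin 3 → ℝ) : 0 < 1 + t ⬝ᵥ t := by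
  have : 0 ≤ t ⬝ᵥ t := Finset.sum_nonneg fun i _ => mul_self_nonneg (t i)
  linarith

theorem act_zero (x : Amb) : act 0 x = x := by
  funext k
  simp [act]

theorem contDiff_act : ContDiff ℝ ∞ (fun p : (Fin 3 → ℝ) × Amb => act p.1 p.2) := by
  refine contDiff_pi.mpr fun k => ContDiff.fun_smul (ContDiff.fun_inv ?_ ?_) ?_
  · refine contDiff_const.add (ContDiff.sum fun i _ => ?_)
    exact ((contDiff_apply ℝ ℝ i).comp contDiff_fst).mul ((contDiff_apply ℝ ℝ i).comp contDiff_fst)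
  · exact fun p => (one_add_dotProduct_pos p.1).ne'
  · have h : ContDiff ℝ ∞ (fun p : (Fin 3 → ℝ) × Amb => imQuat p.1) :=
      (contDiff_linear imQuat).comp contDiff_fst
    exact ((contDiff_const.add h).mul ((contDiff_component k).comp contDiff_snd)).mul
      (contDiff_const.sub h)

/-- A unit quaternion with non-zero real part is a real multiple of `1 + t` with `t = Im g / Re g`,
and conjugation ignores the multiple's sign. Thus `t` parametrises a neighbourhood of the identity
in `SU(2)/±1`. -/
theorem conjAmb_eq_act {g : ℍ[ℝ]} (hg : Quaternion.normSq g = 1) (h0 : g.re ≠ 0) (x : Amb) :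
    conjAmb g x = act (g.re⁻¹ • imVec g) x := by
  set t := g.re⁻¹ • imVec g with ht
  have h1 : g = g.re • (1 + imQuat t) := by
    ext <;> simp [ht, imVec, h0]
  have h2 : star g = g.re • (1 - imQuat t) := by
    ext <;> simp [ht, imVec, h0]
  have h3 : (1 + t ⬝ᵥ t)⁻¹ = g.re * g.re := by
    rw [Quaternion.normSq_def'] at hg
    rw [inv_eq_iff_eq_inv, eq_comm, inv_eq_iff_eq_inv, ← one_div, eq_div_iff]
    · simp [ht, imVec, dotProduct, Fin.sum_univ_three]
      field_simp
      linarith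
    · exact (one_add_dotProduct_pos t).ne'
  funext k
  rw [conjAmb, act, h3]
  rw [h2]
  nth_rewrite 1 [h1]
  simp only [smul_mul_assoc, mul_smul_comm, smul_smul]

theorem act_eq_conjAmb (t : Fin 3 → ℝ) : ∃ g : SU2, ∀ x, act t x = conjAmb g x := by
  have hp := one_add_dotProduct_pos t
  set r := (Real.sqrt (1 + t ⬝ᵥ t))⁻¹ with hr
  have hrpos : 0 < r := inv_pos.mpr (Real.sqrt_pos.mpr hp)
  have hr2 : r * r = (1 + t ⬝ᵥ t)⁻¹ := by
    rw [hr, ← mul_inv, Real.mul_self_sqrt hp.le]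
  have hn : Quaternion.normSq (r • (1 + imQuat t)) = 1 := by
    rw [Quaternion.normSq_smul, sq, hr2, inv_mul_eq_one₀ hp.ne', Quaternion.normSq_def']
    simp [dotProduct, Fin.sum_univ_three]
    ring
  refine ⟨SU2.mk _ hn, fun x => ?_⟩
  funext k
  change _ = (r • (1 + imQuat t)) * x k * star (r • (1 + imQuat t))
  rw [act, ← hr2, Quaternion.star_smul, star_add, star_one, star_imQuat, ← sub_eq_add_neg]
  simp only [smul_mul_assoc, mul_smul_comm, smul_smul]

theorem norm_conjAmb_sub_le (g : SU2) (x y : Amb) :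
    ‖conjAmb g x - conjAmb g y‖ ≤ ‖x - y‖ := by
  rw [pi_norm_le_iff_of_nonneg (norm_nonneg _)]
  intro k
  have : (conjAmb g x - conjAmb g y) k = g * (x - y) k * star (g : ℍ[ℝ]) := by
    simp [conjAmb, mul_sub, sub_mul]
  rw [this, norm_mul, norm_mul, Quaternion.norm_star]
  have hn : ‖(g : ℍ[ℝ])‖ = 1 := by simp
  rw [hn, one_mul, mul_one]
  exact norm_le_pi_norm (x - y) k

/-- Elements fixing a non-abelian representation are real. -/
theorem real_of_conjAmb_eq_self (a : RepS6Star) {g : SU2} (h : conjAmb g a.incl = a.incl) :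
    imVec (g : ℍ[ℝ]) = 0 := by
  by_contra hne
  rw [imVec_eq_zero] at hne
  obtain ⟨-, -, i, j, hij⟩ := mem_range_incl_iff.mp ⟨a, rfl⟩
  have hc : ∀ k, Commute (g : ℍ[ℝ]) (a.incl k) := by
    intro k
    have h1 := congrFun h k
    have hs : star (g : ℍ[ℝ]) * g = 1 := by
      rw [← SU2.coe_inv]
      exact congrArg Subtype.val (inv_mul_cancel g)
    have h2 := congrArg (· * (g : ℍ[ℝ])) h1
    simp only [conjAmb, mul_assoc, hs, mul_one] at h2
    exact h2
  exact hij (commute_of_commute_nonreal hne (hc i) (hc j))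

/-- Near a non-abelian representation, conjugate representations are conjugate by an element close
to the identity. -/
theorem exists_nhds_conj (A : RepS6Star) {N : Set (Fin 3 → ℝ)} (hN : N ∈ 𝓝 0) :
    ∃ O ∈ 𝓝 A.incl, ∀ a b : RepS6Star, a.incl ∈ O → b.incl ∈ O → a.cls = b.cls →
      ∃ t ∈ N, b.incl = act t a.incl := by
  obtain ⟨N', hN'N, hN'o, hN'0⟩ := mem_nhds_iff.mp hN
  have hre : Continuous fun g : SU2 => (g : ℍ[ℝ]).re :=
    contDiff_re.continuous.comp continuous_subtype_val
  have him : Continuous fun g : SU2 => imVec (g : ℍ[ℝ]) :=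
    (contDiff_linear imVec).continuous.comp continuous_subtype_val
  -- The elements acting as some `act t` with `t ∈ N'`. Both signs `±1` are included, since `t` is a
  -- quotient.
  let good : Set SU2 := {g | (g : ℍ[ℝ]).re ≠ 0} ∩
    (fun g : SU2 => (g : ℍ[ℝ]).re⁻¹ • imVec (g : ℍ[ℝ])) ⁻¹' N'
  have hgood : IsOpen good := by
    refine ContinuousOn.isOpen_inter_preimage ?_ ?_ hN'o
    · exact ContinuousOn.smul (hre.continuousOn.inv₀ fun g hg => hg) him.continuousOn
    · exact isOpen_ne_fun hre continuous_const
  -- Compactness of the group: the remaining elements move `A` into a closed set missing `A`,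
  -- because the stabiliser consists of real quaternions.
  have hbad : IsCompact goodᶜ := hgood.isClosed_compl.isCompact
  have hcont : Continuous fun g : SU2 => conjAmb g A.incl := by
    refine continuous_pi fun k => ?_
    have : Continuous fun g : SU2 => (g : ℍ[ℝ]) := continuous_subtype_val
    exact (this.mul continuous_const).mul (continuous_star.comp this)
  have hK := (hbad.image hcont).isClosed
  have hA : A.incl ∈ ((fun g : SU2 => conjAmb g A.incl) '' goodᶜ)ᶜ := by
    rintro ⟨g, hg, hgA⟩
    apply hg
    have h0 := real_of_conjAmb_eq_self A hgA
    refine ⟨fun hz => ?_, ?_⟩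
    · have hn := SU2.normSq g
      rw [imVec_eq_zero] at h0
      rw [Quaternion.normSq_def', hz, h0.1, h0.2.1, h0.2.2] at hn
      norm_num at hn
    · rw [mem_preimage, h0, smul_zero]
      exact hN'0
  obtain ⟨ε, hε, hball⟩ := Metric.isOpen_iff.mp hK.isOpen_compl _ hA
  refine ⟨Metric.ball A.incl (ε / 2), Metric.ball_mem_nhds _ (by positivity), ?_⟩
  intro a b ha hb hab
  obtain ⟨g, hg⟩ := cls_eq_iff.mp hab
  by_cases hgg : g ∈ good
  · exact ⟨_, hN'N hgg.2, by rw [hg, conjAmb_eq_act (SU2.normSq g) hgg.1]⟩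
  · exfalso
    -- Conjugation does not increase distances, so with `a` and `b` within `ε / 2` of `A` the
    -- element `g` moves `A` by less than `ε`.
    refine hball ?_ ⟨g, hgg, rfl⟩
    rw [Metric.mem_ball, dist_eq_norm] at *
    have h1 := norm_conjAmb_sub_le g A.incl a.incl
    rw [norm_sub_rev A.incl] at h1
    rw [← hg] at h1
    calc ‖conjAmb g A.incl - A.incl‖ = ‖(conjAmb g A.incl - b.incl) + (b.incl - A.incl)‖ := by
          congr 1; abel
      _ ≤ ‖conjAmb g A.incl - b.incl‖ + ‖b.incl - A.incl‖ := norm_add_le _ _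
      _ < ε := by linarith

/-- The infinitesimal conjugation action. -/
def orb (x : Amb) (t : Fin 3 → ℝ) : Amb := fun k => imQuat t * x k - x k * imQuat t

/-- The normalising factor `(1 + s²|t|²)⁻¹` is stationary at `s = 0`, so only the commutator with
`t` survives. -/
theorem hasDerivAt_act (t : Fin 3 → ℝ) (x : Amb) :
    HasDerivAt (fun s : ℝ => act (s • t) x) (orb x t) 0 := by
  rw [hasDerivAt_pi]
  intro k
  have h1 : HasDerivAt (fun s : ℝ => s • imQuat t) (imQuat t) 0 := by
    simpa using (hasDerivAt_id (0 : ℝ)).smul_const (imQuat t)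
  have h2 := ((h1.const_add 1).mul_const (x k)).fun_mul (h1.const_sub 1)
  have h3 : HasDerivAt (fun s : ℝ => (1 + s * s * (t ⬝ᵥ t))⁻¹) 0 0 := by
    have h4 := ((((hasDerivAt_id' (0 : ℝ)).fun_mul (hasDerivAt_id' (0 : ℝ))).mul_const
      (t ⬝ᵥ t)).const_add 1).fun_inv (by simp)
    simpa using h4
  have h5 := h3.fun_smul h2
  have e : (fun s : ℝ => act (s • t) x k) = fun s : ℝ => (1 + s * s * (t ⬝ᵥ t))⁻¹ •
      ((1 + s • imQuat t) * x k * (1 - s • imQuat t)) := by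
    funext s
    simp only [act, map_smul, smul_dotProduct, dotProduct_smul, smul_eq_mul, mul_assoc]
  rw [e]
  convert h5 using 1
  simp [orb, sub_eq_add_neg]

theorem fderiv_act (x : Amb) (t : Fin 3 → ℝ) (δ : Amb) :
    fderiv ℝ (fun p : (Fin 3 → ℝ) × Amb => act p.1 p.2) (0, x) (t, δ) = orb x t + δ := by
  have hd : DifferentiableAt ℝ (fun p : (Fin 3 → ℝ) × Amb => act p.1 p.2) (0, x) :=
    contDiff_act.contDiffAt.differentiableAt (by simp)
  have e : ((t, δ) : (Fin 3 → ℝ) × Amb) = (t, 0) + (0, δ) := by simp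
  rw [e, map_add]
  congr 1
  · have h1 : HasDerivAt (fun s : ℝ => ((s • t, x) : (Fin 3 → ℝ) × Amb)) (t, 0) 0 := by
      have : HasDerivAt (fun s : ℝ => s • t) t 0 := by
        simpa using (hasDerivAt_id (0 : ℝ)).smul_const t
      exact this.prodMk (hasDerivAt_const _ _)
    have h2 : HasFDerivAt (fun p : (Fin 3 → ℝ) × Amb => act p.1 p.2)
        (fderiv ℝ (fun p : (Fin 3 → ℝ) × Amb => act p.1 p.2) (0, x))
        ((fun s : ℝ => ((s • t, x) : (Fin 3 → ℝ) × Amb)) 0) := by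
      simp only [zero_smul]
      exact hd.hasFDerivAt
    have h3 := HasFDerivAt.comp_hasDerivAt (0 : ℝ) h2 h1
    exact h3.unique (hasDerivAt_act t x)
  · have h1 : HasFDerivAt (fun y : Amb => ((0, y) : (Fin 3 → ℝ) × Amb))
        (ContinuousLinearMap.inr ℝ (Fin 3 → ℝ) Amb) x := hasFDerivAt_prodMk_right _ x
    have h2 := hd.hasFDerivAt.comp x h1
    have h3 : ((fun p : (Fin 3 → ℝ) × Amb => act p.1 p.2) ∘
        fun y : Amb => ((0, y) : (Fin 3 → ℝ) × Amb)) = id := by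
      funext y
      exact act_zero y
    rw [h3] at h2
    have h4 := h2.unique (hasFDerivAt_id (𝕜 := ℝ) x)
    exact DFunLike.congr_fun h4 δ

end SU2Char

/-! ### The slice theorem -/

namespace SU2Char

open SliceManifold

/-- The model space of `χ*(S², 6)`. -/
abbrev E6 : Type := EuclideanSpace ℝ (Fin 6)

theorem finrank_amb : Module.finrank ℝ Amb = 24 := by
  rw [Module.finrank_pi_fintype]
  simp [Quaternion.finrank_eq_four]

/-- The count is `6 + 3 + (6 + 6 + 3)`: orbit space, orbit directions, and the equations for real
parts, norms and the product. -/
theorem finrank_slice : Module.finrank ℝ ((E6 × (Fin 3 → ℝ)) × ConSpace) = 24 := by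
  simp

set_option maxHeartbeats 400000 in
/-- The slice theorem: functions `f` and `γ` which are coordinates transverse to the defining
equations, such that `γ` is transverse to the orbits, give a slice chart. -/
theorem exists_sliceChart (A : RepS6Star) {U : Set Amb} (hU : IsOpen U) (hAU : A.incl ∈ U)
    {f : Amb → E6} {γ : Amb → (Fin 3 → ℝ)} (hf : ContDiffOn ℝ ∞ f U) (hγ : ContDiffOn ℝ ∞ γ U)
    (hγ0 : γ A.incl = 0)
    (hinj : ∀ δ, fderiv ℝ f A.incl δ = 0 → fderiv ℝ γ A.incl δ = 0 →
      fderiv ℝ con A.incl δ = 0 → δ = 0)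
    (horb : ∀ t, fderiv ℝ γ A.incl (orb A.incl t) = 0 → t = 0) :
    ∃ O' ∈ 𝓝 A.incl, ∀ O ∈ 𝓝 A.incl,
      ∃ (S : SliceChart E6 (Fin 3 → ℝ) ConSpace RepS6Star.incl RepS6Star.cls) (ε : ℝ),
        0 < ε ∧ A.incl ∈ S.Θ.source ∧
        (∀ v, ((v, 0), 0) ∈ S.Θ.target ↔ v ∈ Metric.ball (f A.incl) ε) ∧
        (∀ v ∈ Metric.ball (f A.incl) ε, S.Θ.symm ((v, 0), 0) ∈ O ∧
          f (S.Θ.symm ((v, 0), 0)) = v ∧ γ (S.Θ.symm ((v, 0), 0)) = 0) ∧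
        ∀ a : RepS6Star, a.incl ∈ O' → γ a.incl = 0 → f a.incl ∈ Metric.ball (f A.incl) ε →
          S.Θ.symm ((f a.incl, 0), 0) = a.incl := by
  set x₀ := A.incl with hx₀
  set v₀ := f x₀ with hv₀
  have hx₀U := hU.mem_nhds hAU
  have dfd {W : Type} [NormedAddCommGroup W] [NormedSpace ℝ W] {h : Amb → W}
      (hh : ContDiffOn ℝ ∞ h U) : DifferentiableAt ℝ h x₀ :=
    (hh.contDiffAt hx₀U).differentiableAt (by simp)
  -- the ambient coordinates `(f, γ, con)` and their inverse
  have hΨ : ContDiffOn ℝ ∞ (fun x => ((f x, γ x), con x)) U :=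
    (hf.prodMk hγ).prodMk contDiff_con.contDiffOn
  have hΨd : ∀ δ, fderiv ℝ (fun x => ((f x, γ x), con x)) x₀ δ =
      ((fderiv ℝ f x₀ δ, fderiv ℝ γ x₀ δ), fderiv ℝ con x₀ δ) := by
    intro δ
    have h := ((dfd hf).hasFDerivAt.prodMk (dfd hγ).hasFDerivAt).prodMk
      (dfd contDiff_con.contDiffOn).hasFDerivAt
    rw [h.fderiv]
    rfl
  obtain ⟨eΨ, hxΨ, hΨU, heΨ, -, hΨs⟩ := exists_local_diffeo hU hΨ hAU (fun δ hδ => by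
      rw [hΨd, Prod.ext_iff, Prod.ext_iff] at hδ
      exact hinj δ hδ.1.1 hδ.1.2 hδ.2) (finrank_amb.trans finrank_slice.symm)
  have hcon0 : con x₀ = 0 := (mem_range_incl_iff.mp ⟨A, rfl⟩).1
  have hΨx : eΨ x₀ = ((v₀, 0), 0) := by
    rw [heΨ]
    simp only [hγ0, hcon0, hv₀]
  have hp₀ : ((v₀, 0), 0) ∈ eΨ.target := hΨx ▸ eΨ.map_source hxΨ
  have hΨsymm : eΨ.symm ((v₀, 0), 0) = x₀ := by rw [← hΨx, eΨ.left_inv hxΨ]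
  -- The slice `γ = 0`, thickened in the directions transverse to the representation space so that
  -- an ambient chart results.
  let σ : E6 × ConSpace → Amb := fun p => eΨ.symm ((p.1, 0), p.2)
  have hσ0 : σ (v₀, 0) = x₀ := hΨsymm
  have hj : Continuous fun p : E6 × ConSpace => ((p.1, (0 : Fin 3 → ℝ)), p.2) := by fun_prop
  have hWo : IsOpen {p : E6 × ConSpace | ((p.1, (0 : Fin 3 → ℝ)), p.2) ∈ eΨ.target} :=
    eΨ.open_target.preimage hj
  have hσ : ContDiffOn ℝ ∞ σ {p : E6 × ConSpace | ((p.1, (0 : Fin 3 → ℝ)), p.2) ∈ eΨ.target} :=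
    hΨs.comp ((contDiff_fst.prodMk contDiff_const).prodMk contDiff_snd).contDiffOn
      fun p hp => hp
  have hσΨ : ∀ p : E6 × ConSpace, ((p.1, (0 : Fin 3 → ℝ)), p.2) ∈ eΨ.target →
      f (σ p) = p.1 ∧ γ (σ p) = 0 ∧ con (σ p) = p.2 := by
    intro p hp
    have h := eΨ.right_inv hp
    rw [heΨ, Prod.ext_iff, Prod.ext_iff] at h
    exact ⟨h.1.1, h.1.2, h.2⟩
  have hσd : HasFDerivAt σ (fderiv ℝ σ (v₀, 0)) (v₀, 0) :=
    ((hσ.contDiffAt (hWo.mem_nhds hp₀)).differentiableAt (by simp)).hasFDerivAt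
  have hnear : ∀ᶠ p : E6 × ConSpace in 𝓝 (v₀, 0), ((p.1, (0 : Fin 3 → ℝ)), p.2) ∈ eΨ.target :=
    hWo.mem_nhds hp₀
  have chain {W : Type} [NormedAddCommGroup W] [NormedSpace ℝ W] {h : Amb → W}
      (hh : ContDiffOn ℝ ∞ h U) {k : E6 × ConSpace → W} {k' : E6 × ConSpace →L[ℝ] W}
      (hk : HasFDerivAt k k' (v₀, 0))
      (hhk : ∀ᶠ p in 𝓝 (v₀, 0), h (σ p) = k p) (δ : E6 × ConSpace) :
      fderiv ℝ h x₀ (fderiv ℝ σ (v₀, 0) δ) = k' δ := by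
    have h1 : HasFDerivAt h (fderiv ℝ h x₀) (σ (v₀, 0)) := by
      rw [hσ0]
      exact (dfd hh).hasFDerivAt
    have h2 := (h1.comp (v₀, 0) hσd).congr_of_eventuallyEq
      (hhk.mono fun p hp => hp.symm)
    exact DFunLike.congr_fun (h2.unique hk) δ
  -- the straightening of the orbits
  let H : (E6 × (Fin 3 → ℝ)) × ConSpace → Amb := fun p => act p.1.2 (σ (p.1.1, p.2))
  let j : (E6 × (Fin 3 → ℝ)) × ConSpace →L[ℝ] E6 × ConSpace :=
    ((ContinuousLinearMap.fst ℝ E6 (Fin 3 → ℝ)).comp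
      (ContinuousLinearMap.fst ℝ (E6 × (Fin 3 → ℝ)) ConSpace)).prod
      (ContinuousLinearMap.snd ℝ (E6 × (Fin 3 → ℝ)) ConSpace)
  let j₂ : (E6 × (Fin 3 → ℝ)) × ConSpace →L[ℝ] (Fin 3 → ℝ) :=
    (ContinuousLinearMap.snd ℝ E6 (Fin 3 → ℝ)).comp
      (ContinuousLinearMap.fst ℝ (E6 × (Fin 3 → ℝ)) ConSpace)
  have hVo : IsOpen {p : (E6 × (Fin 3 → ℝ)) × ConSpace |
      ((p.1.1, (0 : Fin 3 → ℝ)), p.2) ∈ eΨ.target} := hWo.preimage j.continuous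
  have hH : ContDiffOn ℝ ∞ H {p : (E6 × (Fin 3 → ℝ)) × ConSpace |
      ((p.1.1, (0 : Fin 3 → ℝ)), p.2) ∈ eΨ.target} := by
    refine contDiff_act.comp_contDiffOn (ContDiffOn.prodMk j₂.contDiff.contDiffOn ?_)
    exact hσ.comp j.contDiff.contDiffOn fun p hp => hp
  have hHd : ∀ δ, fderiv ℝ H ((v₀, 0), 0) δ =
      orb x₀ (j₂ δ) + fderiv ℝ σ (v₀, 0) (j δ) := by
    intro δ
    have h1 : HasFDerivAt (fun p => (j₂ p, σ (j p))) (j₂.prod ((fderiv ℝ σ (v₀, 0)).comp j))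
        ((v₀, 0), 0) :=
      j₂.hasFDerivAt.prodMk (HasFDerivAt.comp ((v₀, 0), 0) (g := σ) hσd j.hasFDerivAt)
    have h2 : HasFDerivAt (fun p : (Fin 3 → ℝ) × Amb => act p.1 p.2)
        (fderiv ℝ (fun p : (Fin 3 → ℝ) × Amb => act p.1 p.2) (0, x₀))
        (j₂ ((v₀, 0), 0), σ (j ((v₀, 0), 0))) := by
      have e : (j₂ ((v₀, 0), 0), σ (j ((v₀, 0), 0))) = (0, x₀) := Prod.ext rfl hσ0
      rw [e]
      exact (contDiff_act.contDiffAt.differentiableAt (by simp)).hasFDerivAt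
    have h3 : HasFDerivAt H _ ((v₀, 0), 0) := HasFDerivAt.comp ((v₀, 0), 0)
      (g := fun p : (Fin 3 → ℝ) × Amb => act p.1 p.2) (f := fun p => (j₂ p, σ (j p))) h2 h1
    rw [h3.fderiv]
    exact fderiv_act x₀ _ _
  -- The slice lies in `γ = 0`, so applying the derivative of `γ` isolates the orbit direction,
  -- which `horb` kills. The derivatives of `f` and `con` then recover the slice directions.
  have hHinj : ∀ δ, fderiv ℝ H ((v₀, 0), 0) δ = 0 → δ = 0 := by
    intro δ hδ
    rw [hHd] at hδ
    have hγσ := chain hγ (hasFDerivAt_const (0 : Fin 3 → ℝ) _)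
      (hnear.mono fun p hp => (hσΨ p hp).2.1) (j δ)
    have ht : j₂ δ = 0 := by
      apply horb
      have := congrArg (fderiv ℝ γ x₀) hδ
      rw [map_add, hγσ, map_zero] at this
      simpa using this
    have horb0 : orb x₀ 0 = 0 := by
      funext k
      simp [orb]
    rw [ht, horb0, zero_add] at hδ
    have h1 := chain hf (ContinuousLinearMap.fst ℝ E6 ConSpace).hasFDerivAt
      (hnear.mono fun p hp => (hσΨ p hp).1) (j δ)
    have h2 := chain contDiff_con.contDiffOn (ContinuousLinearMap.snd ℝ E6 ConSpace).hasFDerivAt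
      (hnear.mono fun p hp => (hσΨ p hp).2.2) (j δ)
    rw [hδ, map_zero] at h1 h2
    exact Prod.ext (Prod.ext h1.symm ht) h2.symm
  obtain ⟨eH, hpH, hHV, heH, hHsm, hHs⟩ := exists_local_diffeo hVo hH (x := ((v₀, 0), 0)) hp₀ hHinj
    (finrank_slice.trans finrank_amb.symm)
  -- The neighbourhood on which slice points are determined by `f` is fixed before `O` is given, so
  -- `O` may later be chosen in terms of it.
  refine ⟨eΨ.source, eΨ.open_source.mem_nhds hxΨ, fun O hO => ?_⟩
  -- shrinking
  have hσc : Tendsto (fun p => σ (j p)) (𝓝 ((v₀, 0), 0)) (𝓝 x₀) := by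
    have h : Tendsto (fun p => σ (j p)) (𝓝 ((v₀, 0), 0)) (𝓝 (σ (v₀, 0))) :=
      ContinuousAt.comp (g := σ) (f := j) (x := ((v₀, 0), 0)) hσd.continuousAt
        j.continuous.continuousAt
    rwa [hσ0] at h
  have hrange : ∀ᶠ p in 𝓝 ((v₀, 0), 0), σ (j p) ∈ range RepS6Star.incl ↔ con (σ (j p)) = 0 :=
    hσc.eventually (eventually_mem_range_iff A)
  obtain ⟨ε₁, hε₁, hball₁⟩ := Metric.mem_nhds_iff.mp
    (inter_mem (eH.open_source.mem_nhds hpH) hrange)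
  -- Conjugating parameters are forced into the ball of radius `ε₁`, where `H` is already known to
  -- be injective.
  obtain ⟨O₁, hO₁, hconj⟩ := exists_nhds_conj A (Metric.ball_mem_nhds (0 : Fin 3 → ℝ) hε₁)
  have hσO : ∀ᶠ p in 𝓝 ((v₀, 0), 0), σ (j p) ∈ O ∩ O₁ :=
    hσc.eventually (inter_mem hO hO₁)
  obtain ⟨ε₂, hε₂, hball₂⟩ := Metric.mem_nhds_iff.mp hσO
  set ε := min ε₁ ε₂ with hε
  have hεpos : 0 < ε := lt_min hε₁ hε₂
  let B : Set ((E6 × (Fin 3 → ℝ)) × ConSpace) := Metric.ball ((v₀, 0), 0) ε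
  have hBo : IsOpen B := Metric.isOpen_ball
  have hmemB : ∀ v t c, ((v, t), c) ∈ B ↔
      (v ∈ Metric.ball v₀ ε ∧ t ∈ Metric.ball (0 : Fin 3 → ℝ) ε) ∧
        c ∈ Metric.ball (0 : ConSpace) ε := by
    intro v t c
    simp only [B, ← ball_prod_same, mem_prod]
  have hBsub : B ⊆ eH.source := fun p hp =>
    (hball₁ (Metric.ball_subset_ball (min_le_left _ _) hp)).1
  have hBr : ∀ p ∈ B, σ (j p) ∈ range RepS6Star.incl ↔ con (σ (j p)) = 0 := fun p hp =>
    (hball₁ (Metric.ball_subset_ball (min_le_left _ _) hp)).2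
  have hBO : ∀ p ∈ B, σ (j p) ∈ O ∩ O₁ := fun p hp =>
    hball₂ (Metric.ball_subset_ball (min_le_right _ _) hp)
  have hBΨ : ∀ p ∈ B, ((p.1.1, (0 : Fin 3 → ℝ)), p.2) ∈ eΨ.target := fun p hp => hHV (hBsub hp)
  let Θ := (eH.restrOpen B hBo).symm
  have hΘsrc : ∀ x, x ∈ Θ.source ↔ x ∈ eH.target ∧ eH.symm x ∈ B := fun x => Iff.rfl
  have hΘtgt : Θ.target = B := by
    change eH.source ∩ B = B
    exact inter_eq_right.mpr hBsub
  have hΘsymm : ∀ p, Θ.symm p = H p := fun p => by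
    change eH p = H p
    rw [heH]
  have hΘB : ∀ x ∈ Θ.source, Θ x ∈ B := fun x hx => hΘtgt ▸ Θ.map_source hx
  have hΘH : ∀ x ∈ Θ.source, H (Θ x) = x := fun x hx => by
    rw [← hΘsymm, Θ.left_inv hx]
  -- membership in the image of `incl` is invariant under the action
  have hact : ∀ (t : Fin 3 → ℝ) (a : RepS6Star), ∃ b : RepS6Star, b.incl = act t a.incl ∧
      b.cls = a.cls := by
    intro t a
    obtain ⟨g, hg⟩ := act_eq_conjAmb t
    obtain ⟨b, hb, hb'⟩ := exists_conj g a
    exact ⟨b, hb.trans (hg _).symm, hb'⟩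
  -- The converse direction is needed because the chart sees a point of the image only after
  -- translation by `act t`; its slice point must be a representation too.
  have hact' : ∀ (t : Fin 3 → ℝ) (x : Amb), act t x ∈ range RepS6Star.incl →
      x ∈ range RepS6Star.incl := by
    rintro t x ⟨a, ha⟩
    obtain ⟨g, hg⟩ := act_eq_conjAmb t
    obtain ⟨b, hb, -⟩ := exists_conj g⁻¹ a
    refine ⟨b, ?_⟩
    rw [hb, ha, hg]
    have hs : star (g : ℍ[ℝ]) * g = 1 := by
      rw [← SU2.coe_inv]
      exact congrArg Subtype.val (inv_mul_cancel g)
    funext k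
    rw [conjAmb, conjAmb, SU2.coe_inv, star_star]
    calc star (g : ℍ[ℝ]) * (g * x k * star (g : ℍ[ℝ])) * g
        = (star (g : ℍ[ℝ]) * g) * x k * (star (g : ℍ[ℝ]) * g) := by simp only [mul_assoc]
      _ = x k := by rw [hs, one_mul, mul_one]
  have hlift : ∀ p ∈ B, p.2 = 0 → ∃ a : RepS6Star, a.incl = σ (j p) := by
    intro p hp h0
    exact (hBr p hp).mpr ((hσΨ (j p) (hBΨ p hp)).2.2.trans h0)
  -- the class of a point is determined by its slice representative
  have hcls : ∀ a : RepS6Star, a.incl ∈ Θ.source → ∃ b : RepS6Star,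
      b.incl = σ ((Θ a.incl).1.1, 0) ∧ b.cls = a.cls ∧ (Θ a.incl).2 = 0 := by
    intro a ha
    have hB := hΘB _ ha
    have h1 : σ (j (Θ a.incl)) ∈ range RepS6Star.incl :=
      hact' (Θ a.incl).1.2 _ ⟨a, (hΘH _ ha).symm⟩
    have h2 : (Θ a.incl).2 = 0 :=
      (hσΨ (j (Θ a.incl)) (hBΨ _ hB)).2.2.symm.trans ((hBr _ hB).mp h1)
    obtain ⟨b, hb⟩ := h1
    obtain ⟨c, hc, hc'⟩ := hact (Θ a.incl).1.2 b
    have hca : c = a := by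
      have : c.incl = a.incl := by
        rw [hc, hb]
        exact hΘH _ ha
      exact Subtype.ext (Subtype.ext (funext fun k => Subtype.ext (congrFun this k)))
    refine ⟨b, ?_, by rw [← hc', hca], h2⟩
    rw [hb]
    change σ ((Θ a.incl).1.1, (Θ a.incl).2) = _
    rw [h2]
  have hB0 : ∀ p ∈ B, ((p.1.1, 0), 0) ∈ B := by
    intro p hp
    have h := (hmemB p.1.1 p.1.2 p.2).mp hp
    exact (hmemB _ _ _).mpr ⟨⟨h.1.1, Metric.mem_ball_self hεpos⟩, Metric.mem_ball_self hεpos⟩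
  refine ⟨⟨Θ, ?_, ?_, ?_, ?_, ?_⟩, ε, hεpos, ?_, ?_, ?_, ?_⟩
  · exact hHs.mono fun x hx => hx.1
  · rw [hΘtgt]
    exact (hHsm.mono hBsub)
  · intro x hx
    constructor
    · rintro ⟨a, rfl⟩
      obtain ⟨-, -, -, h⟩ := hcls a hx
      exact h
    · intro h0
      obtain ⟨a, ha⟩ := hlift _ (hΘB x hx) h0
      obtain ⟨b, hb, -⟩ := hact (Θ x).1.2 a
      refine ⟨b, ?_⟩
      rw [hb, ha]
      exact hΘH x hx
  · intro a b ha hb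
    obtain ⟨a', ha', haa', -⟩ := hcls a ha
    obtain ⟨b', hb', hbb', -⟩ := hcls b hb
    have hBa := hB0 _ (hΘB _ ha)
    have hBb := hB0 _ (hΘB _ hb)
    constructor
    · intro hab
      have haO : a'.incl ∈ O₁ := by rw [ha']; exact (hBO _ hBa).2
      have hbO : b'.incl ∈ O₁ := by rw [hb']; exact (hBO _ hBb).2
      obtain ⟨t, ht, hbt⟩ := hconj a' b' haO hbO (by rw [haa', hbb', hab])
      have hmem : (((Θ a.incl).1.1, t), (0 : ConSpace)) ∈ eH.source := by
        refine (hball₁ ?_).1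
        have h := (hmemB _ _ _).mp hBa
        rw [← ball_prod_same, ← ball_prod_same]
        exact ⟨⟨Metric.ball_subset_ball (min_le_left _ _) h.1.1, ht⟩,
          Metric.mem_ball_self hε₁⟩
      -- Conjugate slice points would be two preimages under `H`, one with parameter `t` and one
      -- with parameter `0`; injectivity then equates their invariant coordinates.
      have heq : eH (((Θ a.incl).1.1, t), 0) = eH (((Θ b.incl).1.1, 0), 0) := by
        rw [heH]
        change act t (σ ((Θ a.incl).1.1, 0)) = act 0 (σ ((Θ b.incl).1.1, 0))
        rw [act_zero, ← ha', ← hb', hbt]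
      have := eH.injOn hmem (hBsub hBb) heq
      exact congrArg (fun p => p.1.1) this
    · intro hv
      have hab : a'.incl = b'.incl := by rw [ha', hb', hv]
      have : a' = b' :=
        Subtype.ext (Subtype.ext (funext fun k => Subtype.ext (congrFun hab k)))
      rw [← haa', ← hbb', this]
  · intro v t hvt
    have hvt' : ((v, t), (0 : ConSpace)) ∈ B := hΘtgt ▸ hvt
    have h : ((v, (0 : Fin 3 → ℝ)), (0 : ConSpace)) ∈ B := hB0 ((v, t), 0) hvt'
    exact hΘtgt.symm ▸ h
  · refine (hΘsrc _).mpr ?_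
    have h1 : eH ((v₀, 0), 0) = x₀ := by
      rw [heH]
      change act 0 (σ (v₀, 0)) = x₀
      rw [act_zero, hσ0]
    rw [← h1]
    refine ⟨eH.map_source hpH, ?_⟩
    rw [eH.left_inv hpH]
    exact Metric.mem_ball_self hεpos
  · intro v
    change _ ∈ Θ.target ↔ _
    rw [hΘtgt, hmemB]
    simp [hεpos]
  · intro v hv
    have hvB : ((v, 0), 0) ∈ B := (hmemB _ _ _).mpr
      ⟨⟨hv, Metric.mem_ball_self hεpos⟩, Metric.mem_ball_self hεpos⟩
    have hs : Θ.symm ((v, 0), 0) = σ (v, 0) := by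
      rw [hΘsymm]
      exact act_zero _
    change Θ.symm ((v, 0), 0) ∈ O ∧ f (Θ.symm ((v, 0), 0)) = v ∧ γ (Θ.symm ((v, 0), 0)) = 0
    rw [hs]
    have h := hσΨ (v, 0) (hBΨ _ hvB)
    exact ⟨(hBO _ hvB).1, h.1, h.2.1⟩
  · intro a haO haγ _
    change Θ.symm ((f a.incl, 0), 0) = a.incl
    rw [hΘsymm]
    change act 0 (σ (f a.incl, 0)) = a.incl
    rw [act_zero]
    have hc : con a.incl = 0 := (mem_range_incl_iff.mp ⟨a, rfl⟩).1
    have h : eΨ a.incl = ((f a.incl, 0), 0) := by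
      rw [heΨ]
      simp only [haγ, hc]
    change eΨ.symm ((f a.incl, 0), 0) = a.incl
    rw [← h, eΨ.left_inv haO]

end SU2Char

/-! ### Regularity of the defining equations -/

namespace SU2Char

open SliceManifold

theorem fderiv_apply_eq {V W : Type} [NormedAddCommGroup V] [NormedSpace ℝ V]
    [NormedAddCommGroup W] [NormedSpace ℝ W] {f : V → W} {x δ : V} {d : W}
    (hf : DifferentiableAt ℝ f x) (h : HasDerivAt (fun s : ℝ => f (x + s • δ)) d 0) :
    fderiv ℝ f x δ = d := by
  have h1 : HasDerivAt (fun s : ℝ => x + s • δ) δ 0 := by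
    simpa using ((hasDerivAt_id (0 : ℝ)).smul_const δ).const_add x
  have h2 : HasFDerivAt f (fderiv ℝ f x) (x + (0 : ℝ) • δ) := by
    rw [zero_smul, add_zero]
    exact hf.hasFDerivAt
  exact (HasFDerivAt.comp_hasDerivAt (0 : ℝ) h2 h1).unique h

/-- The inner product of quaternions, in coordinates. -/
def qdot (x y : ℍ[ℝ]) : ℝ := x.re * y.re + x.imI * y.imI + x.imJ * y.imJ + x.imK * y.imK

/-- The derivative of the product of six quaternions. -/
def dprod (x δ : Amb) : ℍ[ℝ] :=
  ((((δ 0 * x 1 + x 0 * δ 1) * x 2 + x 0 * x 1 * δ 2) * x 3 + x 0 * x 1 * x 2 * δ 3) * x 4 +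
    x 0 * x 1 * x 2 * x 3 * δ 4) * x 5 + x 0 * x 1 * x 2 * x 3 * x 4 * δ 5

theorem hasDerivAt_line (x δ : Amb) (k : Fin 6) :
    HasDerivAt (fun s : ℝ => (x + s • δ) k) (δ k) 0 := by
  simpa using ((hasDerivAt_id (0 : ℝ)).smul_const (δ k)).const_add (x k)

theorem hasDerivAt_prod6 (x δ : Amb) :
    HasDerivAt (fun s : ℝ => prod6 (x + s • δ)) (dprod x δ) 0 := by
  have h := hasDerivAt_line x δ
  have h1 := (((((h 0).fun_mul (h 1)).fun_mul (h 2)).fun_mul (h 3)).fun_mul (h 4)).fun_mul (h 5)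
  simpa [dprod, prod6] using h1

theorem hasDerivAt_linear {W : Type} [NormedAddCommGroup W] [NormedSpace ℝ W] (L : ℍ[ℝ] →ₗ[ℝ] W)
    {c : ℝ → ℍ[ℝ]} {d : ℍ[ℝ]} (h : HasDerivAt c d 0) : HasDerivAt (fun s => L (c s)) (L d) 0 :=
  HasFDerivAt.comp_hasDerivAt (0 : ℝ) (LinearMap.toContinuousLinearMap L).hasFDerivAt h

theorem hasDerivAt_normSq (x δ : ℍ[ℝ]) :
    HasDerivAt (fun s : ℝ => Quaternion.normSq (x + s • δ)) (2 * qdot x δ) 0 := by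
  have e : (fun s : ℝ => Quaternion.normSq (x + s • δ)) = fun s =>
      Quaternion.normSq x + (s * (2 * qdot x δ) + s * s * Quaternion.normSq δ) := by
    funext s
    simp only [Quaternion.normSq_def', qdot, Quaternion.re_add, Quaternion.imI_add,
      Quaternion.imJ_add, Quaternion.imK_add, Quaternion.re_smul, Quaternion.imI_smul,
      Quaternion.imJ_smul, Quaternion.imK_smul, smul_eq_mul]
    ring
  rw [e]
  have h1 := ((hasDerivAt_id' (0 : ℝ)).mul_const (2 * qdot x δ)).fun_add
    (((hasDerivAt_id' (0 : ℝ)).fun_mul (hasDerivAt_id' (0 : ℝ))).mul_const (Quaternion.normSq δ))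
  simpa using h1.const_add (Quaternion.normSq x)

theorem fderiv_con (x δ : Amb) : fderiv ℝ con x δ =
    (fun k => (δ k).re, fun k => 2 * qdot (x k) (δ k), imVec (dprod x δ)) := by
  refine fderiv_apply_eq (contDiff_con.contDiffAt.differentiableAt (by simp)) ?_
  refine HasDerivAt.prodMk ?_ (HasDerivAt.prodMk ?_ ?_)
  · exact hasDerivAt_pi.mpr fun k => hasDerivAt_linear reL (hasDerivAt_line x δ k)
  · exact hasDerivAt_pi.mpr fun k => (hasDerivAt_normSq (x k) (δ k)).sub_const 1
  · exact hasDerivAt_linear imVec (hasDerivAt_prod6 x δ)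

/-- The infinitesimal conjugation action, as a linear map. -/
def orbL (x : Amb) : (Fin 3 → ℝ) →ₗ[ℝ] Amb where
  toFun := orb x
  map_add' s t := by
    funext k
    simp only [orb, map_add, add_mul, mul_add, Pi.add_apply]
    abel
  map_smul' c t := by
    funext k
    simp [orb, smul_sub]

/-- Commuting with a fixed non-real quaternion is transitive, so a non-real `m` would make all the
values commute with each other. -/
theorem eq_zero_of_commute (A : RepS6Star) {m : ℍ[ℝ]} (h : ∀ k, Commute m (A.incl k)) :
    imVec m = 0 := by
  by_contra hne
  rw [imVec_eq_zero] at hne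
  obtain ⟨-, -, i, j, hij⟩ := mem_range_incl_iff.mp ⟨A, rfl⟩
  exact hij (commute_of_commute_nonreal hne (h i) (h j))

theorem imVec_imQuat (t : Fin 3 → ℝ) : imVec (imQuat t) = t := by
  ext i; fin_cases i <;> rfl

theorem orb_injective (A : RepS6Star) {t : Fin 3 → ℝ} (h : orb A.incl t = 0) : t = 0 := by
  rw [← imVec_imQuat t]
  exact eq_zero_of_commute A fun k => sub_eq_zero.mp (congrFun h k)

/-- The equations hold along the whole orbit, so they have zero derivative in orbit directions. -/
theorem fderiv_con_orb (A : RepS6Star) (t : Fin 3 → ℝ) : fderiv ℝ con A.incl (orb A.incl t) = 0 := by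
  have h1 := hasDerivAt_act t A.incl
  have h2 : HasFDerivAt con (fderiv ℝ con A.incl) (act ((0 : ℝ) • t) A.incl) := by
    rw [zero_smul, act_zero]
    exact (contDiff_con.contDiffAt.differentiableAt (by simp)).hasFDerivAt
  have h3 := HasFDerivAt.comp_hasDerivAt (0 : ℝ) h2 h1
  have h4 : (con ∘ fun s : ℝ => act (s • t) A.incl) = fun _ => 0 := by
    funext s
    obtain ⟨g, hg⟩ := act_eq_conjAmb (s • t)
    obtain ⟨b, hb, -⟩ := exists_conj g A
    simp only [comp_apply, hg, ← hb]
    exact (mem_range_incl_iff.mp ⟨b, rfl⟩).1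
  rw [h4] at h3
  exact h3.unique (hasDerivAt_const _ _)

/-- Test with the cross product `c = x × m`, which is tangent to the sphere at `x`. Cyclicity of the
real part, `m p = p m` and `r p = -x` reduce the hypothesis to the vanishing of `Re (x m c)`, a sum
of squares that vanishes only if `x × m = 0`. -/
theorem commute_of_dprod_step {m p x r : ℍ[ℝ]} (hm : m.re = 0) (hx : x.re = 0)
    (hn : Quaternion.normSq x = 1) (hpxr : p * x * r = 1) (hmp : Commute m p)
    (h : ∀ δ : ℍ[ℝ], δ.re = 0 → qdot x δ = 0 → (m * (p * δ * r)).re = 0) : Commute m x := by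
  have hxx : x * x = -1 := by
    rw [Quaternion.normSq_def'] at hn
    rw [quaternion_ext_iff']
    simp only [Quaternion.re_mul, Quaternion.imI_mul, Quaternion.imJ_mul, Quaternion.imK_mul, hx,
      Quaternion.re_neg, Quaternion.imI_neg, Quaternion.imJ_neg, Quaternion.imK_neg,
      Quaternion.re_one, Quaternion.imI_one, Quaternion.imJ_one, Quaternion.imK_one]
    refine ⟨?_, ?_, ?_, ?_⟩ <;> nlinarith
  have hrp : r * p = -x := by
    have h1 : x * r * p = 1 := by
      have h2 : p * (x * r) = 1 := by rw [← mul_assoc]; exact hpxr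
      exact mul_eq_one_comm.mp h2
    calc r * p = -(x * x) * (r * p) := by rw [hxx]; simp
      _ = -(x * (x * r * p)) := by simp only [neg_mul, mul_assoc]
      _ = -x := by rw [h1, mul_one]
  let c : ℍ[ℝ] := qmk 0 (x.imJ * m.imK - x.imK * m.imJ) (x.imK * m.imI - x.imI * m.imK)
    (x.imI * m.imJ - x.imJ * m.imI)
  have h1 := h c rfl (by simp [qdot, c, hx]; ring)
  have hcyc : ∀ a b : ℍ[ℝ], (a * b).re = (b * a).re := by
    intro a b
    simp only [Quaternion.re_mul]
    ring
  have h2 : (m * (p * c * r)).re = -(x * m * c).re := by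
    calc (m * (p * c * r)).re = (m * p * c * r).re := by simp only [mul_assoc]
      _ = (r * (m * p) * c).re := by rw [hcyc (m * p * c) r]; simp only [mul_assoc]
      _ = (r * p * m * c).re := by rw [hmp.eq]; simp only [mul_assoc]
      _ = -(x * m * c).re := by rw [hrp]; simp
  rw [h2] at h1
  have h3 : (x.imJ * m.imK - x.imK * m.imJ) ^ 2 + (x.imK * m.imI - x.imI * m.imK) ^ 2 +
      (x.imI * m.imJ - x.imJ * m.imI) ^ 2 = 0 := by
    simp only [Quaternion.re_mul, Quaternion.imI_mul, Quaternion.imJ_mul, Quaternion.imK_mul, c,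
      qmk_re, qmk_imI, qmk_imJ, qmk_imK, hx, hm] at h1
    linarith
  have s1 := sq_nonneg (x.imJ * m.imK - x.imK * m.imJ)
  have s2 := sq_nonneg (x.imK * m.imI - x.imI * m.imK)
  have s3 := sq_nonneg (x.imI * m.imJ - x.imJ * m.imI)
  have z1 := pow_eq_zero_iff (two_ne_zero) |>.mp (by linarith : (x.imJ * m.imK - x.imK * m.imJ) ^ 2 = 0)
  have z2 := pow_eq_zero_iff (two_ne_zero) |>.mp (by linarith : (x.imK * m.imI - x.imI * m.imK) ^ 2 = 0)
  have z3 := pow_eq_zero_iff (two_ne_zero) |>.mp (by linarith : (x.imI * m.imJ - x.imJ * m.imI) ^ 2 = 0)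
  rw [commute_iff_cross]
  refine ⟨?_, ?_, ?_⟩ <;> linarith

/-- A covector annihilating the image of the derivative of the product map on tangent vectors
vanishes. -/
theorem covector_eq_zero (A : RepS6Star) {m : ℍ[ℝ]} (hm : m.re = 0)
    (h : ∀ δ : Amb, (∀ k, (δ k).re = 0) → (∀ k, qdot (A.incl k) (δ k) = 0) →
      (m * dprod A.incl δ).re = 0) : imVec m = 0 := by
  set x := A.incl with hx
  obtain ⟨hre, hn, -⟩ := con_eq_zero_iff.mp (mem_range_incl_iff.mp ⟨A, rfl⟩).1
  have hp : x 0 * x 1 * x 2 * x 3 * x 4 * x 5 = 1 :=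
    congrArg (Subtype.val) (RepS6.prod_eq_one A.1)
  have hs : ∀ (k : Fin 6) (δ : ℍ[ℝ]), δ.re = 0 → qdot (x k) δ = 0 →
      (m * dprod x (Pi.single k δ)).re = 0 := by
    intro k δ h1 h2
    refine h _ (fun l => ?_) (fun l => ?_)
    · by_cases hl : l = k
      · subst hl; simpa using h1
      · simp [hl]
    · by_cases hl : l = k
      · subst hl; simpa using h2
      · simp [hl, qdot]
  -- Induction along the word: once `m` commutes with the earlier values it commutes with the prefix
  -- `p`, and varying the next value alone gives the next commutation.
  have step : ∀ (k : Fin 6) (p r : ℍ[ℝ]), p * x k * r = 1 → Commute m p →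
      (∀ δ, dprod x (Pi.single k δ) = p * δ * r) → Commute m (x k) := by
    intro k p r h1 h2 h3
    refine commute_of_dprod_step hm (hre k) (hn k) h1 h2 fun δ hδ hδ' => ?_
    rw [← h3]
    exact hs k δ hδ hδ'
  have c0 : Commute m (x 0) := step 0 1 (x 1 * x 2 * x 3 * x 4 * x 5)
    (by simpa only [one_mul, mul_assoc] using hp) (Commute.one_right m)
    (fun δ => by simp [dprod, Pi.single_apply, mul_assoc])
  have c1 : Commute m (x 1) := step 1 (x 0) (x 2 * x 3 * x 4 * x 5)
    (by simpa only [mul_assoc] using hp) c0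
    (fun δ => by simp [dprod, Pi.single_apply, mul_assoc])
  have c2 : Commute m (x 2) := step 2 (x 0 * x 1) (x 3 * x 4 * x 5)
    (by simpa only [mul_assoc] using hp) (c0.mul_right c1)
    (fun δ => by simp [dprod, Pi.single_apply, mul_assoc])
  have c3 : Commute m (x 3) := step 3 (x 0 * x 1 * x 2) (x 4 * x 5)
    (by simpa only [mul_assoc] using hp) ((c0.mul_right c1).mul_right c2)
    (fun δ => by simp [dprod, Pi.single_apply, mul_assoc])
  have c4 : Commute m (x 4) := step 4 (x 0 * x 1 * x 2 * x 3) (x 5)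
    hp (((c0.mul_right c1).mul_right c2).mul_right c3)
    (fun δ => by simp [dprod, Pi.single_apply, mul_assoc])
  have c5 : Commute m (x 5) := step 5 (x 0 * x 1 * x 2 * x 3 * x 4) 1
    (by rw [mul_one]; exact hp) ((((c0.mul_right c1).mul_right c2).mul_right c3).mul_right c4)
    (fun δ => by simp [dprod, Pi.single_apply])
  refine eq_zero_of_commute A fun k => ?_
  fin_cases k
  exacts [c0, c1, c2, c3, c4, c5]

/-- A functional vanishing on the range has a component on the product equation, encoded by an
imaginary quaternion `m`. Variations tangent to the spheres force `m = 0` by `covector_eq_zero`; the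
remaining components die on radial and on real variations. -/
theorem fderiv_con_surjective (A : RepS6Star) : Surjective (fderiv ℝ con A.incl) := by
  by_contra hns
  obtain ⟨hre, hn, -⟩ := con_eq_zero_iff.mp (mem_range_incl_iff.mp ⟨A, rfl⟩).1
  let D : Amb →ₗ[ℝ] ConSpace := (fderiv ℝ con A.incl : Amb →L[ℝ] ConSpace)
  have hlt : LinearMap.range D < ⊤ := lt_top_iff_ne_top.mpr fun h =>
    hns (LinearMap.range_eq_top.mp h)
  obtain ⟨φ, hφ0, hφ⟩ := Submodule.exists_le_ker_of_lt_top _ hlt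
  have hφD : ∀ δ, φ (fun k => (δ k).re, fun k => 2 * qdot (A.incl k) (δ k),
      imVec (dprod A.incl δ)) = 0 := by
    intro δ
    rw [← fderiv_con]
    exact hφ ⟨δ, rfl⟩
  have hsplit : ∀ a b c, φ (a, b, c) = φ (a, 0, 0) + φ (0, b, 0) + φ (0, 0, c) := by
    intro a b c
    rw [← map_add, ← map_add]
    simp
  -- the component of `φ` on the product equation
  let m : ℍ[ℝ] := qmk 0 (φ (0, 0, Pi.single 0 1)) (φ (0, 0, Pi.single 1 1))
    (φ (0, 0, Pi.single 2 1))
  have hm : ∀ q : ℍ[ℝ], φ (0, 0, imVec q) = -(m * q).re := by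
    intro q
    have e : imVec q = q.imI • (Pi.single 0 1 : Fin 3 → ℝ) + q.imJ • (Pi.single 1 1 : Fin 3 → ℝ) +
        q.imK • (Pi.single 2 1 : Fin 3 → ℝ) := by
      ext i; fin_cases i <;> simp [imVec]
    have e2 : ((0, 0, imVec q) : ConSpace) = q.imI • (0, 0, Pi.single 0 1) +
        q.imJ • (0, 0, Pi.single 1 1) + q.imK • (0, 0, Pi.single 2 1) := by
      rw [e]; simp
    rw [e2, map_add, map_add, map_smul, map_smul, map_smul]
    simp only [smul_eq_mul, Quaternion.re_mul, m, qmk_re, qmk_imI, qmk_imJ, qmk_imK]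
    ring
  have hm0 : imVec m = 0 := by
    refine covector_eq_zero A rfl fun δ h1 h2 => ?_
    have h3 := hφD δ
    simp only [h1, h2, mul_zero] at h3
    change φ (0, 0, imVec (dprod A.incl δ)) = 0 at h3
    rw [hm] at h3
    linarith
  have hm1 : m = 0 := by
    rw [imVec_eq_zero] at hm0
    rw [quaternion_ext_iff']
    exact ⟨rfl, hm0.1, hm0.2.1, hm0.2.2⟩
  have hφD' : ∀ δ : Amb, φ (fun k => (δ k).re, 0, 0) +
      φ (0, fun k => 2 * qdot (A.incl k) (δ k), 0) = 0 := by
    intro δ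
    have h3 := hφD δ
    rw [hsplit, hm, hm1] at h3
    simpa using h3
  -- Radial variations change the norms only; the factor `1 / 2` compensates for the `2` in the
  -- derivative of the squared norm.
  have hb : ∀ b, φ (0, b, 0) = 0 := by
    intro b
    have h := hφD' fun k => (b k / 2) • A.incl k
    have e1 : (fun k => ((b k / 2) • A.incl k).re) = 0 := by
      funext k
      simp [hre k]
    have e2 : (fun k => 2 * qdot (A.incl k) ((b k / 2) • A.incl k)) = b := by
      funext k
      have := hn k
      rw [Quaternion.normSq_def'] at this
      simp only [qdot, Quaternion.re_smul, Quaternion.imI_smul, Quaternion.imJ_smul,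
        Quaternion.imK_smul, smul_eq_mul]
      linear_combination b k * this
    rw [e1, e2] at h
    have h0 : φ (0, 0, 0) = 0 := map_zero φ
    rwa [h0, zero_add] at h
  have ha : ∀ a, φ (a, 0, 0) = 0 := by
    intro a
    have h := hφD' fun k => qmk (a k) 0 0 0
    rw [hb, add_zero] at h
    exact h
  have hc : ∀ c, φ (0, 0, c) = 0 := by
    intro c
    have h := hm (imQuat c)
    rw [imVec_imQuat, hm1] at h
    simpa using h
  refine hφ0 (LinearMap.ext fun ⟨a, b, c⟩ => ?_)
  rw [hsplit, ha, hb, hc]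
  simp

/-- Every non-abelian traceless representation has a slice chart around it. -/
theorem exists_sliceChart_at (A : RepS6Star) :
    ∃ S : SliceChart E6 (Fin 3 → ℝ) ConSpace RepS6Star.incl RepS6Star.cls,
      A.incl ∈ S.Θ.source := by
  let D : Amb →ₗ[ℝ] ConSpace := (fderiv ℝ con A.incl : Amb →L[ℝ] ConSpace)
  have hDτ : ∀ t, D (orbL A.incl t) = 0 := fderiv_con_orb A
  -- A linear left inverse of the infinitesimal action is automatically transverse to the orbit at
  -- `A`.
  obtain ⟨γ, hγ⟩ := LinearMap.exists_leftInverse_of_injective (orbL A.incl)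
    (LinearMap.ker_eq_bot'.mpr fun t ht => orb_injective A ht)
  have hγ' : ∀ t, γ (orbL A.incl t) = t := fun t => DFunLike.congr_fun hγ t
  -- The kernel of `Φ` has dimension `24 - 3 - 15 = 6`; any linear projection onto it supplies the
  -- coordinates `f`.
  let Φ : Amb →ₗ[ℝ] (Fin 3 → ℝ) × ConSpace := γ.prod D
  have hΦ : Surjective Φ := by
    rintro ⟨t, c⟩
    obtain ⟨x, hx⟩ := fderiv_con_surjective A c
    refine ⟨x + orbL A.incl (t - γ x), Prod.ext ?_ ?_⟩
    · change γ (x + orbL A.incl (t - γ x)) = t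
      rw [map_add, hγ']
      abel
    · change D (x + orbL A.incl (t - γ x)) = c
      rw [map_add, hDτ, add_zero]
      exact hx
  have hker : Module.finrank ℝ (LinearMap.ker Φ) = Module.finrank ℝ E6 := by
    have h1 := LinearMap.finrank_range_add_finrank_ker Φ
    rw [LinearMap.range_eq_top.mpr hΦ, finrank_top, finrank_amb] at h1
    simp at h1 ⊢
    omega
  let e : LinearMap.ker Φ ≃ₗ[ℝ] E6 := LinearEquiv.ofFinrankEq _ _ hker
  obtain ⟨P, hP⟩ := LinearMap.exists_leftInverse_of_injective (LinearMap.ker Φ).subtype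
    (LinearMap.ker_eq_bot.mpr Subtype.val_injective)
  let f : Amb →L[ℝ] E6 := LinearMap.toContinuousLinearMap (e.toLinearMap ∘ₗ P)
  let γ' : Amb →L[ℝ] (Fin 3 → ℝ) := LinearMap.toContinuousLinearMap γ
  have hfd : fderiv ℝ f A.incl = f := f.fderiv
  have hγd : fderiv ℝ (fun x => γ' x - γ' A.incl) A.incl = γ' := by
    rw [fderiv_sub_const]
    exact γ'.fderiv
  obtain ⟨O', -, hO⟩ := exists_sliceChart A isOpen_univ (mem_univ _) (f := f)
    (γ := fun x => γ' x - γ' A.incl) f.contDiff.contDiffOn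
    (γ'.contDiff.sub contDiff_const).contDiffOn (sub_self _) (fun δ h1 h2 h3 => by
      rw [hfd] at h1
      rw [hγd] at h2
      have hδ : δ ∈ LinearMap.ker Φ := Prod.ext h2 h3
      have h4 : P δ = 0 := e.map_eq_zero_iff.mp h1
      have h5 : P ((⟨δ, hδ⟩ : LinearMap.ker Φ) : Amb) = ⟨δ, hδ⟩ := 
        DFunLike.congr_fun hP (⟨δ, hδ⟩ : LinearMap.ker Φ)
      change P δ = _ at h5
      rw [h4] at h5
      exact (congrArg Subtype.val h5).symm)
    (fun t h => by
      rw [hγd] at h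
      exact (hγ' t).symm.trans h)
  obtain ⟨S, _, _, hS, _⟩ := hO univ univ_mem
  exact ⟨S, hS⟩

end SU2Char

namespace SU2Char

open SliceManifold Complex ComplexConjugate

/-! ### Quaternions as pairs of complex numbers -/

/-- The quaternion `a + b j`. -/
def cj (a b : ℂ) : ℍ[ℝ] := qmk a.re a.im b.re b.im

/-- The complex number `b` in `a + b j`. -/
def xi : ℍ[ℝ] →ₗ[ℝ] ℂ where
  toFun x := ⟨x.imJ, x.imK⟩
  map_add' x y := by apply Complex.ext <;> simp
  map_smul' c x := by apply Complex.ext <;> simp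

/-- The coefficient of `i`. -/
def hi : ℍ[ℝ] →ₗ[ℝ] ℝ where
  toFun x := x.imI
  map_add' _ _ := rfl
  map_smul' _ _ := rfl

@[simp] theorem xi_cj (a b : ℂ) : xi (cj a b) = b := rfl

@[simp] theorem hi_cj (a b : ℂ) : hi (cj a b) = a.im := rfl

theorem cj_mul (a b c d : ℂ) :
    cj a b * cj c d = cj (a * c - b * conj d) (a * d + b * conj c) := by
  ext <;> simp [cj] <;> ring

theorem cj_add (a b c d : ℂ) : cj a b + cj c d = cj (a + c) (b + d) := by
  ext <;> simp [cj]

theorem cj_sub (a b c d : ℂ) : cj a b - cj c d = cj (a - c) (b - d) := by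
  ext <;> simp [cj]

theorem star_cj (a b : ℂ) : star (cj a b) = cj (conj a) (-b) := by
  ext <;> simp [cj]

theorem cj_inj {a b c d : ℂ} : cj a b = cj c d ↔ a = c ∧ b = d := by
  rw [quaternion_ext_iff', Complex.ext_iff, Complex.ext_iff]
  simp [cj, and_assoc]

theorem normSq_cj (a b : ℂ) :
    Quaternion.normSq (cj a b) = Complex.normSq a + Complex.normSq b := by
  rw [Quaternion.normSq_def', Complex.normSq_apply, Complex.normSq_apply]
  simp only [cj, qmk_re, qmk_imI, qmk_imJ, qmk_imK]
  ring

theorem qdot_cj (a b c d : ℂ) : qdot (cj a b) (cj c d) = (a * conj c).re + (b * conj d).re := by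
  simp [qdot, cj]
  ring

theorem eq_cj (x : ℍ[ℝ]) : x = cj ⟨x.re, hi x⟩ (xi x) := by
  ext <;> rfl

theorem eq_cj_of_re_eq_zero {x : ℍ[ℝ]} (h : x.re = 0) : x = cj (I * hi x) (xi x) := by
  conv_lhs => rw [eq_cj x, h]
  congr 1
  apply Complex.ext <;> simp

theorem imVec_cj (a b : ℂ) : imVec (cj a b) = ![a.im, b.re, b.im] := rfl

/-- The products of five of the `u k`, with every second one conjugated. -/
def tw (u : Fin 6 → ℂ) : Fin 6 → ℂ :=
  ![u 1 * conj (u 2) * u 3 * conj (u 4) * u 5,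
    -(u 0 * conj (u 2) * u 3 * conj (u 4) * u 5),
    u 0 * conj (u 1) * u 3 * conj (u 4) * u 5,
    -(u 0 * conj (u 1) * u 2 * conj (u 4) * u 5),
    u 0 * conj (u 1) * u 2 * conj (u 3) * u 5,
    -(u 0 * conj (u 1) * u 2 * conj (u 3) * u 4)]

theorem tw_conj (u : Fin 6 → ℂ) (k : Fin 6) : tw (fun l => conj (u l)) k = conj (tw u k) := by
  fin_cases k <;> simp [tw]

/-- Each product contains three plain and two conjugated factors, so a unit `c` comes out to the
first power. -/
theorem tw_mul {c : ℂ} (hc : c * conj c = 1) (u : Fin 6 → ℂ) (k : Fin 6) :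
    tw (fun l => c * u l) k = c * tw u k := by
  have h : ∀ p q r s t : ℂ, c * p * conj (c * q) * (c * r) * conj (c * s) * (c * t) =
      c * (p * conj q * r * conj s * t) := by
    intro p q r s t
    simp only [map_mul]
    linear_combination (c * (p * conj q * r * conj s * t)) * (c * conj c + 1) * hc
  fin_cases k
  · exact h _ _ _ _ _
  · exact (congrArg Neg.neg (h _ _ _ _ _)).trans (mul_neg _ _).symm
  · exact h _ _ _ _ _
  · exact (congrArg Neg.neg (h _ _ _ _ _)).trans (mul_neg _ _).symm
  · exact h _ _ _ _ _
  · exact (congrArg Neg.neg (h _ _ _ _ _)).trans (mul_neg _ _).symm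

/-- The linear constraints on the normal coordinates along the planar configurations. -/
def constraint (u : Fin 6 → ℂ) : E6 →L[ℝ] ℂ × ℂ :=
  ∑ k, (EuclideanSpace.proj k : E6 →L[ℝ] ℝ).smulRight ((u k, tw u k) : ℂ × ℂ)

theorem constraint_apply (u : Fin 6 → ℂ) (h : E6) :
    constraint u h = (∑ k, (h k : ℂ) * u k, ∑ k, (h k : ℂ) * tw u k) := by
  simp only [constraint, _root_.sum_apply, ContinuousLinearMap.smulRight_apply,
    PiLp.proj_apply, Prod.smul_mk, Complex.real_smul]
  rw [Prod.ext_iff, Prod.fst_sum, Prod.snd_sum]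
  exact ⟨rfl, rfl⟩

theorem constraint_conj_eq_zero {u : Fin 6 → ℂ} {h : E6} :
    constraint (fun k => conj (u k)) h = 0 ↔ constraint u h = 0 := by
  have e : constraint (fun k => conj (u k)) h =
      (conj (constraint u h).1, conj (constraint u h).2) := by
    simp only [constraint_apply, tw_conj, map_sum, map_mul, conj_ofReal]
  rw [e, Prod.ext_iff, Prod.ext_iff]
  simp

theorem constraint_mul {c : ℂ} (hc : c * conj c = 1) (u : Fin 6 → ℂ) (h : E6) :
    constraint (fun k => c * u k) h = (c * (constraint u h).1, c * (constraint u h).2) := by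
  simp only [constraint_apply, tw_mul hc, Finset.mul_sum]
  congr 1 <;> exact Finset.sum_congr rfl fun k _ => by ring

/-- At a planar tuple the linearised product decouples: the angular variations `a` appear only in
the first complex coordinate, and the variations `h` towards `i` only in the second. -/
theorem dprod_planar (u : Fin 6 → ℂ) (h a : Fin 6 → ℝ) :
    dprod (fun k => cj 0 (u k)) (fun k => cj (I * h k) (I * a k * u k)) =
      cj (-(u 0 * conj (u 1) * u 2 * conj (u 3) * u 4 * conj (u 5)) * I *
        (a 0 - a 1 + a 2 - a 3 + a 4 - a 5 : ℝ)) (I * ∑ k, (h k : ℂ) * tw u k) := by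
  simp only [dprod, cj_mul, cj_add, cj_inj, Fin.sum_univ_six]
  constructor
  · simp
    ring
  · simp [tw]
    ring

/-! ### Planar representations -/

variable (A : RepS6Star)

theorem re_incl (k : Fin 6) : (A.incl k).re = 0 :=
  RepS6.re_eq_zero A.1 k

theorem normSq_incl (k : Fin 6) : Quaternion.normSq (A.incl k) = 1 := SU2.normSq _

theorem prod6_incl : prod6 A.incl = 1 := congrArg (Subtype.val) (RepS6.prod_eq_one A.1)

theorem incl_eq_cj (k : Fin 6) : A.incl k = cj (I * hi (A.incl k)) (xi (A.incl k)) :=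
  eq_cj_of_re_eq_zero (re_incl A k)

/-- A representation whose values are all orthogonal to `i`. -/
def Planar : Prop := ∀ k, hi (A.incl k) = 0

variable {A}

theorem Planar.incl_eq (hA : Planar A) : A.incl = fun k => cj 0 (xi (A.incl k)) := by
  funext k
  have := incl_eq_cj A k
  rwa [hA k, ofReal_zero, mul_zero] at this

theorem Planar.mul_conj (hA : Planar A) (k : Fin 6) : xi (A.incl k) * conj (xi (A.incl k)) = 1 := by
  have h := normSq_incl A k
  rw [congrFun hA.incl_eq k, normSq_cj, map_zero, zero_add] at h
  rw [Complex.mul_conj, h, ofReal_one]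

theorem Planar.prod (hA : Planar A) : xi (A.incl 0) * conj (xi (A.incl 1)) * xi (A.incl 2) *
    conj (xi (A.incl 3)) * xi (A.incl 4) * conj (xi (A.incl 5)) = -1 := by
  have h := prod6_incl A
  rw [hA.incl_eq] at h
  have e : (1 : ℍ[ℝ]) = cj 1 0 := by ext <;> simp [cj]
  simp only [prod6, cj_mul, e, cj_inj] at h
  have h1 := h.1
  simp at h1
  linear_combination (-1) * h1

/-- Vectors tangent to the product of the spheres. -/
theorem Planar.eq_cj_of_tangent (hA : Planar A) {δ : Amb} (h1 : ∀ k, (δ k).re = 0)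
    (h2 : ∀ k, qdot (A.incl k) (δ k) = 0) :
    ∃ a : Fin 6 → ℝ, δ = fun k => cj (I * hi (δ k)) (I * a k * xi (A.incl k)) := by
  refine ⟨fun k => (xi (δ k) * conj (xi (A.incl k))).im, ?_⟩
  funext k
  have h3 := h2 k
  rw [eq_cj_of_re_eq_zero (h1 k), congrFun hA.incl_eq k, qdot_cj] at h3
  have h4 : (xi (δ k) * conj (xi (A.incl k))).re = 0 := by
    simp at h3 ⊢
    linarith
  have h5 : I * ((xi (δ k) * conj (xi (A.incl k))).im : ℂ) = xi (δ k) * conj (xi (A.incl k)) := by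
    apply Complex.ext <;> simp at h4 ⊢
    linarith
  rw [h5, mul_assoc, mul_comm (conj _), hA.mul_conj, mul_one]
  exact eq_cj_of_re_eq_zero (h1 k)

theorem Planar.orb_eq (hA : Planar A) (t : Fin 3 → ℝ) : orb A.incl t = fun k =>
    cj (I * ((2 * (xi (A.incl k) * conj (⟨t 1, t 2⟩ : ℂ)).im : ℝ) : ℂ))
      (I * ((2 * t 0 : ℝ) : ℂ) * xi (A.incl k)) := by
  funext k
  have e : imQuat t = cj (I * (t 0 : ℝ)) ⟨t 1, t 2⟩ := by
    ext <;> simp [cj]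
  rw [orb, e]
  conv_lhs => rw [congrFun hA.incl_eq k]
  rw [cj_mul, cj_mul, cj_sub, cj_inj]
  constructor
  · apply Complex.ext <;> simp <;> ring
  · simp
    ring

/-- Pairing the hypothesis with `s` turns it into a sum of squares, so each tilt towards `i`
vanishes. The infinitesimal action is then zero, and it is injective. -/
theorem Planar.orb_eq_zero (hA : Planar A) {t : Fin 3 → ℝ} (h0 : t 0 = 0)
    (h : ∑ k, ((2 * (xi (A.incl k) * conj (⟨t 1, t 2⟩ : ℂ)).im : ℝ) : ℂ) * xi (A.incl k) = 0) :
    t = 0 := by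
  set s : ℂ := ⟨t 1, t 2⟩
  have h1 : ∑ k, 2 * ((xi (A.incl k) * conj s).im) ^ 2 = 0 := by
    have h2 := congrArg (fun z => (z * conj s).im) h
    simp only [Finset.sum_mul, zero_mul, zero_im, im_sum] at h2
    rw [← h2]
    refine Finset.sum_congr rfl fun k _ => ?_
    rw [mul_assoc, im_ofReal_mul]
    ring
  have h3 : ∀ k, (xi (A.incl k) * conj s).im = 0 := by
    intro k
    have := (Finset.sum_eq_zero_iff_of_nonneg fun k _ => by positivity).mp h1 k (Finset.mem_univ k)
    simpa using this
  apply orb_injective A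
  rw [hA.orb_eq]
  funext k
  simp only [s] at h3
  rw [h3 k, h0]
  ext <;> simp [cj]

/-- The tilts `H s` coming from orbits satisfy the second constraint, since the equations are
invariant, and they fill the first one by injectivity and dimension. The second constraint is the
planar form of the product equation, so its surjectivity follows from that of the derivative of
`con`. -/
theorem Planar.constraint_surjective (hA : Planar A) :
    Surjective (constraint fun k => xi (A.incl k)) := by
  set u : Fin 6 → ℂ := fun k => xi (A.incl k)
  let H (s : ℂ) : E6 := WithLp.toLp 2 fun k => 2 * (u k * conj s).im
  -- the orbit directions
  have hH2 : ∀ s, (constraint u (H s)).2 = 0 := by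
    intro s
    have h := fderiv_con_orb A ![0, s.re, s.im]
    rw [hA.orb_eq, fderiv_con] at h
    have h2 : imVec (dprod (fun k => cj 0 (u k)) fun k => cj (I * ((H s k : ℝ) : ℂ))
        (I * (((fun _ => 2 * (0 : ℝ)) k : ℝ) : ℂ) * u k)) = 0 := by
      have := (Prod.ext_iff.mp (Prod.ext_iff.mp h).2).2
      rw [hA.incl_eq] at this
      exact this
    rw [dprod_planar, imVec_cj] at h2
    have h3 := congrFun h2 1
    have h4 := congrFun h2 2
    simp only [Matrix.cons_val] at h3 h4
    have h5 : I * ∑ k, (H s k : ℂ) * tw u k = 0 := Complex.ext h3 h4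
    rw [constraint_apply]
    exact (mul_eq_zero.mp h5).resolve_left I_ne_zero
  let K : ℂ →ₗ[ℝ] ℂ :=
    { toFun := fun s => (constraint u (H s)).1
      map_add' := fun s s' => by
        have : H (s + s') = H s + H s' := by
          ext k
          simp [H]
          ring
        rw [this, map_add, Prod.fst_add]
      map_smul' := fun c s => by
        have : H (c • s) = c • H s := by
          ext k
          simp [H]
          ring
        rw [this, map_smul, Prod.smul_fst]; rfl }
  have hK : Injective K := by
    rw [← LinearMap.ker_eq_bot, LinearMap.ker_eq_bot']
    intro s hs
    have h1 : (constraint u (H s)).1 = 0 := hs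
    rw [constraint_apply] at h1
    have h2 := hA.orb_eq_zero (t := ![0, s.re, s.im]) rfl h1
    exact Complex.ext (congrFun h2 1) (congrFun h2 2)
  have hKs : Surjective K := LinearMap.injective_iff_surjective.mp hK
  rintro ⟨a, b⟩
  -- The right-hand side is chosen so that `δ` is tangent to the spheres and its second complex
  -- coordinate in `dprod_planar` equals `I * b`.
  obtain ⟨δ, hδ⟩ := fderiv_con_surjective A (0, 0, imVec (cj 0 (I * b)))
  rw [fderiv_con] at hδ
  have d1 : ∀ k, (δ k).re = 0 := fun k => congrFun (Prod.ext_iff.mp hδ).1 k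
  have d2 : ∀ k, qdot (A.incl k) (δ k) = 0 := fun k => by
    have := congrFun (Prod.ext_iff.mp (Prod.ext_iff.mp hδ).2).1 k
    simpa using this
  have d3 : imVec (dprod A.incl δ) = imVec (cj 0 (I * b)) :=
    (Prod.ext_iff.mp (Prod.ext_iff.mp hδ).2).2
  obtain ⟨c, hc⟩ := hA.eq_cj_of_tangent d1 d2
  let h : E6 := WithLp.toLp 2 fun k => hi (δ k)
  have d4 : imVec (dprod (fun k => cj 0 (u k)) fun k => cj (I * ((h k : ℝ) : ℂ))
      (I * (c k : ℂ) * u k)) = imVec (cj 0 (I * b)) := by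
    rw [← d3, hA.incl_eq]
    conv_rhs => rw [hc]
  rw [dprod_planar, imVec_cj, imVec_cj] at d4
  have h3 := congrFun d4 1
  have h4 := congrFun d4 2
  simp only [Matrix.cons_val] at h3 h4
  have h5 : I * ∑ k, (h k : ℂ) * tw u k = I * b := Complex.ext h3 h4
  have h6 : (constraint u h).2 = b := by
    rw [constraint_apply]
    exact mul_left_cancel₀ I_ne_zero h5
  obtain ⟨s, hs⟩ := hKs (a - (constraint u h).1)
  have hs' : (constraint u (H s)).1 = a - (constraint u h).1 := hs
  refine ⟨h + H s, ?_⟩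
  rw [map_add]
  refine Prod.ext ?_ ?_
  · rw [Prod.fst_add, hs']
    ring
  · rw [Prod.snd_add, h6, hH2, add_zero]

end SU2Char

/-! ### Smooth orthonormal frames of kernels -/

namespace SliceManifold

section Frame

variable {P E F : Type} [NormedAddCommGroup P] [NormedSpace ℝ P] [NormedAddCommGroup E]
  [InnerProductSpace ℝ E] [FiniteDimensional ℝ E] [NormedAddCommGroup F] [NormedSpace ℝ F]
  [FiniteDimensional ℝ F]

/-- A smooth family of surjective linear maps with two-dimensional kernels has a smooth orthonormal
frame for the kernels, locally. -/
theorem exists_smooth_orthonormal_kernel_frame {V : P → E →L[ℝ] F} (hV : ContDiff ℝ ∞ V)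
    (hdim : Module.finrank ℝ E = Module.finrank ℝ F + 2) {w₀ : P} (hs : Surjective (V w₀)) :
    ∃ (W : Set P) (n : Fin 2 → P → E), IsOpen W ∧ w₀ ∈ W ∧ (∀ i, ContDiffOn ℝ ∞ (n i) W) ∧
      ∀ w ∈ W, inner ℝ (n 0 w) (n 0 w) = 1 ∧ inner ℝ (n 1 w) (n 1 w) = 1 ∧
        inner ℝ (n 0 w) (n 1 w) = 0 ∧ V w (n 0 w) = 0 ∧ V w (n 1 w) = 0 ∧
        ∀ h, V w h = 0 → h = inner ℝ (n 0 w) h • n 0 w + inner ℝ (n 1 w) h • n 1 w := by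
  let V₀ : E →ₗ[ℝ] F := (V w₀ : E →L[ℝ] F)
  have hker : Module.finrank ℝ (LinearMap.ker V₀) = Module.finrank ℝ (Fin 2 → ℝ) := by
    have h1 := LinearMap.finrank_range_add_finrank_ker V₀
    rw [LinearMap.range_eq_top.mpr hs, finrank_top, hdim] at h1
    simp
    omega
  let e : LinearMap.ker V₀ ≃ₗ[ℝ] (Fin 2 → ℝ) := LinearEquiv.ofFinrankEq _ _ hker
  obtain ⟨Q, hQ⟩ := LinearMap.exists_leftInverse_of_injective (LinearMap.ker V₀).subtype
    (LinearMap.ker_eq_bot.mpr Subtype.val_injective)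
  let B : E →L[ℝ] (Fin 2 → ℝ) := LinearMap.toContinuousLinearMap (e.toLinearMap ∘ₗ Q)
  -- Completing `V w` by coordinates on the kernel at `w₀` gives an isomorphism near `w₀`; its
  -- inverse carries the standard basis of `ℝ²` to a smooth frame of the kernels.
  let T : P → E →L[ℝ] F × (Fin 2 → ℝ) := fun w => (V w).prod B
  have hT : ContDiff ℝ ∞ T := by
    have e : T = fun w => (ContinuousLinearMap.inl ℝ F (Fin 2 → ℝ)).comp (V w) +
        (ContinuousLinearMap.inr ℝ F (Fin 2 → ℝ)).comp B := by
      funext w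
      ext1 x
      simp [T]
    rw [e]
    exact (contDiff_const.clm_comp hV).add contDiff_const
  have hinj₀ : Injective (T w₀) := by
    rw [injective_iff_map_eq_zero]
    intro δ hδ
    have h1 : V₀ δ = 0 := (Prod.ext_iff.mp hδ).1
    have h2 : B δ = 0 := (Prod.ext_iff.mp hδ).2
    have h4 : Q δ = 0 := e.map_eq_zero_iff.mp h2
    have h5 : Q ((⟨δ, h1⟩ : LinearMap.ker V₀) : E) = ⟨δ, h1⟩ :=
      DFunLike.congr_fun hQ (⟨δ, h1⟩ : LinearMap.ker V₀)
    change Q δ = _ at h5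
    rw [h4] at h5
    exact (congrArg Subtype.val h5).symm
  have hfin : Module.finrank ℝ E = Module.finrank ℝ (F × (Fin 2 → ℝ)) := by
    rw [Module.finrank_prod, hdim]
    simp
  let e₀ : E ≃L[ℝ] F × (Fin 2 → ℝ) := (LinearEquiv.ofInjectiveOfFinrankEq
    (T w₀ : E →ₗ[ℝ] F × (Fin 2 → ℝ)) hinj₀ hfin).toContinuousLinearEquiv
  have he₀ : (e₀ : E →L[ℝ] F × (Fin 2 → ℝ)) = T w₀ := by
    ext1 x
    rfl
  let W : Set P := T ⁻¹' range ((↑) : (E ≃L[ℝ] F × (Fin 2 → ℝ)) → E →L[ℝ] F × (Fin 2 → ℝ))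
  have hWo : IsOpen W := (ContinuousLinearEquiv.isOpen (𝕜 := ℝ)).preimage hT.continuous
  have hw₀ : w₀ ∈ W := ⟨e₀, he₀⟩
  let m : Fin 2 → P → E := fun i w => (T w).inverse (0, Pi.single i 1)
  have hm : ∀ i, ContDiffOn ℝ ∞ (m i) W := by
    rintro i w ⟨e', he'⟩
    have h1 : ContDiffAt ℝ ∞ ContinuousLinearMap.inverse (T w) := by
      rw [← he']
      exact contDiffAt_map_inverse e'
    exact ((h1.comp w hT.contDiffAt).clm_apply contDiffAt_const).contDiffWithinAt
  have hTm : ∀ w ∈ W, ∀ i, T w (m i w) = (0, Pi.single i 1) := by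
    rintro w ⟨e', he'⟩ i
    simp only [m, ← he', ContinuousLinearMap.inverse_equiv]
    exact e'.apply_symm_apply _
  have hTinj : ∀ w ∈ W, Injective (T w) := by
    rintro w ⟨e', he'⟩
    rw [← he']
    exact e'.injective
  have hspan : ∀ w ∈ W, ∀ h, V w h = 0 → h = B h 0 • m 0 w + B h 1 • m 1 w := by
    intro w hw h hh
    apply hTinj w hw
    rw [map_add, map_smul, map_smul, hTm w hw, hTm w hw]
    refine Prod.ext ?_ ?_
    · simpa [T] using hh
    · ext i
      fin_cases i <;> simp [T]
  have hind : ∀ w ∈ W, ∀ a b : ℝ, a • m 0 w + b • m 1 w = 0 → a = 0 ∧ b = 0 := by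
    intro w hw a b hab
    have h1 := congrArg (fun x => (T w x).2) hab
    simp only [map_add, map_smul, hTm w hw, map_zero] at h1
    have h2 := congrFun h1 0
    have h3 := congrFun h1 1
    simp at h2 h3
    exact ⟨h2, h3⟩
  have hVm : ∀ w ∈ W, ∀ i, V w (m i w) = 0 := fun w hw i => (Prod.ext_iff.mp (hTm w hw i)).1
  -- orthonormalisation
  let n₀ : P → E := fun w => ‖m 0 w‖⁻¹ • m 0 w
  let p : P → E := fun w => m 1 w - inner ℝ (n₀ w) (m 1 w) • n₀ w
  have hm0 : ∀ w ∈ W, m 0 w ≠ 0 := fun w hw h => by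
    have := hind w hw 1 0 (by rw [h]; simp)
    exact one_ne_zero this.1
  have hp0 : ∀ w ∈ W, p w ≠ 0 := fun w hw h => by
    have := hind w hw (-(inner ℝ (n₀ w) (m 1 w) * ‖m 0 w‖⁻¹)) 1 (by
      rw [← h]
      simp only [p, n₀, smul_smul, neg_smul, one_smul]
      abel)
    exact one_ne_zero this.2
  have hn₀ : ContDiffOn ℝ ∞ n₀ W :=
    (((hm 0).norm ℝ hm0).inv fun w hw => norm_ne_zero_iff.mpr (hm0 w hw)).smul (hm 0)
  have hp : ContDiffOn ℝ ∞ p W := (hm 1).sub ((hn₀.inner ℝ (hm 1)).smul hn₀)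
  have hunit : ∀ x : E, x ≠ 0 → inner ℝ (‖x‖⁻¹ • x) (‖x‖⁻¹ • x) = 1 := by
    intro x hx
    rw [real_inner_self_eq_norm_sq, norm_smul, norm_inv, norm_norm,
      inv_mul_cancel₀ (norm_ne_zero_iff.mpr hx), one_pow]
  have h00 : ∀ w ∈ W, inner ℝ (n₀ w) (n₀ w) = 1 := fun w hw => hunit _ (hm0 w hw)
  have h0p : ∀ w ∈ W, inner ℝ (n₀ w) (p w) = 0 := fun w hw => by
    simp only [p, inner_sub_right, inner_smul_right, h00 w hw]
    ring
  refine ⟨W, ![n₀, fun w => ‖p w‖⁻¹ • p w], hWo, hw₀, fun i => ?_, fun w hw => ?_⟩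
  · fin_cases i
    · exact hn₀
    · exact ((hp.norm ℝ hp0).inv fun w hw => norm_ne_zero_iff.mpr (hp0 w hw)).smul hp
  · simp only [Matrix.cons_val_zero, Matrix.cons_val_one]
    have hVn : V w (n₀ w) = 0 := by simp [n₀, hVm w hw]
    have hVp : V w (p w) = 0 := by simp [p, hVm w hw, hVn]
    have h01 : inner ℝ (n₀ w) (‖p w‖⁻¹ • p w) = 0 := by
      rw [inner_smul_right, h0p w hw, mul_zero]
    have h11 := hunit _ (hp0 w hw)
    refine ⟨h00 w hw, h11, h01, hVn, by simp [hVp], fun h hh => ?_⟩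
    have key : ∃ a b : ℝ, h = a • n₀ w + b • (‖p w‖⁻¹ • p w) := by
      refine ⟨B h 0 * ‖m 0 w‖ + B h 1 * inner ℝ (n₀ w) (m 1 w), B h 1 * ‖p w‖, ?_⟩
      have e0 : ‖m 0 w‖ • n₀ w = m 0 w := by
        simp only [n₀, smul_smul]
        rw [mul_inv_cancel₀ (norm_ne_zero_iff.mpr (hm0 w hw)), one_smul]
      have e1 : ‖p w‖ • (‖p w‖⁻¹ • p w) = p w := by
        rw [smul_smul, mul_inv_cancel₀ (norm_ne_zero_iff.mpr (hp0 w hw)), one_smul]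
      rw [add_smul, mul_smul, mul_smul, mul_smul, e0, e1]
      conv_lhs => rw [hspan w hw h hh]
      simp only [p, smul_sub]
      abel
    obtain ⟨a, b, hab⟩ := key
    have gen : ∀ x y : E, inner ℝ x x = 1 → inner ℝ y y = 1 → inner ℝ x y = 0 →
        h = a • x + b • y → h = inner ℝ x h • x + inner ℝ y h • y := by
      intro x y hx hy hxy hh
      have ha : inner ℝ x h = a := by
        rw [hh, inner_add_right, inner_smul_right, inner_smul_right, hx, hxy]
        ring
      have hb : inner ℝ y h = b := by
        rw [hh, inner_add_right, inner_smul_right, inner_smul_right, real_inner_comm, hxy, hy]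
        ring
      rw [ha, hb]
      exact hh
    exact gen _ _ (h00 w hw) h11 h01 hab

end Frame

end SliceManifold

namespace SU2Char

open SliceManifold Complex ComplexConjugate

/-! ### Coordinates adapted to the involution -/

/-- The index `k`, among the six. -/
abbrev ix (k : Fin 4) : Fin 6 := ⟨k, by omega⟩

/-- The index after `k`, among the six. -/
abbrev ixs (k : Fin 4) : Fin 6 := ⟨k + 1, by omega⟩

/-- The relative positions of consecutive planar parts. -/
def rel (x : Amb) (k : Fin 4) : ℂ := xi (x (ix k)) * conj (xi (x (ixs k)))

/-- The tuple of `i`-coordinates. -/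
def hvec : Amb →ₗ[ℝ] E6 where
  toFun x := WithLp.toLp 2 fun k => hi (x k)
  map_add' x y := by ext k; simp
  map_smul' c x := by ext k; simp

theorem hvec_apply (x : Amb) (k : Fin 6) : hvec x k = hi (x k) := rfl

/-- The sum of the products of `i`-coordinates and planar parts. -/
def mixed (x : Amb) : ℂ := ∑ k, (hi (x k) : ℂ) * xi (x k)

/-- The planar configuration with given relative positions. -/
def uOf (η : Fin 4 → ℂ) : Fin 6 → ℂ :=
  ![1, conj (η 0), conj (η 0) * conj (η 1), conj (η 0) * conj (η 1) * conj (η 2),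
    conj (η 0) * conj (η 1) * conj (η 2) * conj (η 3),
    -- The last entry is determined by the others through the alternating product relation
    -- `Planar.prod`, so four relative positions suffice.
    -(η 0 * η 2 * (conj (η 0) * conj (η 1) * conj (η 2) * conj (η 3)))]

theorem uOf_conj (η : Fin 4 → ℂ) (k : Fin 6) :
    uOf (fun l => conj (η l)) k = conj (uOf η k) := by
  fin_cases k <;> simp [uOf]

/-- Relative positions determine a planar tuple up to rotation about `i`; `uOf` picks the rotated
copy whose first entry is `1`. -/
theorem Planar.uOf_rel {A : RepS6Star} (hA : Planar A) (k : Fin 6) :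
    uOf (rel A.incl) k = conj (xi (A.incl 0)) * xi (A.incl k) := by
  have h := hA.mul_conj
  have hp := hA.prod
  have h0 := h 0
  have h1 := h 1
  have h2 := h 2
  have h3 := h 3
  have h4 := h 4
  have h5 := h 5
  have r0 : rel A.incl 0 = xi (A.incl 0) * conj (xi (A.incl 1)) := rfl
  have r1 : rel A.incl 1 = xi (A.incl 1) * conj (xi (A.incl 2)) := rfl
  have r2 : rel A.incl 2 = xi (A.incl 2) * conj (xi (A.incl 3)) := rfl
  have r3 : rel A.incl 3 = xi (A.incl 3) * conj (xi (A.incl 4)) := rfl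
  have e : ∀ a b c : ℂ, b * conj b = 1 → conj a * b * (conj b * c) = conj a * c := by
    intro a b c hb
    linear_combination (conj a * c) * hb
  fin_cases k
  · simp only [uOf, Fin.zero_eta, Matrix.cons_val]
    rw [mul_comm, h 0]
  · simp [uOf, r0, r1, r2, r3]
  · simp [uOf, r0, r1, r2, r3, e _ _ _ h1]
  · simp [uOf, r0, r1, r2, r3, e _ _ _ h1, e _ _ _ h2]
  · simp [uOf, r0, r1, r2, r3, e _ _ _ h1, e _ _ _ h2, e _ _ _ h3]
  · simp [uOf, r0, r1, r2, r3, e _ _ _ h1, e _ _ _ h2, e _ _ _ h3]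
    linear_combination (-conj (xi (A.incl 0)) * xi (A.incl 5)) * hp +
      (conj (xi (A.incl 0)) * (xi (A.incl 0) * conj (xi (A.incl 1)) * xi (A.incl 2) *
    conj (xi (A.incl 3)) * xi (A.incl 4))) * h5

/-- The constraint as a function of the relative positions. -/
theorem contDiff_constraint_uOf {P : Type} [NormedAddCommGroup P] [NormedSpace ℝ P]
    {η : P → Fin 4 → ℂ} (hη : ∀ k, ContDiff ℝ ∞ fun p => η p k) :
    ContDiff ℝ ∞ fun p => constraint (uOf (η p)) := by
  have hc : ∀ k, ContDiff ℝ ∞ fun p => conj (η p k) := fun k =>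
    conjCLE.contDiff.comp (hη k)
  have hu : ∀ k, ContDiff ℝ ∞ fun p => uOf (η p) k := by
    intro k
    have h0 := hη 0
    have h2 := hη 2
    have c0 := hc 0
    have c1 := hc 1
    have c2 := hc 2
    have c3 := hc 3
    fin_cases k
    · exact contDiff_const
    · exact c0
    · exact c0.mul c1
    · exact (c0.mul c1).mul c2
    · exact ((c0.mul c1).mul c2).mul c3
    · exact ((h0.mul h2).mul (((c0.mul c1).mul c2).mul c3)).neg
  have hcu : ∀ k, ContDiff ℝ ∞ fun p => conj (uOf (η p) k) := fun k =>
    conjCLE.contDiff.comp (hu k)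
  have ht : ∀ k, ContDiff ℝ ∞ fun p => tw (uOf (η p)) k := by
    intro k
    fin_cases k
    · exact ((((hu 1).mul (hcu 2)).mul (hu 3)).mul (hcu 4)).mul (hu 5)
    · exact (((((hu 0).mul (hcu 2)).mul (hu 3)).mul (hcu 4)).mul (hu 5)).neg
    · exact ((((hu 0).mul (hcu 1)).mul (hu 3)).mul (hcu 4)).mul (hu 5)
    · exact (((((hu 0).mul (hcu 1)).mul (hu 2)).mul (hcu 4)).mul (hu 5)).neg
    · exact ((((hu 0).mul (hcu 1)).mul (hu 2)).mul (hcu 3)).mul (hu 5)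
    · exact (((((hu 0).mul (hcu 1)).mul (hu 2)).mul (hcu 3)).mul (hu 4)).neg
  refine ContDiff.sum fun k _ => ?_
  exact contDiff_const.smulRight ((hu k).prodMk (ht k))

/-- The unit complex numbers at the tangents `w` from the `η k`. -/
def etaOf (η : Fin 4 → ℂ) (w : Fin 4 → ℝ) (k : Fin 4) : ℂ :=
  ((Real.sqrt (1 + w k ^ 2))⁻¹ : ℝ) • (η k * (1 + I * w k))

theorem etaOf_zero (η : Fin 4 → ℂ) : etaOf η 0 = η := by
  funext k
  simp [etaOf]

theorem contDiff_etaOf (η : Fin 4 → ℂ) (k : Fin 4) : ContDiff ℝ ∞ fun w => etaOf η w k := by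
  have hw : ContDiff ℝ ∞ fun w : Fin 4 → ℝ => w k := contDiff_apply ℝ ℝ k
  have hpos : ∀ w : Fin 4 → ℝ, 1 + w k ^ 2 ≠ 0 := fun w => by positivity
  refine ContDiff.smul (ContDiff.inv ((contDiff_const.add (hw.pow 2)).sqrt hpos) fun w => ?_) ?_
  · exact (Real.sqrt_pos.mpr (by positivity)).ne'
  · exact contDiff_const.mul (contDiff_const.add (contDiff_const.mul (ofRealCLM.contDiff.comp hw)))

theorem etaOf_mul_conj {η : Fin 4 → ℂ} (hη : ∀ k, η k * conj (η k) = 1) (w : Fin 4 → ℝ)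
    (k : Fin 4) : etaOf η w k * conj (etaOf η w k) = 1 := by
  have hpos : 0 < 1 + w k ^ 2 := by positivity
  have hs := Real.mul_self_sqrt hpos.le
  have hs0 := (Real.sqrt_pos.mpr hpos).ne'
  have e : (((Real.sqrt (1 + w k ^ 2))⁻¹ : ℝ) : ℂ) * ((Real.sqrt (1 + w k ^ 2))⁻¹ : ℝ) *
      (1 + w k ^ 2 : ℝ) = 1 := by
    rw [← ofReal_mul, ← ofReal_mul, ← mul_inv, hs, inv_mul_cancel₀ hpos.ne', ofReal_one]
  simp only [etaOf, real_smul, map_mul, conj_ofReal, map_add, map_one, conj_I]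
  push_cast at e ⊢
  linear_combination (((Real.sqrt (1 + w k ^ 2) : ℝ) : ℂ)⁻¹ ^ 2 * (1 + (w k : ℂ) ^ 2)) * hη k + e -
    (((Real.sqrt (1 + w k ^ 2) : ℝ) : ℂ)⁻¹ ^ 2 * (w k : ℂ) ^ 2 * (η k * conj (η k))) * I_sq

/-- The tangents of the angles from the `η k` to the `p k`. -/
def tanOf (η p : Fin 4 → ℂ) (k : Fin 4) : ℝ := (p k * conj (η k)).im / (p k * conj (η k)).re

/-- Away from planar tuples the relative positions are no longer of length one. In the half-plane
around `η k` the tangent records exactly the direction, so the length is the only loss. -/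
theorem eq_smul_etaOf_tanOf {η p : Fin 4 → ℂ} (hη : ∀ k, η k * conj (η k) = 1) {k : Fin 4}
    (hp : 0 < (p k * conj (η k)).re) : ∃ c : ℝ, 0 < c ∧ p k = c * etaOf η (tanOf η p) k := by
  set q := p k * conj (η k)
  have hpos : 0 < 1 + tanOf η p k ^ 2 := by positivity
  have hs0 : ((Real.sqrt (1 + tanOf η p k ^ 2) : ℝ) : ℂ) ≠ 0 :=
    ofReal_ne_zero.mpr (Real.sqrt_pos.mpr hpos).ne'
  refine ⟨q.re * Real.sqrt (1 + tanOf η p k ^ 2), mul_pos hp (Real.sqrt_pos.mpr hpos), ?_⟩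
  have h1 : q = q.re * (1 + I * (tanOf η p k : ℝ)) := by
    have : q.re * tanOf η p k = q.im := by
      simp only [tanOf]
      exact mul_div_cancel₀ _ hp.ne'
    apply Complex.ext
    · simp
    · simp [this]
  have h2 : p k = q * η k := by
    simp only [q]
    linear_combination (-p k) * hη k
  rw [h2]
  conv_lhs => rw [h1]
  simp only [etaOf, real_smul]
  push_cast
  field_simp

theorem tanOf_smul {η p p' : Fin 4 → ℂ} {k : Fin 4} {c : ℝ} (hc : 0 < c) (h : p' k = c * p k) :
    tanOf η p' k = tanOf η p k := by
  simp only [tanOf, h, mul_assoc, re_ofReal_mul, im_ofReal_mul]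
  exact mul_div_mul_left _ _ hc.ne'

theorem eq_of_smul_eq_smul {a b : ℂ} (ha : a * conj a = 1) (hb : b * conj b = 1) {c d : ℝ}
    (hc : 0 < c) (hd : 0 < d) (h : (c : ℂ) * a = d * b) : a = b := by
  have na : ‖a‖ = 1 := by
    rw [mul_conj, normSq_eq_norm_sq] at ha
    have : ‖a‖ ^ 2 = 1 := by exact_mod_cast ha
    nlinarith [norm_nonneg a]
  have nb : ‖b‖ = 1 := by
    rw [mul_conj, normSq_eq_norm_sq] at hb
    have : ‖b‖ ^ 2 = 1 := by exact_mod_cast hb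
    nlinarith [norm_nonneg b]
  have h1 := congrArg norm h
  rw [norm_mul, norm_mul, na, nb, norm_real, norm_real, Real.norm_of_nonneg hc.le,
    Real.norm_of_nonneg hd.le, mul_one, mul_one] at h1
  rw [h1] at h
  exact mul_left_cancel₀ (ofReal_ne_zero.mpr hd.ne') h

end SU2Char

/-! ### Coordinates around planar representations -/

namespace SU2Char

open SliceManifold Complex ComplexConjugate

/-- A smooth orthonormal frame of the normal spaces of the planar configurations with relative
positions near `η`. -/
structure FoldFrame where
  η : Fin 4 → ℂ
  unit : ∀ k, η k * conj (η k) = 1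
  W : Set (Fin 4 → ℝ)
  n : Fin 2 → (Fin 4 → ℝ) → E6
  isOpen : IsOpen W
  smooth : ∀ i, ContDiffOn ℝ ∞ (n i) W
  frame : ∀ w ∈ W, inner ℝ (n 0 w) (n 0 w) = 1 ∧ inner ℝ (n 1 w) (n 1 w) = 1 ∧
    inner ℝ (n 0 w) (n 1 w) = 0 ∧ constraint (uOf (etaOf η w)) (n 0 w) = 0 ∧
    constraint (uOf (etaOf η w)) (n 1 w) = 0 ∧
    ∀ h, constraint (uOf (etaOf η w)) h = 0 →
      h = inner ℝ (n 0 w) h • n 0 w + inner ℝ (n 1 w) h • n 1 w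

theorem Planar.rel_mul_conj {A : RepS6Star} (hA : Planar A) (k : Fin 4) :
    rel A.incl k * conj (rel A.incl k) = 1 := by
  have h1 := hA.mul_conj (ix k)
  have h2 := hA.mul_conj (ixs k)
  simp only [rel, map_mul, conj_conj]
  linear_combination xi (A.incl (ixs k)) * conj (xi (A.incl (ixs k))) * h1 + h2

theorem Planar.constraint_uOf_rel {A : RepS6Star} (hA : Planar A) (h : E6) :
    constraint (uOf (rel A.incl)) h =
      (conj (xi (A.incl 0)) * (constraint (fun k => xi (A.incl k)) h).1,
        conj (xi (A.incl 0)) * (constraint (fun k => xi (A.incl k)) h).2) := by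
  rw [funext hA.uOf_rel]
  refine constraint_mul ?_ _ _
  rw [conj_conj, mul_comm]
  exact hA.mul_conj 0

theorem Planar.exists_foldFrame {A : RepS6Star} (hA : Planar A) :
    ∃ D : FoldFrame, D.η = rel A.incl ∧ 0 ∈ D.W := by
  have hs : Surjective (constraint (uOf (etaOf (rel A.incl) 0))) := by
    rw [etaOf_zero]
    rintro ⟨a, b⟩
    obtain ⟨h, hh⟩ := hA.constraint_surjective (xi (A.incl 0) * a, xi (A.incl 0) * b)
    refine ⟨h, ?_⟩
    rw [hA.constraint_uOf_rel, hh]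
    have h0 := hA.mul_conj 0
    refine Prod.ext ?_ ?_
    · linear_combination a * h0
    · linear_combination b * h0
  obtain ⟨W, n, hW, h0, hn, hf⟩ := exists_smooth_orthonormal_kernel_frame
    (contDiff_constraint_uOf fun k => contDiff_etaOf (rel A.incl) k) (by simp) hs
  exact ⟨⟨rel A.incl, hA.rel_mul_conj, W, n, hW, hn, hf⟩, rfl, h0⟩

theorem contDiff_xi (k : Fin 6) : ContDiff ℝ ∞ fun x : Amb => xi (x k) :=
  (contDiff_linear xi).comp (contDiff_component k)

theorem contDiff_hi (k : Fin 6) : ContDiff ℝ ∞ fun x : Amb => hi (x k) :=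
  (contDiff_linear hi).comp (contDiff_component k)

theorem contDiff_rel_mul (c : ℂ) (k : Fin 4) : ContDiff ℝ ∞ fun x : Amb => rel x k * c :=
  ((contDiff_xi _).mul (conjCLE.contDiff.comp (contDiff_xi _))).mul contDiff_const

theorem contDiff_mixed : ContDiff ℝ ∞ mixed :=
  ContDiff.sum fun k _ => (ofRealCLM.contDiff.comp (contDiff_hi k)).mul (contDiff_xi k)

namespace FoldFrame

variable (D : FoldFrame)

/-- The domain of the coordinates. -/
def dom : Set Amb :=
  {x | ∀ k, 0 < (rel x k * conj (D.η k)).re} ∩ (fun x => tanOf D.η (rel x)) ⁻¹' D.W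

/-- Coordinates transverse to the orbits. -/
def coord (x : Amb) : E6 :=
  splitC.symm (tanOf D.η (rel x), ⟨inner ℝ (D.n 0 (tanOf D.η (rel x))) (hvec x),
    inner ℝ (D.n 1 (tanOf D.η (rel x))) (hvec x)⟩)

theorem contDiffOn_tanOf :
    ContDiffOn ℝ ∞ (fun x => tanOf D.η (rel x)) {x | ∀ k, 0 < (rel x k * conj (D.η k)).re} := by
  refine contDiffOn_pi.mpr fun k => ContDiffOn.div ?_ ?_ fun x hx => (hx k).ne'
  · exact (imCLM.contDiff.comp (contDiff_rel_mul (conj (D.η k)) k)).contDiffOn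
  · exact (reCLM.contDiff.comp (contDiff_rel_mul (conj (D.η k)) k)).contDiffOn

theorem isOpen_dom : IsOpen D.dom := by
  refine D.contDiffOn_tanOf.continuousOn.isOpen_inter_preimage ?_ D.isOpen
  rw [setOf_forall]
  refine isOpen_iInter_of_finite fun k => ?_
  exact isOpen_lt continuous_const
    (reCLM.contDiff.comp (contDiff_rel_mul (conj (D.η k)) k)).continuous

theorem contDiffOn_inner (i : Fin 2) :
    ContDiffOn ℝ ∞ (fun x => inner ℝ (D.n i (tanOf D.η (rel x))) (hvec x)) D.dom :=
  ((D.smooth i).comp (D.contDiffOn_tanOf.mono inter_subset_left) fun _ hx => hx.2).inner ℝ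
    (contDiff_linear hvec).contDiffOn

theorem contDiffOn_coord : ContDiffOn ℝ ∞ D.coord D.dom := by
  refine splitC.symm.contDiff.comp_contDiffOn
    ((D.contDiffOn_tanOf.mono inter_subset_left).prodMk ?_)
  exact equivRealProdCLM.symm.contDiff.comp_contDiffOn
    ((D.contDiffOn_inner 0).prodMk (D.contDiffOn_inner 1))

theorem splitC_coord (x : Amb) : splitC (D.coord x) =
    (tanOf D.η (rel x), ⟨inner ℝ (D.n 0 (tanOf D.η (rel x))) (hvec x),
      inner ℝ (D.n 1 (tanOf D.η (rel x))) (hvec x)⟩) := splitC.apply_symm_apply _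

end FoldFrame

/-- The normalisation of the position within the orbits. -/
def gauge (u : ℂ) (x : Amb) : Fin 3 → ℝ :=
  ![(xi (x 0) * conj u).im, (mixed x).re, (mixed x).im]

theorem contDiff_gauge (u : ℂ) : ContDiff ℝ ∞ (gauge u) := by
  refine contDiff_pi.mpr fun i => ?_
  fin_cases i
  · exact imCLM.contDiff.comp ((contDiff_xi 0).mul contDiff_const)
  · exact reCLM.contDiff.comp contDiff_mixed
  · exact imCLM.contDiff.comp contDiff_mixed

theorem gauge_eq_zero {u : ℂ} {x : Amb} :
    gauge u x = 0 ↔ (xi (x 0) * conj u).im = 0 ∧ mixed x = 0 := by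
  constructor
  · intro h
    exact ⟨congrFun h 0, Complex.ext (congrFun h 1) (congrFun h 2)⟩
  · rintro ⟨h1, h2⟩
    ext i; fin_cases i <;> simp [gauge, h1, h2]

theorem hasDerivAt_comp_xi (x δ : Amb) (k : Fin 6) :
    HasDerivAt (fun s : ℝ => xi ((x + s • δ) k)) (xi (δ k)) 0 :=
  hasDerivAt_linear xi (hasDerivAt_line x δ k)

theorem HasDerivAt.linear_comp {V W : Type} [NormedAddCommGroup V] [NormedSpace ℝ V]
    [NormedAddCommGroup W] [NormedSpace ℝ W] (L : V →L[ℝ] W) {c : ℝ → V} {d : V} {s : ℝ}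
    (h : HasDerivAt c d s) : HasDerivAt (fun s => L (c s)) (L d) s :=
  HasFDerivAt.comp_hasDerivAt s L.hasFDerivAt h

variable {A : RepS6Star}

/-- In the product rule the terms that vary `xi` carry the factor `hi (A.incl k) = 0`. -/
theorem Planar.hasDerivAt_mixed (hA : Planar A) (δ : Amb) :
    HasDerivAt (fun s : ℝ => mixed (A.incl + s • δ)) (∑ k, (hi (δ k) : ℂ) * xi (A.incl k)) 0 := by
  refine HasDerivAt.fun_sum fun k _ => ?_
  have h1 := (HasDerivAt.linear_comp ofRealCLM
    (hasDerivAt_linear hi (hasDerivAt_line A.incl δ k))).fun_mul (hasDerivAt_comp_xi A.incl δ k)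
  simpa [hA k] using h1

theorem Planar.fderiv_gauge (hA : Planar A) (u : ℂ) (δ : Amb) :
    fderiv ℝ (gauge u) A.incl δ = ![(xi (δ 0) * conj u).im,
      (∑ k, (hi (δ k) : ℂ) * xi (A.incl k)).re, (∑ k, (hi (δ k) : ℂ) * xi (A.incl k)).im] := by
  refine fderiv_apply_eq ((contDiff_gauge u).contDiffAt.differentiableAt (by simp)) ?_
  refine hasDerivAt_pi.mpr fun i => ?_
  fin_cases i
  · exact HasDerivAt.linear_comp imCLM ((hasDerivAt_comp_xi A.incl δ 0).mul_const (conj u))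
  · exact HasDerivAt.linear_comp reCLM (hA.hasDerivAt_mixed δ)
  · exact HasDerivAt.linear_comp imCLM (hA.hasDerivAt_mixed δ)

theorem tanOf_self (p : Fin 4 → ℂ) : tanOf p p = 0 := by
  funext k
  simp [tanOf, mul_conj]

theorem Planar.gauge_incl (hA : Planar A) : gauge (xi (A.incl 0)) A.incl = 0 := by
  rw [gauge_eq_zero, hA.mul_conj]
  refine ⟨one_im, Finset.sum_eq_zero fun k _ => ?_⟩
  simp [hA k]

theorem Planar.hvec_incl (hA : Planar A) : hvec A.incl = 0 := by
  ext k
  exact hA k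

theorem Planar.mem_dom (hA : Planar A) {D : FoldFrame} (hD : D.η = rel A.incl) (h0 : 0 ∈ D.W) :
    A.incl ∈ D.dom := by
  refine ⟨fun k => ?_, ?_⟩
  · rw [hD, hA.rel_mul_conj]
    simp
  · rw [mem_preimage, hD, tanOf_self]
    exact h0

theorem Planar.coord_incl (hA : Planar A) {D : FoldFrame} (hD : D.η = rel A.incl) :
    D.coord A.incl = 0 := by
  apply splitC.injective
  rw [D.splitC_coord, hD, tanOf_self, hA.hvec_incl, map_zero]
  simp only [inner_zero_right]
  rfl

/-- To first order the tangent of a relative angle is the angle itself, and its speed is the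
difference of the two angular speeds. -/
theorem Planar.hasDerivAt_tanOf (hA : Planar A) {δ : Amb} {a : Fin 6 → ℝ}
    (ha : ∀ k, xi (δ k) = I * a k * xi (A.incl k)) (k : Fin 4) :
    HasDerivAt (fun s : ℝ => tanOf (rel A.incl) (rel (A.incl + s • δ)) k)
      (a (ix k) - a (ixs k)) 0 := by
  have h1 : HasDerivAt (fun s : ℝ => rel (A.incl + s • δ) k * conj (rel A.incl k))
      (I * (a (ix k) - a (ixs k) : ℝ)) 0 := by
    have h2 := ((hasDerivAt_comp_xi A.incl δ (ix k)).fun_mul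
      (HasDerivAt.linear_comp (conjCLE : ℂ →L[ℝ] ℂ)
        (hasDerivAt_comp_xi A.incl δ (ixs k)))).mul_const (conj (rel A.incl k))
    refine HasDerivAt.congr_deriv h2 ?_
    have h3 := hA.rel_mul_conj k
    simp only [rel, map_mul, conj_conj] at h3
    simp only [ha, zero_smul, add_zero, rel, ContinuousLinearEquiv.coe_coe, conjCLE_apply, map_mul,
      conj_I, conj_ofReal, conj_conj, ofReal_sub]
    linear_combination (I * (a (ix k) - a (ixs k))) * h3
  have h4 := (HasDerivAt.linear_comp imCLM h1).fun_div (HasDerivAt.linear_comp reCLM h1) (by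
    simp only [zero_smul, add_zero, hA.rel_mul_conj]
    simp)
  refine HasDerivAt.congr_deriv h4 ?_
  simp only [zero_smul, add_zero, hA.rel_mul_conj]
  simp

/-- A vector tangent to the spheres consists of angular speeds `a` and `i`-components `h`. The
`w`-coordinates make the first five speeds equal, the gauge sets `a 0 = 0`, and the product equation
gives `a 5 = 0`. The product equation and the gauge `mixed` put `h` into the kernel of `constraint`,
while the `z`-coordinates make it orthogonal to a frame of that kernel. -/
theorem Planar.injective_aux (hA : Planar A) {D : FoldFrame} (hD : D.η = rel A.incl)
    (h0 : 0 ∈ D.W) {δ : Amb} (h1 : fderiv ℝ D.coord A.incl δ = 0)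
    (h2 : fderiv ℝ (gauge (xi (A.incl 0))) A.incl δ = 0) (h3 : fderiv ℝ con A.incl δ = 0) :
    δ = 0 := by
  have hdom := hA.mem_dom hD h0
  rw [fderiv_con] at h3
  have d1 : ∀ k, (δ k).re = 0 := fun k => congrFun (Prod.ext_iff.mp h3).1 k
  have d2 : ∀ k, qdot (A.incl k) (δ k) = 0 := fun k => by
    have := congrFun (Prod.ext_iff.mp (Prod.ext_iff.mp h3).2).1 k
    simpa using this
  have d3 : imVec (dprod A.incl δ) = 0 := (Prod.ext_iff.mp (Prod.ext_iff.mp h3).2).2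
  obtain ⟨a, ha⟩ := hA.eq_cj_of_tangent d1 d2
  have hxi : ∀ k, xi (δ k) = I * a k * xi (A.incl k) := fun k => by
    conv_lhs => rw [congrFun ha k]
    rfl
  have d4 : imVec (dprod (fun k => cj 0 (xi (A.incl k))) fun k => cj (I * ((hi (δ k) : ℝ) : ℂ))
      (I * (a k : ℂ) * xi (A.incl k))) = 0 := by
    rw [← d3, hA.incl_eq]
    conv_rhs => rw [ha]
    rfl
  rw [dprod_planar, imVec_cj, hA.prod] at d4
  have d5 := congrFun d4 0
  have d6 := congrFun d4 1
  have d7 := congrFun d4 2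
  simp only [Matrix.cons_val] at d5 d6 d7
  have d8 : ∑ k, (hi (δ k) : ℂ) * tw (fun k => xi (A.incl k)) k = 0 :=
    (mul_eq_zero.mp (Complex.ext d6 d7 : I * _ = 0)).resolve_left I_ne_zero
  rw [neg_neg, one_mul] at d5
  have d9 : a 0 - a 1 + a 2 - a 3 + a 4 - a 5 = 0 := by simpa using d5
  -- the gauge
  rw [hA.fderiv_gauge] at h2
  have g0 := congrFun h2 0
  have g1 := congrFun h2 1
  have g2 := congrFun h2 2
  simp only [Matrix.cons_val] at g0 g1 g2
  have g3 : ∑ k, (hi (δ k) : ℂ) * xi (A.incl k) = 0 := Complex.ext g1 g2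
  have g4 : a 0 = 0 := by
    rw [hxi, mul_assoc, hA.mul_conj] at g0
    simpa using g0
  -- the coordinates
  have c1 : HasDerivAt (fun s : ℝ => D.coord (A.incl + s • δ)) 0 0 := by
    have e1 : HasDerivAt (fun s : ℝ => A.incl + s • δ) δ 0 := by
      simpa using ((hasDerivAt_id (0 : ℝ)).smul_const δ).const_add A.incl
    have e2 : HasFDerivAt D.coord (fderiv ℝ D.coord A.incl) (A.incl + (0 : ℝ) • δ) := by
      rw [zero_smul, add_zero]
      exact ((D.contDiffOn_coord.contDiffAt (D.isOpen_dom.mem_nhds hdom)).differentiableAt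
        (by simp)).hasFDerivAt
    rw [← h1]
    exact HasFDerivAt.comp_hasDerivAt (0 : ℝ) e2 e1
  have c2 := HasDerivAt.linear_comp (splitC : E6 →L[ℝ] (Fin 4 → ℝ) × ℂ) c1
  simp only [ContinuousLinearEquiv.coe_coe, D.splitC_coord, map_zero, hD] at c2
  have c3 : ∀ k : Fin 4, a (ix k) - a (ixs k) = 0 := by
    intro k
    have e1 := HasDerivAt.linear_comp (ContinuousLinearMap.fst ℝ (Fin 4 → ℝ) ℂ) c2
    have e2 := (hasDerivAt_pi.mp e1) k
    exact (hA.hasDerivAt_tanOf hxi k).unique e2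
  have c4 : HasDerivAt (fun s : ℝ => tanOf (rel A.incl) (rel (A.incl + s • δ))) 0 0 := by
    have e1 := HasDerivAt.linear_comp (ContinuousLinearMap.fst ℝ (Fin 4 → ℝ) ℂ) c2
    exact e1
  have c5 : ∀ i, inner ℝ (D.n i 0) (hvec δ) = 0 := by
    intro i
    have e0 : HasDerivAt (fun s : ℝ => inner ℝ (D.n i (tanOf (rel A.incl) (rel (A.incl + s • δ))))
        (hvec (A.incl + s • δ))) 0 0 := by
      fin_cases i
      · exact HasDerivAt.linear_comp (reCLM.comp (ContinuousLinearMap.snd ℝ (Fin 4 → ℝ) ℂ)) c2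
      · exact HasDerivAt.linear_comp (imCLM.comp (ContinuousLinearMap.snd ℝ (Fin 4 → ℝ) ℂ)) c2
    have e1 : HasFDerivAt (D.n i) (fderiv ℝ (D.n i) 0)
        (tanOf (rel A.incl) (rel (A.incl + (0 : ℝ) • δ))) := by
      rw [zero_smul, add_zero, tanOf_self]
      exact (((D.smooth i).contDiffAt (D.isOpen.mem_nhds h0)).differentiableAt
        (by simp)).hasFDerivAt
    have e2 := HasFDerivAt.comp_hasDerivAt (0 : ℝ) e1 c4
    have e3 : HasDerivAt (fun s : ℝ => hvec (A.incl + s • δ)) (hvec δ) 0 := by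
      have : (fun s : ℝ => hvec (A.incl + s • δ)) = fun s => s • hvec δ := by
        funext s
        rw [map_add, hA.hvec_incl, map_smul, zero_add]
      rw [this]
      simpa using (hasDerivAt_id (0 : ℝ)).smul_const (hvec δ)
    -- The derivative of the frame does not contribute because `hvec` vanishes at a planar tuple.
    have e4 := (e2.inner ℝ e3).unique e0
    simpa [tanOf_self, hA.hvec_incl] using e4
  have hcon : constraint (fun k => xi (A.incl k)) (hvec δ) = 0 := by
    rw [constraint_apply]
    exact Prod.ext g3 d8
  have hh : hvec δ = 0 := by
    have e1 := (D.frame 0 h0).2.2.2.2.2 (hvec δ) (by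
      rw [etaOf_zero, hD, hA.constraint_uOf_rel, hcon]
      simp)
    rw [e1, c5, c5]
    simp
  have ha0 : ∀ k, a k = 0 := by
    have k0 := c3 0
    have k1 := c3 1
    have k2 := c3 2
    have k3 := c3 3
    change a 0 - a 1 = 0 at k0
    change a 1 - a 2 = 0 at k1
    change a 2 - a 3 = 0 at k2
    change a 3 - a 4 = 0 at k3
    intro k
    fin_cases k <;> simp only [Fin.zero_eta, Fin.mk_one, Fin.reduceFinMk] <;> linarith
  rw [ha]
  funext k
  have hk : hi (δ k) = 0 := congrFun (congrArg WithLp.ofLp hh) k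
  rw [hk, ha0]
  ext <;> simp [cj]

/-- The first gauge component detects rotation about `i`; the other two detect tilting, by the
positivity in `Planar.orb_eq_zero`. -/
theorem Planar.orb_aux (hA : Planar A) {t : Fin 3 → ℝ}
    (h : fderiv ℝ (gauge (xi (A.incl 0))) A.incl (orb A.incl t) = 0) : t = 0 := by
  rw [hA.fderiv_gauge, hA.orb_eq] at h
  have g0 := congrFun h 0
  have g1 := congrFun h 1
  have g2 := congrFun h 2
  simp only [Matrix.cons_val, xi_cj, hi_cj] at g0 g1 g2
  rw [mul_assoc, hA.mul_conj, mul_one] at g0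
  refine hA.orb_eq_zero (by simpa using g0) ?_
  have g3 := Complex.ext (w := 0) g1 g2
  rw [← g3]
  refine Finset.sum_congr rfl fun k _ => ?_
  congr 2
  simp

end SU2Char

namespace SU2Char

open SliceManifold Complex ComplexConjugate

/-! ### Lifts of the involution -/

/-- Reflection in the plane orthogonal to `i`. -/
def flip : Amb →ₗ[ℝ] Amb where
  toFun x k := qmk (x k).re (-(x k).imI) (x k).imJ (x k).imK
  map_add' x y := by funext k; ext <;> simp <;> ring
  map_smul' c x := by funext k; ext <;> simp

@[simp] theorem xi_flip (x : Amb) (k : Fin 6) : xi (flip x k) = xi (x k) := rfl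

@[simp] theorem hi_flip (x : Amb) (k : Fin 6) : hi (flip x k) = -hi (x k) := rfl

theorem rel_flip (x : Amb) : rel (flip x) = rel x := rfl

theorem mixed_flip (x : Amb) : mixed (flip x) = -mixed x := by
  simp [mixed]

theorem hvec_flip (x : Amb) : hvec (flip x) = -hvec x := by
  ext k
  rfl

/-- The relative positions do not see the reflection and `hvec` changes sign. The involution is
therefore linear in these coordinates by construction, at all points and not only to first order. -/
theorem FoldFrame.coord_flip (D : FoldFrame) (x : Amb) :
    D.coord (flip x) = reflectC (D.coord x) := by
  apply splitC.injective
  rw [splitC_reflectC, D.splitC_coord, D.splitC_coord, rel_flip, hvec_flip]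
  refine Prod.ext rfl (Complex.ext ?_ ?_) <;> simp

/-- The representation with all signs changed. -/
def negRep (a : RepS6Star) : RepS6Star := ⟨nuRep a.1, by
  have h := a.2
  rw [Rep.isNonabelian_iff] at h ⊢
  obtain ⟨i, j, hij⟩ := h
  refine ⟨i, j, fun hc => hij ?_⟩
  simpa [nuRep, Commute, SemiconjBy] using hc⟩

theorem incl_negRep (a : RepS6Star) : (negRep a).incl = -a.incl := rfl

theorem cls_negRep (a : RepS6Star) : (negRep a).cls = nuStar a.cls := rfl

/-- Conjugation by `i` fixes `i` and negates `j` and `k`; after changing all signs, only the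
`i`-coordinate is reversed. -/
theorem exists_flip (a : RepS6Star) : ∃ b : RepS6Star, b.incl = flip a.incl ∧
    b.cls = nuStar a.cls := by
  let g : SU2 := SU2.mk (cj I 0) (by simp [normSq_cj])
  obtain ⟨b, hb, hbc⟩ := exists_conj g (negRep a)
  refine ⟨b, ?_, hbc⟩
  rw [hb, incl_negRep]
  funext k
  have h0 := re_incl a k
  change cj I 0 * -(a.incl k) * star (cj I 0) = _
  ext <;> simp [cj, flip, h0]

/-- The `i`-direction is the unique direction in which the configuration is smallest. -/
def Gap (x : Amb) : Prop :=
  ∀ s : ℂ, s ≠ 0 → normSq s * ∑ k, hi (x k) ^ 2 < ∑ k, (conj s * xi (x k)).re ^ 2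

/-- For a planar tuple the left side is zero, and a zero right side would put all values on one
line, making them commute. By homogeneity in `s` it suffices to treat the compact unit circle, which
makes the condition open. -/
theorem Planar.eventually_gap {A : RepS6Star} (hA : Planar A) : ∀ᶠ x in 𝓝 A.incl, Gap x := by
  have h1 : ∀ s : ℂ, s ≠ 0 → ∑ k, hi (A.incl k) ^ 2 < ∑ k, (conj s * xi (A.incl k)).re ^ 2 := by
    intro s hs
    have h0 : ∑ k, hi (A.incl k) ^ 2 = 0 := Finset.sum_eq_zero fun k _ => by simp [hA k]
    rw [h0]
    refine lt_of_le_of_ne (Finset.sum_nonneg fun k _ => sq_nonneg _) fun hz => ?_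
    have h2 : ∀ k, (conj s * xi (A.incl k)).re = 0 := by
      intro k
      have := (Finset.sum_eq_zero_iff_of_nonneg fun k _ => sq_nonneg _).mp hz.symm k
        (Finset.mem_univ k)
      exact pow_eq_zero_iff two_ne_zero |>.mp this
    have h3 : imVec (cj 0 (I * s)) = 0 := by
      refine eq_zero_of_commute A fun k => ?_
      have h4 := h2 k
      rw [congrFun hA.incl_eq k, Commute, SemiconjBy, cj_mul, cj_mul, cj_inj]
      constructor
      · apply Complex.ext <;> simp at h4 ⊢ <;> linarith
      · simp
    have h5 : I * s = 0 := Complex.ext (congrFun h3 1) (congrFun h3 2)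
    exact hs ((mul_eq_zero.mp h5).resolve_left I_ne_zero)
  have h2 : ∀ᶠ x in 𝓝 A.incl, ∀ s ∈ Metric.sphere (0 : ℂ) 1,
      ∑ k, hi (x k) ^ 2 < ∑ k, (conj s * xi (x k)).re ^ 2 := by
    refine (isCompact_sphere (0 : ℂ) 1).eventually_forall_of_forall_eventually fun s hs => ?_
    have c1 : Continuous fun p : Amb × ℂ => ∑ k, hi (p.1 k) ^ 2 :=
      continuous_finsetSum _ fun k _ => ((contDiff_hi k).continuous.comp continuous_fst).pow 2
    have c2 : Continuous fun p : Amb × ℂ => ∑ k, (conj p.2 * xi (p.1 k)).re ^ 2 :=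
      continuous_finsetSum _ fun k _ => (continuous_re.comp
        ((continuous_conj.comp continuous_snd).mul
          ((contDiff_xi k).continuous.comp continuous_fst))).pow 2
    refine c1.continuousAt.eventually_lt c2.continuousAt (h1 s ?_)
    rintro rfl
    simp at hs
  filter_upwards [h2] with x hx s hs
  have hn : ‖s‖ ≠ 0 := norm_ne_zero_iff.mpr hs
  have h3 := hx ((‖s‖⁻¹ : ℝ) * s) (by
    rw [mem_sphere_zero_iff_norm, norm_mul, norm_real, norm_inv, norm_norm, inv_mul_cancel₀ hn])
  have h4 : ∀ k, (conj (((‖s‖⁻¹ : ℝ) : ℂ) * s) * xi (x k)).re =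
      ‖s‖⁻¹ * (conj s * xi (x k)).re := fun k => by
    rw [map_mul, conj_ofReal, mul_assoc, re_ofReal_mul]
  simp only [h4, mul_pow, ← Finset.mul_sum] at h3
  rw [normSq_eq_norm_sq]
  have hpos : 0 < ‖s‖ ^ 2 := by positivity
  calc ‖s‖ ^ 2 * ∑ k, hi (x k) ^ 2 < ‖s‖ ^ 2 * (‖s‖⁻¹ ^ 2 * ∑ k, (conj s * xi (x k)).re ^ 2) :=
        mul_lt_mul_of_pos_left h3 hpos
    _ = _ := by field_simp

/-! ### Charts around the fixed points -/

/-- A chart of the orbit space given by the coordinates of a frame. -/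
structure IsFold (κ : OpenPartialHomeomorph ChiS6Star E6) (D : FoldFrame) : Prop where
  lift : ∀ x ∈ κ.source, ∃ a : RepS6Star, a.cls = x ∧ a.incl ∈ D.dom ∧ mixed a.incl = 0 ∧
    Gap a.incl ∧ κ x = D.coord a.incl
  nu : ∀ x ∈ κ.source, nuStar x ∈ κ.source ∧ κ (nuStar x) = reflectC (κ x)

theorem norm_reflectC (y : E6) : ‖reflectC y‖ = ‖y‖ := by
  rw [EuclideanSpace.norm_eq, EuclideanSpace.norm_eq, Fin.sum_univ_six, Fin.sum_univ_six]
  simp [reflectC, splitC]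

/-- The slice theorem applied to `coord` and `gauge`. The involution preserves the resulting chart
because `flip` preserves the gauge condition and `reflectC` preserves balls around the origin. -/
theorem Planar.exists_fold {A : RepS6Star} (hA : Planar A) [Nonempty RepS6Star]
    (hι : IsEmbedding RepS6Star.incl) (hq : IsOpenQuotientMap RepS6Star.cls) :
    ∃ (S : SliceChart E6 (Fin 3 → ℝ) ConSpace RepS6Star.incl RepS6Star.cls) (D : FoldFrame),
      A.cls ∈ (S.quotChart hι hq).source ∧ IsFold (S.quotChart hι hq) D := by
  obtain ⟨D, hD, h0⟩ := hA.exists_foldFrame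
  have hdom := hA.mem_dom hD h0
  obtain ⟨O', hO', hO⟩ := exists_sliceChart A D.isOpen_dom hdom D.contDiffOn_coord
    (contDiff_gauge (xi (A.incl 0))).contDiffOn hA.gauge_incl
    (fun δ h1 h2 h3 => hA.injective_aux hD h0 h1 h2 h3) (fun t h => hA.orb_aux h)
  have hfc : Continuous flip := (contDiff_linear flip).continuous
  have hfA : flip A.incl = A.incl := by
    rw [hA.incl_eq]
    funext k
    ext <;> simp [flip, cj]
  have hflip : flip ⁻¹' O' ∈ 𝓝 A.incl := by
    refine hfc.continuousAt.preimage_mem_nhds ?_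
    rw [hfA]
    exact hO'
  -- Shrinking into `flip ⁻¹' O'` keeps the reflected slice points in the region where a slice point
  -- is recovered from its coordinates.
  obtain ⟨S, ε, -, hAS, htar, hsec, huniq⟩ := hO (flip ⁻¹' O' ∩ {x | Gap x} ∩ D.dom)
    (inter_mem (inter_mem hflip hA.eventually_gap) (D.isOpen_dom.mem_nhds hdom))
  rw [hA.coord_incl hD] at htar hsec huniq
  refine ⟨S, D, ⟨A, hAS, rfl⟩, ?_⟩
  -- lifts
  have key : ∀ x ∈ (S.quotChart hι hq).source, ∃ a : RepS6Star, a.cls = x ∧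
      a.incl = S.Θ.symm ((S.quotChart hι hq x, 0), 0) ∧
      S.quotChart hι hq x ∈ Metric.ball (0 : E6) ε := by
    intro x hx
    have hv : ((S.quotChart hι hq x, 0), 0) ∈ S.Θ.target := (S.quotChart hι hq).map_source hx
    exact ⟨_, (S.quotChart hι hq).left_inv hx, S.invFun_lift hv, (htar _).mp hv⟩
  constructor
  · intro x hx
    obtain ⟨a, hax, ha, hv⟩ := key x hx
    obtain ⟨h1, h2, h3⟩ := hsec _ hv
    rw [← ha] at h1 h2 h3
    exact ⟨a, hax, h1.2, (gauge_eq_zero.mp h3).2, h1.1.2, h2.symm⟩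
  · intro x hx
    obtain ⟨a, hax, ha, hv⟩ := key x hx
    obtain ⟨h1, h2, h3⟩ := hsec _ hv
    rw [← ha] at h1 h2 h3
    obtain ⟨b, hb, hbc⟩ := exists_flip a
    have hcb : D.coord b.incl = reflectC (S.quotChart hι hq x) := by
      rw [hb, D.coord_flip, h2]
    have hball : D.coord b.incl ∈ Metric.ball (0 : E6) ε := by
      rw [hcb, mem_ball_zero_iff, norm_reflectC, ← mem_ball_zero_iff]
      exact hv
    have h4 := huniq b (by rw [hb]; exact h1.1.1) (by
      rw [gauge_eq_zero] at h3 ⊢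
      rw [hb, mixed_flip, h3.2, neg_zero]
      exact ⟨h3.1, rfl⟩) hball
    have htb := (htar _).mpr hball
    have hbS : b.incl ∈ S.Θ.source := by
      rw [← h4]
      exact S.Θ.map_target htb
    have hnx : nuStar x = b.cls := by rw [hbc, hax]
    rw [hnx]
    refine ⟨⟨b, hbS, rfl⟩, ?_⟩
    rw [S.quotChart_apply hι hq hbS, ← h4, S.Θ.right_inv htb]
    exact hcb

end SU2Char

namespace SU2Char

open SliceManifold Complex ComplexConjugate

/-! ### Changes of coordinates around the fixed points -/

theorem hi_conj_cj (a b ξ : ℂ) (h : ℝ) : hi (cj a b * cj (I * h) ξ * star (cj a b)) =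
    (normSq a - normSq b) * h + (conj (2 * I * conj a * b) * ξ).re := by
  rw [star_cj, cj_mul, cj_mul, hi_cj, normSq_apply, normSq_apply]
  simp
  ring

/-- The sum is the quadratic form `∑ ⟨xₖ, ·⟩²` evaluated at `i` and, on the right, at the direction
that conjugation moves to `i`. With `mixed = 0` there are no cross terms, and with `Gap` every
direction other than `±i` gives a strictly larger value; `a, b ≠ 0` says that the direction is not
`±i`. -/
theorem sum_hi_le {x : Amb} (hx : ∀ k, (x k).re = 0) (h0 : mixed x = 0) (hg : Gap x) {a b : ℂ}
    (hab : normSq a + normSq b = 1) (hne : a ≠ 0 ∧ b ≠ 0) :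
    ∑ k, hi (x k) ^ 2 < ∑ k, hi (conjAmb (cj a b) x k) ^ 2 := by
  set s := 2 * I * conj a * b with hs
  have hs0 : s ≠ 0 := by simp [hs, hne.1, hne.2]
  have e : ∀ k, hi (conjAmb (cj a b) x k) =
      (normSq a - normSq b) * hi (x k) + (conj s * xi (x k)).re := by
    intro k
    rw [conjAmb]
    conv_lhs => rw [eq_cj_of_re_eq_zero (hx k)]
    exact hi_conj_cj a b _ _
  have hcross : ∑ k, hi (x k) * (conj s * xi (x k)).re = 0 := by
    have h1 : (conj s * mixed x).re = 0 := by rw [h0]; simp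
    rw [mixed, Finset.mul_sum, re_sum] at h1
    rw [← h1]
    refine Finset.sum_congr rfl fun k _ => ?_
    rw [mul_left_comm, re_ofReal_mul]
  have hns : normSq s = 4 * normSq a * normSq b := by
    rw [hs]
    simp only [map_mul, normSq_conj, normSq_I]
    rw [show normSq 2 = 4 by rw [normSq_apply]; norm_num]
    ring
  have hsum : ∑ k, hi (conjAmb (cj a b) x k) ^ 2 =
      (normSq a - normSq b) ^ 2 * ∑ k, hi (x k) ^ 2 + ∑ k, (conj s * xi (x k)).re ^ 2 := by
    have h2 : ∀ k, hi (conjAmb (cj a b) x k) ^ 2 = (normSq a - normSq b) ^ 2 * hi (x k) ^ 2 +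
        2 * (normSq a - normSq b) * (hi (x k) * (conj s * xi (x k)).re) +
        (conj s * xi (x k)).re ^ 2 := fun k => by rw [e]; ring
    simp only [h2, Finset.sum_add_distrib, ← Finset.mul_sum, hcross]
    ring
  have h3 := hg s hs0
  rw [hsum]
  have h4 : (normSq a - normSq b) ^ 2 + normSq s = 1 := by
    rw [hns]
    linear_combination (normSq a + normSq b + 1) * hab
  calc ∑ k, hi (x k) ^ 2 = ((normSq a - normSq b) ^ 2 + normSq s) * ∑ k, hi (x k) ^ 2 := by
        rw [h4, one_mul]
    _ < _ := by rw [add_mul]; linarith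

/-- Conjugate configurations in normal position differ by a rotation around `i`, and perhaps a
reflection. -/
theorem normal_position_unique {a a' : RepS6Star} (h : a.cls = a'.cls) (h0 : mixed a.incl = 0)
    (hg : Gap a.incl) (h0' : mixed a'.incl = 0) (hg' : Gap a'.incl) :
    (∃ c : ℂ, c * conj c = 1 ∧ ∀ k, hi (a'.incl k) = hi (a.incl k) ∧
      xi (a'.incl k) = c * xi (a.incl k)) ∨
    (∃ c : ℂ, c * conj c = 1 ∧ ∀ k, hi (a'.incl k) = -hi (a.incl k) ∧
      xi (a'.incl k) = c * conj (xi (a.incl k))) := by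
  obtain ⟨g, hg1⟩ := cls_eq_iff.mp h
  set p : ℂ := ⟨(g : ℍ[ℝ]).re, (g : ℍ[ℝ]).imI⟩
  set q : ℂ := ⟨(g : ℍ[ℝ]).imJ, (g : ℍ[ℝ]).imK⟩
  have hgc : (g : ℍ[ℝ]) = cj p q := rfl
  have hpq : normSq p + normSq q = 1 := by
    rw [← normSq_cj, ← hgc, SU2.normSq]
  have hg2 : a.incl = conjAmb (cj (conj p) (-q)) a'.incl := by
    have hs : star (g : ℍ[ℝ]) * g = 1 := by
      rw [← SU2.coe_inv]
      exact congrArg Subtype.val (inv_mul_cancel g)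
    rw [← star_cj, ← hgc, hg1]
    funext k
    simp only [conjAmb, star_star]
    calc a.incl k = (star (g : ℍ[ℝ]) * g) * a.incl k * (star (g : ℍ[ℝ]) * g) := by rw [hs]; simp
      _ = _ := by simp only [mul_assoc]
  -- Otherwise strict minimality of `i` for each of the two configurations gives contradictory
  -- inequalities.
  have hz : p = 0 ∨ q = 0 := by
    by_contra hne
    rw [not_or] at hne
    have h1 := sum_hi_le (re_incl a) h0 hg hpq hne
    have h2 := sum_hi_le (re_incl a') h0' hg' (a := conj p) (b := -q) (by
      rwa [normSq_conj, normSq_neg]) ⟨by simpa using hne.1, by simpa using hne.2⟩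
    rw [← hg2] at h2
    rw [← hgc, ← hg1] at h1
    exact lt_asymm h1 h2
  have e : ∀ k, a'.incl k = cj p q * cj (I * hi (a.incl k)) (xi (a.incl k)) * star (cj p q) := by
    intro k
    rw [congrFun hg1 k, conjAmb, hgc]
    conv_lhs => rw [incl_eq_cj a k]
  rcases hz with hz | hz
  · right
    have hq : q * conj q = 1 := by
      rw [mul_conj]
      rw [hz, map_zero, zero_add] at hpq
      rw [hpq, ofReal_one]
    refine ⟨q ^ 2, ?_, fun k => ⟨?_, ?_⟩⟩
    · rw [map_pow, ← mul_pow, hq, one_pow]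
    · rw [e k, hi_conj_cj, hz]
      rw [hz, map_zero, zero_add] at hpq
      rw [hpq]
      simp
    · rw [e k, star_cj, cj_mul, cj_mul, xi_cj, hz]
      simp
      ring
  · left
    have hp : p * conj p = 1 := by
      rw [mul_conj]
      rw [hz, map_zero, add_zero] at hpq
      rw [hpq, ofReal_one]
    refine ⟨p ^ 2, ?_, fun k => ⟨?_, ?_⟩⟩
    · rw [map_pow, ← mul_pow, hp, one_pow]
    · rw [e k, hi_conj_cj, hz]
      rw [hz, map_zero, add_zero] at hpq
      rw [hpq]
      simp
    · rw [e k, star_cj, cj_mul, cj_mul, xi_cj, hz]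
      simp
      ring

/-- If the planar parts all lie on one real line, the direction perpendicular to that line makes the
right side of `Gap` vanish. -/
theorem Gap.not_real {x : Amb} (hg : Gap x) {k₀ : Fin 6} (h0 : xi (x k₀) ≠ 0) :
    ¬ ∀ k, (conj (xi (x k₀)) * xi (x k)).im = 0 := by
  intro h
  have h1 := hg (I * xi (x k₀)) (mul_ne_zero I_ne_zero h0)
  have h2 : ∑ k, (conj (I * xi (x k₀)) * xi (x k)).re ^ 2 = 0 := by
    refine Finset.sum_eq_zero fun k _ => ?_
    have : (conj (I * xi (x k₀)) * xi (x k)).re = (conj (xi (x k₀)) * xi (x k)).im := by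
      simp
      ring
    rw [this, h k]
    ring
  rw [h2] at h1
  exact absurd h1 (not_lt.mpr (mul_nonneg (normSq_nonneg _)
    (Finset.sum_nonneg fun k _ => sq_nonneg _)))

theorem FoldFrame.rel_ne_zero {D : FoldFrame} {x : Amb} (hx : x ∈ D.dom) (k : Fin 4) :
    rel x k ≠ 0 := by
  intro h
  have := hx.1 k
  rw [h, zero_mul, zero_re] at this
  exact lt_irrefl _ this

theorem FoldFrame.xi_ne_zero {D : FoldFrame} {x : Amb} (hx : x ∈ D.dom) : xi (x 0) ≠ 0 := by
  intro h
  refine FoldFrame.rel_ne_zero hx 0 ?_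
  change xi (x 0) * _ = 0
  rw [h, zero_mul]

/-- Lifts of fixed points in normal position are planar. -/
theorem planar_of_fixed {D : FoldFrame} {a : RepS6Star} (ha : a.incl ∈ D.dom)
    (h0 : mixed a.incl = 0) (hg : Gap a.incl) (hfix : nuStar a.cls = a.cls) : Planar a := by
  obtain ⟨b, hb, hbc⟩ := exists_flip a
  have hgb : Gap b.incl := by
    rw [hb]
    intro s hs
    simpa using hg s hs
  rcases normal_position_unique (hfix.symm.trans hbc.symm) h0 hg
    (by rw [hb, mixed_flip, h0, neg_zero]) hgb with ⟨c, -, hc⟩ | ⟨c, hcc, hc⟩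
  · intro k
    have := (hc k).1
    rw [hb, hi_flip] at this
    linarith
  -- In the second alternative each planar part satisfies `ξ = c * conj ξ` with the same `c`, so all
  -- lie on one real line.
  · exfalso
    refine hg.not_real (FoldFrame.xi_ne_zero ha) fun k => ?_
    have e : ∀ l, xi (a.incl l) = c * conj (xi (a.incl l)) := fun l => by
      have := (hc l).2
      rwa [hb, xi_flip] at this
    have e1 : conj (conj (xi (a.incl 0)) * xi (a.incl k)) = conj (xi (a.incl 0)) * xi (a.incl k) := by
      conv_rhs => rw [e 0, e k]
      rw [map_mul, map_mul, conj_conj]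
      linear_combination (-(xi (a.incl 0)) * conj (xi (a.incl k))) * hcc
    exact conj_eq_iff_im.mp e1

/-- Some relative position of a planar representation is not real. -/
theorem Planar.exists_rel_im_ne_zero {a : RepS6Star} (hA : Planar a) (hg : Gap a.incl) :
    ∃ k, (rel a.incl k).im ≠ 0 := by
  by_contra! h
  refine hg.not_real (k₀ := 0) (fun h0 => ?_) fun k => ?_
  · have := hA.mul_conj 0
    rw [h0, zero_mul] at this
    exact zero_ne_one this
  · rw [← hA.uOf_rel, ← conj_eq_iff_im, ← uOf_conj]
    congr 1
    funext l
    exact conj_eq_iff_im.mpr (h l)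

/-- The identity or complex conjugation. -/
def conjIf (σ : Bool) : ℂ ≃L[ℝ] ℂ := if σ then conjCLE else ContinuousLinearEquiv.refl ℝ ℂ

/-- The sign. -/
def signIf (σ : Bool) : ℝ := if σ then -1 else 1

theorem conjIf_mul (σ : Bool) (a b : ℂ) : conjIf σ (a * b) = conjIf σ a * conjIf σ b := by
  cases σ <;> simp [conjIf]

theorem conjIf_conj (σ : Bool) (a : ℂ) : conjIf σ (conj a) = conj (conjIf σ a) := by
  cases σ <;> simp [conjIf]

theorem conjIf_ofReal (σ : Bool) (a : ℝ) : conjIf σ a = a := by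
  cases σ <;> simp [conjIf]

theorem conjIf_one (σ : Bool) : conjIf σ 1 = 1 := by
  cases σ <;> simp [conjIf]

theorem constraint_conjIf (σ : Bool) (η : Fin 4 → ℂ) (h : E6) :
    constraint (uOf fun k => conjIf σ (η k)) h = 0 ↔ constraint (uOf η) h = 0 := by
  cases σ
  · rfl
  · rw [← constraint_conj_eq_zero (u := uOf η)]
    have : uOf (fun k => conjIf true (η k)) = fun k => conj (uOf η k) := by
      funext k
      exact uOf_conj η k
    rw [this]

theorem signIf_mul_self (σ : Bool) : signIf σ * signIf σ = 1 := by
  cases σ <;> simp [signIf]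

/-- Passing to relative positions removes the rotation `c`; only the binary choice remains, acting
by conjugation on `rel` and by a sign on `hvec`. -/
theorem normal_position_rel {a a' : RepS6Star} (h : a.cls = a'.cls) (h0 : mixed a.incl = 0)
    (hg : Gap a.incl) (h0' : mixed a'.incl = 0) (hg' : Gap a'.incl) :
    ∃ σ : Bool, (∀ k, rel a'.incl k = conjIf σ (rel a.incl k)) ∧
      hvec a'.incl = signIf σ • hvec a.incl := by
  rcases normal_position_unique h h0 hg h0' hg' with ⟨c, hcc, hc⟩ | ⟨c, hcc, hc⟩
  · refine ⟨false, fun k => ?_, ?_⟩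
    · simp only [rel, (hc _).2, map_mul, conjIf]
      simp only [Bool.false_eq_true, if_false, ContinuousLinearEquiv.refl_apply]
      linear_combination (xi (a.incl (ix k)) * conj (xi (a.incl (ixs k)))) * hcc
    · ext k
      simp [signIf, hvec_apply, (hc k).1]
  · refine ⟨true, fun k => ?_, ?_⟩
    · simp only [rel, (hc _).2, map_mul, conjIf, if_true, conjCLE_apply, conj_conj]
      linear_combination (conj (xi (a.incl (ix k))) * xi (a.incl (ixs k))) * hcc
    · ext k
      simp [signIf, hvec_apply, (hc k).1]

end SU2Char

/-! ### Transitions between fold charts -/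

namespace SU2Char

open SliceManifold Complex ComplexConjugate

namespace FoldFrame

variable (D D' : FoldFrame) (σ : Bool)

/-- The change of the tangential coordinates. -/
def trans (w : Fin 4 → ℝ) : Fin 4 → ℝ := tanOf D'.η fun k => conjIf σ (etaOf D.η w k)

/-- The matrix of the change of the normal coordinates. -/
def rot (i j : Fin 2) (w : Fin 4 → ℝ) : ℝ :=
  signIf σ * inner ℝ (D'.n i (D.trans D' σ w)) (D.n j w)

/-- The frames are compatible at the point with tangential coordinates `w`. -/
def Compat (w : Fin 4 → ℝ) : Prop :=
  w ∈ D.W ∧ D.trans D' σ w ∈ D'.W ∧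
    (∀ k, etaOf D'.η (D.trans D' σ w) k = conjIf σ (etaOf D.η w k)) ∧
    ∀ k, 0 < (conjIf σ (etaOf D.η w k) * conj (D'.η k)).re

variable {D D' σ} {w : Fin 4 → ℝ}

theorem Compat.contDiffAt_trans (h : D.Compat D' σ w) : ContDiffAt ℝ ∞ (D.trans D' σ) w := by
  have h1 : ∀ k, ContDiff ℝ ∞ fun w => conjIf σ (etaOf D.η w k) * conj (D'.η k) := fun k =>
    ((conjIf σ).contDiff.comp (contDiff_etaOf D.η k)).mul contDiff_const
  refine contDiffAt_pi.mpr fun k => ContDiffAt.div ?_ ?_ (h.2.2.2 k).ne'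
  · exact (imCLM.contDiff.comp (h1 k)).contDiffAt
  · exact (reCLM.contDiff.comp (h1 k)).contDiffAt

theorem Compat.contDiffAt_rot (h : D.Compat D' σ w) (i j : Fin 2) :
    ContDiffAt ℝ ∞ (D.rot D' σ i j) w := by
  refine contDiffAt_const.mul (ContDiffAt.inner ℝ ?_ ?_)
  · exact ((D'.smooth i).contDiffAt (D'.isOpen.mem_nhds h.2.1)).comp w h.contDiffAt_trans
  · exact (D.smooth j).contDiffAt (D.isOpen.mem_nhds h.1)

/-- Conjugating the relative positions does not change the kernel of the constraint, so both frames
span the same plane. -/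
theorem Compat.expand (h : D.Compat D' σ w) (i : Fin 2) :
    D'.n i (D.trans D' σ w) = (signIf σ * D.rot D' σ i 0 w) • D.n 0 w +
      (signIf σ * D.rot D' σ i 1 w) • D.n 1 w := by
  have hk : constraint (uOf (etaOf D.η w)) (D'.n i (D.trans D' σ w)) = 0 := by
    rw [← constraint_conjIf σ, ← funext h.2.2.1]
    have := D'.frame _ h.2.1
    fin_cases i
    · exact this.2.2.2.1
    · exact this.2.2.2.2.1
  have h1 := (D.frame w h.1).2.2.2.2.2 _ hk
  simp only [rot, ← mul_assoc, signIf_mul_self, one_mul]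
  conv_lhs => rw [h1]
  rw [real_inner_comm, real_inner_comm (D'.n i (D.trans D' σ w)) (D.n 1 w)]

theorem Compat.rot_mul (h : D.Compat D' σ w) (i l : Fin 2) :
    D.rot D' σ i 0 w * D.rot D' σ l 0 w + D.rot D' σ i 1 w * D.rot D' σ l 1 w =
      inner ℝ (D'.n i (D.trans D' σ w)) (D'.n l (D.trans D' σ w)) := by
  have hs := signIf_mul_self σ
  conv_rhs => rw [h.expand l]
  rw [inner_add_right, inner_smul_right, inner_smul_right]
  simp only [rot]
  ring

/-- Only the frame vector is expanded, so `v` is arbitrary. This matters because the `i`-coordinates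
of a non-planar tuple need not lie in the kernel. -/
theorem Compat.rot_apply (h : D.Compat D' σ w) (i : Fin 2) (v : E6) :
    inner ℝ (D'.n i (D.trans D' σ w)) (signIf σ • v) =
      D.rot D' σ i 0 w * inner ℝ (D.n 0 w) v + D.rot D' σ i 1 w * inner ℝ (D.n 1 w) v := by
  have hs := signIf_mul_self σ
  conv_lhs => rw [h.expand i]
  rw [inner_smul_right, inner_add_left, real_inner_smul_left, real_inner_smul_left]
  linear_combination (D.rot D' σ i 0 w * inner ℝ (D.n 0 w) v +
    D.rot D' σ i 1 w * inner ℝ (D.n 1 w) v) * hs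

/-- The complex linear part of the change of the normal coordinates. -/
def alpha (D D' : FoldFrame) (σ : Bool) (w : Fin 4 → ℝ) : ℂ :=
  ⟨(D.rot D' σ 0 0 w + D.rot D' σ 1 1 w) / 2, (D.rot D' σ 1 0 w - D.rot D' σ 0 1 w) / 2⟩

/-- The antilinear part of the change of the normal coordinates. -/
def beta (D D' : FoldFrame) (σ : Bool) (w : Fin 4 → ℝ) : ℂ :=
  ⟨(D.rot D' σ 0 0 w - D.rot D' σ 1 1 w) / 2, (D.rot D' σ 1 0 w + D.rot D' σ 0 1 w) / 2⟩

theorem Compat.contDiffAt_alpha (h : D.Compat D' σ w) : ContDiffAt ℝ ∞ (D.alpha D' σ) w :=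
  equivRealProdCLM.symm.contDiff.contDiffAt.comp w
    ((((h.contDiffAt_rot 0 0).add (h.contDiffAt_rot 1 1)).div_const 2).prodMk
      (((h.contDiffAt_rot 1 0).sub (h.contDiffAt_rot 0 1)).div_const 2))

theorem Compat.contDiffAt_beta (h : D.Compat D' σ w) : ContDiffAt ℝ ∞ (D.beta D' σ) w :=
  equivRealProdCLM.symm.contDiff.contDiffAt.comp w
    ((((h.contDiffAt_rot 0 0).sub (h.contDiffAt_rot 1 1)).div_const 2).prodMk
      (((h.contDiffAt_rot 1 0).add (h.contDiffAt_rot 0 1)).div_const 2))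

/-- An orthogonal `2 × 2` matrix is complex linear or antilinear. In coordinates, the real part of
the product is the equality of the row norms and the imaginary part is the orthogonality of the
rows. -/
theorem Compat.alpha_mul_beta (h : D.Compat D' σ w) : D.alpha D' σ w * D.beta D' σ w = 0 := by
  have f := D'.frame _ h.2.1
  have h00 := h.rot_mul 0 0
  have h11 := h.rot_mul 1 1
  have h01 := h.rot_mul 0 1
  rw [f.1] at h00
  rw [f.2.1] at h11
  rw [f.2.2.1] at h01
  apply Complex.ext <;> simp only [alpha, beta, mul_re, mul_im, zero_re, zero_im]
  · linear_combination (1 / 4) * h00 - (1 / 4) * h11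
  · linear_combination (1 / 2) * h01

theorem alpha_add_beta (z : ℂ) : D.alpha D' σ w * z + D.beta D' σ w * conj z =
    ⟨D.rot D' σ 0 0 w * z.re + D.rot D' σ 0 1 w * z.im,
      D.rot D' σ 1 0 w * z.re + D.rot D' σ 1 1 w * z.im⟩ := by
  apply Complex.ext <;>
    simp only [alpha, beta, mul_re, mul_im, add_re, add_im, conj_re, conj_im] <;> ring

end FoldFrame

theorem conjIf_mul_conj (σ : Bool) {a : ℂ} (h : a * conj a = 1) :
    conjIf σ a * conj (conjIf σ a) = 1 := by
  rw [← conjIf_conj, ← conjIf_mul, h, conjIf_one]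

theorem im_conjIf (σ : Bool) (a : ℂ) : (conjIf σ a).im = signIf σ * a.im := by
  cases σ <;> simp [conjIf, signIf]

/-- The two lifts are conjugate and both in normal position, so they differ by the choice `σ` up to
rotation. Lengths of relative positions drop out of the tangents, which is why `w` determines the
new `w` without reference to `z`. -/
theorem IsFold.exists_compat {κ κ' : OpenPartialHomeomorph ChiS6Star E6} {D D' : FoldFrame}
    (h : IsFold κ D) (h' : IsFold κ' D') {x : ChiS6Star} (hx : x ∈ κ.source)
    (hx' : x ∈ κ'.source) :
    ∃ σ, D.Compat D' σ (splitC (κ x)).1 ∧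
      (splitC (κ' x)).1 = D.trans D' σ (splitC (κ x)).1 ∧
      (splitC (κ' x)).2 = D.alpha D' σ (splitC (κ x)).1 * (splitC (κ x)).2 +
        D.beta D' σ (splitC (κ x)).1 * conj (splitC (κ x)).2 := by
  obtain ⟨a, hax, had, ha0, hag, haκ⟩ := h.lift x hx
  obtain ⟨a', hax', had', ha0', hag', haκ'⟩ := h'.lift x hx'
  obtain ⟨σ, hσ, hv⟩ := normal_position_rel (hax.trans hax'.symm) ha0 hag ha0' hag'
  set w := (splitC (κ x)).1 with hw
  have hw1 : w = tanOf D.η (rel a.incl) := by rw [hw, haκ, D.splitC_coord]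
  have hw1' : (splitC (κ' x)).1 = tanOf D'.η (rel a'.incl) := by rw [haκ', D'.splitC_coord]
  have hrel : ∀ k, ∃ c : ℝ, 0 < c ∧ rel a'.incl k = c * conjIf σ (etaOf D.η w k) := by
    intro k
    obtain ⟨c, hc, hck⟩ := eq_smul_etaOf_tanOf D.unit (had.1 k)
    refine ⟨c, hc, ?_⟩
    rw [hσ, hck, conjIf_mul, conjIf_ofReal, hw1]
  have htr : tanOf D'.η (rel a'.incl) = D.trans D' σ w := by
    funext k
    obtain ⟨c, hc, hck⟩ := hrel k
    exact tanOf_smul hc hck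
  have hcomp : D.Compat D' σ w := by
    refine ⟨hw1 ▸ had.2, htr ▸ had'.2, fun k => ?_, fun k => ?_⟩
    · obtain ⟨c, hc, hck⟩ := hrel k
      obtain ⟨c', hc', hck'⟩ := eq_smul_etaOf_tanOf D'.unit (had'.1 k)
      rw [htr, hck] at hck'
      exact (eq_of_smul_eq_smul (conjIf_mul_conj σ (etaOf_mul_conj D.unit w k))
        (etaOf_mul_conj D'.unit _ k) hc hc' hck').symm
    · obtain ⟨c, hc, hck⟩ := hrel k
      have h1 := had'.1 k
      rw [hck, mul_assoc, re_ofReal_mul] at h1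
      exact (mul_pos_iff_of_pos_left hc).mp h1
  refine ⟨σ, hcomp, hw1'.trans htr, ?_⟩
  rw [FoldFrame.alpha_add_beta, haκ', D'.splitC_coord, haκ, D.splitC_coord, ← hw1, htr, hv]
  exact Complex.ext (hcomp.rot_apply 0 _) (hcomp.rot_apply 1 _)

/-- The transition has the required form at each point for some `σ`; smoothness needs one `σ` near
`x`. A fixed class has a relative position off the real axis, and the sign of its imaginary part
distinguishes the two choices. -/
theorem IsFold.compat {κ κ' : OpenPartialHomeomorph ChiS6Star E6} {D D' : FoldFrame}
    (h : IsFold κ D) (h' : IsFold κ' D') {x : ChiS6Star} (hx : x ∈ κ.source)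
    (hx' : x ∈ κ'.source) (hfix : nuStar x = x) :
    ∃ (f : (Fin 4 → ℝ) → (Fin 4 → ℝ)) (α β : (Fin 4 → ℝ) → ℂ),
        ContDiffAt ℝ ∞ f (splitC (κ x)).1 ∧ ContDiffAt ℝ ∞ α (splitC (κ x)).1 ∧
        ContDiffAt ℝ ∞ β (splitC (κ x)).1 ∧
        ∀ᶠ x' in 𝓝 x, (splitC (κ' x')).1 = f (splitC (κ x')).1 ∧
          α (splitC (κ x')).1 * β (splitC (κ x')).1 = 0 ∧
          (splitC (κ' x')).2 = α (splitC (κ x')).1 * (splitC (κ x')).2 +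
            β (splitC (κ x')).1 * (starRingEnd ℂ) (splitC (κ x')).2 := by
  obtain ⟨σ, hσ, hσ1, -⟩ := h.exists_compat h' hx hx'
  refine ⟨D.trans D' σ, D.alpha D' σ, D.beta D' σ, hσ.contDiffAt_trans, hσ.contDiffAt_alpha,
    hσ.contDiffAt_beta, ?_⟩
  -- the type of the change of coordinates is locally constant
  obtain ⟨k, hk⟩ : ∃ k, (etaOf D.η (splitC (κ x)).1 k).im ≠ 0 := by
    obtain ⟨a, hax, had, ha0, hag, haκ⟩ := h.lift x hx
    have hA := planar_of_fixed had ha0 hag (by rw [hax, hfix])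
    obtain ⟨k, hk⟩ := hA.exists_rel_im_ne_zero hag
    refine ⟨k, fun h0 => hk ?_⟩
    obtain ⟨c, hc, hck⟩ := eq_smul_etaOf_tanOf D.unit (had.1 k)
    rw [haκ, D.splitC_coord] at h0
    rw [hck, im_ofReal_mul, h0, mul_zero]
  -- These imaginary parts in the two charts differ by `signIf σ`, so the sign of their product
  -- determines `σ` and is continuous at `x`.
  let m (F : FoldFrame) (φ : OpenPartialHomeomorph ChiS6Star E6) (y : ChiS6Star) : ℝ :=
    (etaOf F.η (splitC (φ y)).1 k).im
  have hm : ∀ (F : FoldFrame) (φ : OpenPartialHomeomorph ChiS6Star E6), x ∈ φ.source →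
      ContinuousAt (m F φ) x := by
    intro F φ hφ
    have h1 : Continuous fun v : E6 => (etaOf F.η (splitC v).1 k).im :=
      continuous_im.comp ((contDiff_etaOf F.η k).continuous.comp
        (continuous_fst.comp splitC.continuous))
    exact h1.continuousAt.comp (φ.continuousAt hφ)
  have hmul : ∀ τ y, D.Compat D' τ (splitC (κ y)).1 →
      (splitC (κ' y)).1 = D.trans D' τ (splitC (κ y)).1 → m D' κ' y = signIf τ * m D κ y := by
    intro τ y hτ hy
    simp only [m]
    rw [hy, hτ.2.2.1, im_conjIf]
  have hpos : 0 < signIf σ * (m D κ x * m D' κ' x) := by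
    rw [hmul σ x hσ hσ1]
    have : signIf σ * (m D κ x * (signIf σ * m D κ x)) = m D κ x ^ 2 := by
      linear_combination (m D κ x ^ 2) * signIf_mul_self σ
    rw [this]
    exact sq_pos_iff.mpr hk
  have hev : ∀ᶠ y in 𝓝 x, 0 < signIf σ * (m D κ y * m D' κ' y) :=
    (continuousAt_const.mul ((hm D κ hx).mul (hm D' κ' hx'))).eventually (lt_mem_nhds hpos)
  filter_upwards [hev, κ.open_source.mem_nhds hx, κ'.open_source.mem_nhds hx'] with y hy hyκ hyκ'
  obtain ⟨τ, hτ, hτ1, hτ2⟩ := h.exists_compat h' hyκ hyκ'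
  have hτσ : τ = σ := by
    rw [hmul τ y hτ hτ1] at hy
    have h1 : 0 < signIf σ * signIf τ * m D κ y ^ 2 := by
      calc _ < _ := hy
        _ = _ := by ring
    have h2 : 0 < signIf σ * signIf τ := by
      by_contra hle
      exact absurd h1 (not_lt.mpr (mul_nonpos_of_nonpos_of_nonneg (not_lt.mp hle) (sq_nonneg _)))
    cases τ <;> cases σ <;> simp [signIf] at h2 ⊢ <;> linarith
  subst hτσ
  exact ⟨hτ1, hτ.alpha_mul_beta, hτ2⟩

/-- In a fold chart, the fixed points are where the last two coordinates vanish. -/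
theorem IsFold.image_fixedPoints {κ : OpenPartialHomeomorph ChiS6Star E6} {D : FoldFrame}
    (h : IsFold κ D) : κ '' (κ.source ∩ fixedPoints nuStar) =
      κ.target ∩ {y | ∀ i : Fin 6, 6 ≤ (i : ℕ) + 2 → y i = 0} := by
  have key : ∀ y : E6, reflectC y = y ↔ ∀ i : Fin 6, 6 ≤ (i : ℕ) + 2 → y i = 0 := by
    intro y
    rw [reflectC_eq_self_iff, splitC_apply]
    constructor
    · intro h1 i hi
      have h4 : y 4 = 0 := congrArg Complex.re h1
      have h5 : y 5 = 0 := congrArg Complex.im h1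
      fin_cases i
      · simp at hi
      · simp at hi
      · simp at hi
      · simp at hi
      · exact h4
      · exact h5
    · intro h1
      exact Complex.ext (h1 4 (by decide)) (h1 5 (by decide))
  ext y
  constructor
  · rintro ⟨x, ⟨hx, hfix⟩, rfl⟩
    refine ⟨κ.map_source hx, (key _).mp ?_⟩
    rw [← (h.nu x hx).2, hfix]
  · rintro ⟨hy, hy0⟩
    have hx := κ.map_target hy
    refine ⟨κ.symm y, ⟨hx, ?_⟩, κ.right_inv hy⟩
    apply κ.injOn (h.nu _ hx).1 hx
    rw [(h.nu _ hx).2, κ.right_inv hy]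
    exact (key y).mpr hy0

end SU2Char

namespace SU2Char

open SliceManifold Complex ComplexConjugate

/-! ### The fixed points of the involution -/

theorem SU2.sq_of_re_eq_zero {a : SU2} (ha : (a : ℍ[ℝ]).re = 0) :
    (a : ℍ[ℝ]) * (a : ℍ[ℝ]) = -1 := by
  have h := mul_inv_cancel a
  rw [inv_eq_neg_of_re_eq_zero ha] at h
  have h1 : (a : ℍ[ℝ]) * -(a : ℍ[ℝ]) = 1 := congrArg Subtype.val h
  rw [mul_neg] at h1
  rw [← h1, neg_neg]

/-- Imaginary unit quaternions which are not opposite are conjugate by an element of the algebra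
generated by their product. -/
theorem SU2.exists_conj_of_re_eq_zero {a b : SU2} (ha : (a : ℍ[ℝ]).re = 0)
    (hb : (b : ℍ[ℝ]).re = 0) (hne : b ≠ -a) :
    ∃ q : SU2, q * a = b * q ∧ ∀ c : SU2, Commute c (b * a) → Commute c q := by
  have haa := SU2.sq_of_re_eq_zero ha
  have hbb := SU2.sq_of_re_eq_zero hb
  -- Since `a² = b² = -1`, both `p * a` and `b * p` equal `a + b`; `p` vanishes only for `b = -a`.
  set p : ℍ[ℝ] := 1 - b * a with hp
  have hp0 : p ≠ 0 := by
    intro h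
    apply hne
    have h1 : (b : ℍ[ℝ]) * a = 1 := (sub_eq_zero.mp h).symm
    have h2 : b * a = 1 := Subtype.ext h1
    rw [eq_inv_of_mul_eq_one_left h2, inv_eq_neg_of_re_eq_zero ha]
  have hn : ‖p‖ ≠ 0 := norm_ne_zero_iff.mpr hp0
  let q : SU2 := ⟨‖p‖⁻¹ • p, by
    rw [mem_sphere_zero_iff_norm, norm_smul, norm_inv, norm_norm, inv_mul_cancel₀ hn]⟩
  refine ⟨q, Subtype.ext ?_, fun c hc => ?_⟩
  · change (‖p‖⁻¹ • p) * (a : ℍ[ℝ]) = b * (‖p‖⁻¹ • p)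
    rw [smul_mul_assoc, mul_smul_comm, hp, sub_mul, mul_sub, one_mul, mul_one, mul_assoc, haa,
      ← mul_assoc, hbb]
    congr 1
    simp
    abel
  · rw [SU2.commute_coe_iff] at hc ⊢
    change Commute (c : ℍ[ℝ]) (‖p‖⁻¹ • p)
    refine Commute.smul_right ?_ _
    exact (Commute.one_right _).sub_right hc

theorem hi_eq_zero_of_anticommute {x : ℍ[ℝ]} (h : cj I 0 * x = -(x * cj I 0)) : hi x = 0 := by
  have h1 := (quaternion_ext_iff'.mp h).1
  simp [cj] at h1
  change x.imI = 0
  linarith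

/-- A conjugation realising the sign change is by some `g` that anticommutes with every value, and
anticommuting with an imaginary unit means orthogonality to it. Thus `g` has to be imaginary, and it
remains to rotate `g` to `i`. -/
theorem exists_planar_lift {x : ChiS6Star} (hfix : nuStar x = x) :
    ∃ a : RepS6Star, Planar a ∧ a.cls = x := by
  obtain ⟨a, rfl⟩ : ∃ a : RepS6Star, a.cls = x := by
    obtain ⟨x, A, hA, rfl⟩ := x
    exact ⟨⟨A, hA⟩, rfl⟩
  rw [← cls_negRep] at hfix
  obtain ⟨g, hg⟩ := cls_eq_iff.mp hfix.symm
  have hgs : star (g : ℍ[ℝ]) * g = 1 := by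
    rw [← SU2.coe_inv]
    exact congrArg Subtype.val (inv_mul_cancel g)
  have h1 : ∀ k, (g : ℍ[ℝ]) * a.incl k = -(a.incl k * g) := by
    intro k
    have h2 := congrFun hg k
    rw [incl_negRep] at h2
    have h3 := congrArg (· * (g : ℍ[ℝ])) h2
    simp only [conjAmb, mul_assoc, hgs, mul_one] at h3
    rw [← h3]
    simp
  have hre : (g : ℍ[ℝ]).re = 0 := by
    by_contra h0
    -- The square of `g` commutes with every value, hence is real. With `Re g ≠ 0` this makes `g`
    -- itself real, and a non-zero real quaternion anticommutes with no unit.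
    have h2 : imVec ((g : ℍ[ℝ]) * g) = 0 := by
      refine eq_zero_of_commute a fun k => ?_
      change (g : ℍ[ℝ]) * g * a.incl k = a.incl k * (g * g)
      rw [mul_assoc, h1, mul_neg, ← mul_assoc, h1, neg_mul, neg_neg, mul_assoc]
    rw [imVec_eq_zero] at h2
    simp only [Quaternion.imI_mul, Quaternion.imJ_mul, Quaternion.imK_mul] at h2
    have e1 : (g : ℍ[ℝ]).imI = 0 := by
      have : (g : ℍ[ℝ]).re * (g : ℍ[ℝ]).imI = 0 := by linarith [h2.1]
      exact (mul_eq_zero.mp this).resolve_left h0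
    have e2 : (g : ℍ[ℝ]).imJ = 0 := by
      have : (g : ℍ[ℝ]).re * (g : ℍ[ℝ]).imJ = 0 := by linarith [h2.2.1]
      exact (mul_eq_zero.mp this).resolve_left h0
    have e3 : (g : ℍ[ℝ]).imK = 0 := by
      have : (g : ℍ[ℝ]).re * (g : ℍ[ℝ]).imK = 0 := by linarith [h2.2.2]
      exact (mul_eq_zero.mp this).resolve_left h0
    have hc : Commute (g : ℍ[ℝ]) (a.incl 0) := by
      rw [commute_iff_cross, e1, e2, e3]
      simp
    have h3 := h1 0
    rw [hc.eq] at h3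
    have h4 : a.incl 0 * (g : ℍ[ℝ]) = 0 := by
      generalize a.incl 0 * (g : ℍ[ℝ]) = z at h3
      obtain ⟨z0, z1, z2, z3⟩ := quaternion_ext_iff'.mp h3
      rw [Quaternion.re_neg] at z0
      rw [Quaternion.imI_neg] at z1
      rw [Quaternion.imJ_neg] at z2
      rw [Quaternion.imK_neg] at z3
      refine quaternion_ext_iff'.mpr ⟨?_, ?_, ?_, ?_⟩
      · rw [Quaternion.re_zero]; linarith
      · rw [Quaternion.imI_zero]; linarith
      · rw [Quaternion.imJ_zero]; linarith
      · rw [Quaternion.imK_zero]; linarith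
    have h5 := congrArg Quaternion.normSq h4
    rw [map_mul, normSq_incl, SU2.normSq] at h5
    simp at h5
  let i : SU2 := SU2.mk (cj I 0) (by simp [normSq_cj])
  by_cases hgi : i = -g
  · refine ⟨a, fun k => hi_eq_zero_of_anticommute ?_, rfl⟩
    have : cj I 0 = -(g : ℍ[ℝ]) := congrArg Subtype.val hgi
    rw [this, neg_mul, mul_neg, h1]
  · obtain ⟨q, hq, -⟩ := SU2.exists_conj_of_re_eq_zero hre (b := i) (by simp [i, SU2.mk, cj]) hgi
    obtain ⟨b, hb, hbc⟩ := exists_conj q a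
    refine ⟨b, fun k => hi_eq_zero_of_anticommute ?_, hbc⟩
    have e1 : (q : ℍ[ℝ]) * g = cj I 0 * q := congrArg Subtype.val hq
    have hqs : star (q : ℍ[ℝ]) * q = 1 := by
      rw [← SU2.coe_inv]
      exact congrArg Subtype.val (inv_mul_cancel q)
    have e2 : (g : ℍ[ℝ]) * star (q : ℍ[ℝ]) = star (q : ℍ[ℝ]) * cj I 0 := by
      have h2 : g * q⁻¹ = q⁻¹ * i := by
        rw [eq_inv_mul_iff_mul_eq, ← mul_assoc, hq, mul_assoc, mul_inv_cancel, mul_one]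
      have h3 := congrArg Subtype.val h2
      change (g : ℍ[ℝ]) * ((q⁻¹ : SU2) : ℍ[ℝ]) = ((q⁻¹ : SU2) : ℍ[ℝ]) * cj I 0 at h3
      rwa [SU2.coe_inv] at h3
    rw [hb, conjAmb]
    calc cj I 0 * ((q : ℍ[ℝ]) * a.incl k * star (q : ℍ[ℝ])) =
          (cj I 0 * q) * a.incl k * star (q : ℍ[ℝ]) := by simp only [mul_assoc]
      _ = q * (g * a.incl k) * star (q : ℍ[ℝ]) := by rw [← e1]; simp only [mul_assoc]
      _ = -(q * a.incl k * (g * star (q : ℍ[ℝ]))) := by rw [h1]; simp [mul_assoc]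
      _ = _ := by rw [e2]; simp only [mul_assoc]

/-- A non-abelian representation with values orthogonal to `i`. -/
theorem exists_planar : ∃ a : RepS6Star, Planar a := by
  -- The alternating product of these numbers is `-1`, as `Planar.prod` demands; the first two
  -- values are `j` and `k`, which do not commute.
  let u : Fin 6 → ℂ := ![1, I, 1, 1, 1, I]
  let x : Amb := fun k => cj 0 (u k)
  have hp : prod6 x = 1 := by
    simp only [prod6, x, u, cj_mul]
    ext <;> simp [cj]
  have hx : x ∈ range RepS6Star.incl := by
    refine mem_range_incl_iff.mpr ⟨con_eq_zero_iff.mpr ⟨fun k => rfl, fun k => ?_, ?_⟩, ?_, 0, 1, ?_⟩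
    · simp only [x, normSq_cj, u]
      fin_cases k <;> simp
    · rw [hp, imVec_eq_zero]; simp
    · rw [hp]; simp
    · rw [commute_iff_cross]
      simp [x, u, cj]
  obtain ⟨a, ha⟩ := hx
  exact ⟨a, fun k => by rw [ha]; rfl⟩

theorem incl_injective : Injective RepS6Star.incl := by
  intro a b h
  apply Subtype.ext
  apply Subtype.ext
  funext k
  exact Subtype.ext (congrFun h k)

theorem Planar.nuStar_cls {a : RepS6Star} (hA : Planar a) : nuStar a.cls = a.cls := by
  obtain ⟨b, hb, hbc⟩ := exists_flip a
  rw [← hbc]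
  congr 1
  apply incl_injective
  rw [hb, hA.incl_eq]
  funext k
  ext <;> simp [flip, cj]

instance : Nonempty RepS6Star := ⟨exists_planar.choose⟩

theorem fixedPoints_nuStar_nonempty : (fixedPoints nuStar).Nonempty := by
  obtain ⟨a, ha⟩ := exists_planar
  exact ⟨a.cls, ha.nuStar_cls⟩

end SU2Char

namespace SU2Char

/-! ### Topology of character varieties -/

theorem SU2.re_mul_comm (a b : ℍ[ℝ]) : (a * b).re = (b * a).re := by
  simp only [Quaternion.re_mul]
  ring

theorem SU2.re_conj (g a : SU2) : ((g * a * g⁻¹ : SU2) : ℍ[ℝ]).re = (a : ℍ[ℝ]).re := by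
  change ((g * a : SU2) * (g⁻¹ : SU2) : ℍ[ℝ]).re = _
  rw [SU2.re_mul_comm]
  change ((g⁻¹ * (g * a) : SU2) : ℍ[ℝ]).re = _
  rw [inv_mul_cancel_left]

section General

variable {ι : Type} {rels S : Set (FreeGroup ι)}

theorem continuous_lift (w : FreeGroup ι) : Continuous fun A : ι → SU2 => FreeGroup.lift A w := by
  induction w using FreeGroup.induction_on with
  | C1 => simpa using continuous_const
  | of i => simpa using continuous_apply i
  | inv_of i h => simpa using (continuous_apply i).fun_inv
  | mul x y hx hy => simpa using hx.fun_mul hy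

theorem lift_conj (g : SU2) (A : ι → SU2) (w : FreeGroup ι) :
    FreeGroup.lift (fun i => g * A i * g⁻¹) w = g * FreeGroup.lift A w * g⁻¹ := by
  have h : FreeGroup.lift (fun i => g * A i * g⁻¹) =
      (MulAut.conj g).toMonoidHom.comp (FreeGroup.lift A) := by
    refine FreeGroup.ext_hom _ _ fun i => ?_
    rw [FreeGroup.lift_apply_of, MonoidHom.comp_apply, FreeGroup.lift_apply_of]
    rfl
  rw [h]
  rfl

/-- The conjugate of a representation. -/
def Rep.conj (g : SU2) (A : Rep rels S) : Rep rels S :=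
  ⟨fun i => g * A.1 i * g⁻¹, fun r hr => by rw [lift_conj, A.2.1 r hr]; simp,
    fun w hw => by rw [lift_conj, SU2.re_conj, A.2.2 w hw]⟩

theorem Rep.cls_conj (g : SU2) (A : Rep rels S) : (A.conj g).cls = A.cls :=
  Quotient.sound ⟨g⁻¹, fun i => by simp [Rep.conj, mul_assoc]⟩

theorem Rep.cls_eq_iff {A B : Rep rels S} : A.cls = B.cls ↔ ∃ g : SU2, B = A.conj g := by
  rw [Rep.cls, Rep.cls, Quotient.eq]
  refine exists_congr fun g => ?_
  rw [Subtype.ext_iff, funext_iff]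
  rfl

theorem Rep.exists_cls_eq (x : CharVar rels S) : ∃ A : Rep rels S, A.cls = x :=
  Quotient.exists_rep x

theorem Rep.continuous_conj : Continuous fun p : SU2 × Rep rels S => p.2.conj p.1 := by
  refine Continuous.subtype_mk (continuous_pi fun i => ?_) _
  have h : Continuous fun p : SU2 × Rep rels S => p.2.1 i :=
    (continuous_apply i).comp (continuous_subtype_val.comp continuous_snd)
  exact (continuous_fst.mul h).mul continuous_fst.inv

instance : CompactSpace (Rep rels S) := by
  have h1 : IsClosed {A : ι → SU2 | ∀ r ∈ rels, FreeGroup.lift A r = 1} := by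
    simp only [ofPred_forall]
    exact isClosed_iInter fun r => isClosed_iInter fun _ =>
      isClosed_eq (continuous_lift r) continuous_const
  have h2 : IsClosed {A : ι → SU2 | ∀ w ∈ S, ((FreeGroup.lift A w : SU2) : ℍ[ℝ]).re = 0} := by
    simp only [ofPred_forall]
    exact isClosed_iInter fun w => isClosed_iInter fun _ =>
      isClosed_eq (contDiff_re.continuous.comp (continuous_subtype_val.comp (continuous_lift w)))
        continuous_const
  exact isCompact_iff_compactSpace.mp (h1.inter h2).isCompact

/-- The saturation of an open set is a union of conjugates of it. -/
theorem Rep.isOpenQuotientMap_cls :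
    IsOpenQuotientMap (Rep.cls : Rep rels S → CharVar rels S) := by
  refine ⟨Rep.exists_cls_eq, continuous_quotient_mk', fun U hU => ?_⟩
  change IsOpen ((Rep.cls : Rep rels S → CharVar rels S) ⁻¹' (Rep.cls '' U))
  have e : (Rep.cls : Rep rels S → CharVar rels S) ⁻¹' (Rep.cls '' U) =
      ⋃ g : SU2, Rep.conj g ⁻¹' U := by
    ext A
    simp only [mem_preimage, mem_image, mem_iUnion]
    constructor
    · rintro ⟨B, hB, hBA⟩
      obtain ⟨g, rfl⟩ := Rep.cls_eq_iff.mp hBA.symm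
      exact ⟨g, hB⟩
    · rintro ⟨g, hg⟩
      exact ⟨_, hg, Rep.cls_conj g A⟩
  rw [e]
  exact isOpen_iUnion fun g => hU.preimage (Rep.continuous_conj.comp (Continuous.prodMk_right g))

/-- The quotient map is open and the orbit relation is the image of the compact space `SU2 × Rep`,
hence closed. -/
instance : T2Space (CharVar rels S) := by
  rw [t2Space_iff_of_isOpenQuotientMap Rep.isOpenQuotientMap_cls]
  have e : {q : Rep rels S × Rep rels S | q.1.cls = q.2.cls} =
      range fun p : SU2 × Rep rels S => (p.2, p.2.conj p.1) := by
    ext ⟨A, B⟩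
    simp only [mem_ofPred_eq, mem_range, Prod.mk.injEq, Prod.exists, Rep.cls_eq_iff]
    constructor
    · rintro ⟨g, rfl⟩
      exact ⟨g, A, rfl, rfl⟩
    · rintro ⟨g, A, rfl, rfl⟩
      exact ⟨g, rfl⟩
  rw [e]
  exact (isCompact_range (continuous_snd.prodMk Rep.continuous_conj)).isClosed

instance [Countable ι] : SecondCountableTopology (Rep rels S) :=
  TopologicalSpace.Subtype.secondCountableTopology _

instance [Countable ι] : SecondCountableTopology (CharVar rels S) :=
  Rep.isOpenQuotientMap_cls.isQuotientMap.secondCountableTopology Rep.isOpenQuotientMap_cls.isOpenMap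

/-! ### Strata -/

theorem Rep.isNonabelian_conj {A : Rep rels S} {g : SU2} :
    (A.conj g).IsNonabelian ↔ A.IsNonabelian := by
  rw [Rep.isNonabelian_iff, Rep.isNonabelian_iff]
  refine exists_congr fun i => exists_congr fun j => not_congr ?_
  change Commute (MulAut.conj g (A.1 i)) (MulAut.conj g (A.1 j)) ↔ _
  rw [Commute, SemiconjBy, ← map_mul, ← map_mul, (MulAut.conj g).injective.eq_iff]
  rfl

theorem Rep.hom_of (A : Rep rels S) (i : ι) : A.hom (PresentedGroup.of i) = A.1 i :=
  PresentedGroup.toGroup.of A.2.1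

theorem Rep.isCentral_iff (A : Rep rels S) :
    A.IsCentral ↔ ∀ i, A.1 i ∈ Subgroup.center SU2 := by
  constructor
  · intro h i
    rw [← A.hom_of]
    exact h _
  · intro h a
    have key : A.hom.range ≤ Subgroup.center SU2 := by
      rw [MonoidHom.range_eq_map, ← PresentedGroup.closure_range_of, MonoidHom.map_closure,
        Subgroup.closure_le]
      rintro _ ⟨_, ⟨i, rfl⟩, rfl⟩
      rw [A.hom_of]
      exact h i
    exact key ⟨a, rfl⟩

theorem Rep.isCentral_conj {A : Rep rels S} {g : SU2} : (A.conj g).IsCentral ↔ A.IsCentral := by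
  rw [Rep.isCentral_iff, Rep.isCentral_iff]
  refine forall_congr' fun i => ?_
  constructor
  · intro h
    have := Subgroup.Normal.conj_mem (H := Subgroup.center SU2) inferInstance _ h g⁻¹
    simpa [Rep.conj, mul_assoc] using this
  · intro h
    exact Subgroup.Normal.conj_mem (H := Subgroup.center SU2) inferInstance _ h g

theorem Rep.cls_mem_starLocus {A : Rep rels S} : A.cls ∈ starLocus rels S ↔ A.IsNonabelian := by
  constructor
  · rintro ⟨B, hB, hBA⟩
    obtain ⟨g, rfl⟩ := Rep.cls_eq_iff.mp hBA
    exact Rep.isNonabelian_conj.mpr hB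
  · exact fun h => ⟨A, h, rfl⟩

theorem Rep.cls_mem_cenLocus {A : Rep rels S} : A.cls ∈ cenLocus rels S ↔ A.IsCentral := by
  constructor
  · rintro ⟨B, hB, hBA⟩
    obtain ⟨g, rfl⟩ := Rep.cls_eq_iff.mp hBA
    exact Rep.isCentral_conj.mpr hB
  · exact fun h => ⟨A, h, rfl⟩

theorem Rep.IsNonabelian.not_isCentral {A : Rep rels S} (h : A.IsNonabelian) : ¬ A.IsCentral :=
  fun hc => h fun a b => (Subgroup.mem_center_iff.mp (hc a) (A.hom b)).symm

theorem compl_cenLocus : (cenLocus rels S)ᶜ = starLocus rels S ∪ ancLocus rels S := by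
  ext x
  obtain ⟨A, rfl⟩ := Rep.exists_cls_eq x
  rw [mem_compl_iff, Rep.cls_mem_cenLocus]
  constructor
  · intro h
    by_cases hA : A.IsNonabelian
    · exact Or.inl ⟨A, hA, rfl⟩
    · exact Or.inr ⟨A, ⟨not_not.mp hA, h⟩, rfl⟩
  · rintro (h | ⟨B, hB, hBA⟩)
    · exact (Rep.cls_mem_starLocus.mp h).not_isCentral
    · rw [← Rep.cls_mem_cenLocus, ← hBA, Rep.cls_mem_cenLocus]
      exact hB.2

theorem disjoint_starLocus_ancLocus : Disjoint (starLocus rels S) (ancLocus rels S) := by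
  rw [disjoint_left]
  rintro x hx ⟨B, hB, rfl⟩
  exact Rep.cls_mem_starLocus.mp hx hB.1

end General

end SU2Char

namespace SU2Char

/-! ### The non-abelian traceless representations -/

theorem isEmbedding_incl : IsEmbedding RepS6Star.incl := by
  have h : IsEmbedding (Pi.map fun (_ : Fin 6) (a : SU2) => (a : ℍ[ℝ])) :=
    IsEmbedding.piMap fun _ => IsEmbedding.subtypeVal
  exact h.comp (IsEmbedding.subtypeVal.comp IsEmbedding.subtypeVal)

theorem isOpenQuotientMap_cls : IsOpenQuotientMap RepS6Star.cls := by
  have hq := Rep.isOpenQuotientMap_cls (rels := relsS6) (S := meridians)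
  refine ⟨?_, ?_, fun U hU => ?_⟩
  · rintro ⟨x, A, hA, rfl⟩
    exact ⟨⟨A, hA⟩, rfl⟩
  · exact Continuous.subtype_mk (hq.continuous.comp continuous_subtype_val) _
  · obtain ⟨V, hV, rfl⟩ := isOpen_induced_iff.mp hU
    refine isOpen_induced_iff.mpr ⟨Rep.cls '' V, hq.isOpenMap _ hV, ?_⟩
    ext ⟨x, hx⟩
    constructor
    · rintro ⟨A, hA, rfl⟩
      exact ⟨⟨A, Rep.cls_mem_starLocus.mp hx⟩, hA, rfl⟩
    · rintro ⟨A, hA, hAx⟩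
      exact ⟨A.1, hA, congrArg Subtype.val hAx⟩

theorem continuous_nuRep : Continuous nuRep := by
  refine Continuous.subtype_mk (continuous_pi fun i => ?_) _
  have h : Continuous fun A : RepS6 => A.1 i :=
    (continuous_apply i).comp continuous_subtype_val
  refine Continuous.subtype_mk ?_ _
  exact (continuous_subtype_val.comp h).neg

theorem continuous_nuStar : Continuous nuStar :=
  Continuous.subtype_mk ((continuous_nuRep.quotient_map' _).comp continuous_subtype_val) _

theorem nuStar_involutive : Involutive nuStar := fun x => Subtype.ext (nu_nu x.1)

/-! ### The central representations -/

theorem SU2.mem_center_iff {a : SU2} : a ∈ Subgroup.center SU2 ↔ imVec (a : ℍ[ℝ]) = 0 := by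
  rw [Subgroup.mem_center_iff]
  constructor
  · intro h
    let i : SU2 := SU2.mk (qmk 0 1 0 0) (by simp [Quaternion.normSq_def'])
    let j : SU2 := SU2.mk (qmk 0 0 1 0) (by simp [Quaternion.normSq_def'])
    have hi : Commute (i : ℍ[ℝ]) a := congrArg Subtype.val (h i)
    have hj : Commute (j : ℍ[ℝ]) a := congrArg Subtype.val (h j)
    rw [commute_iff_cross] at hi hj
    simp [i, j, SU2.mk] at hi hj
    rw [imVec_eq_zero]
    tauto
  · intro h g
    rw [imVec_eq_zero] at h
    have : Commute g a := by
      rw [SU2.commute_coe_iff, commute_iff_cross, h.1, h.2.1, h.2.2]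
      simp
    exact this

/-- The sign, as a unit quaternion. -/
def signSU2 (b : Bool) : SU2 := if b then -1 else 1

theorem SU2.mem_center_iff_exists {a : SU2} : a ∈ Subgroup.center SU2 ↔ ∃ b, a = signSU2 b := by
  rw [SU2.mem_center_iff, imVec_eq_zero]
  constructor
  · rintro ⟨h1, h2, h3⟩
    have hn := SU2.normSq a
    rw [Quaternion.normSq_def', h1, h2, h3] at hn
    have hr : ((a : ℍ[ℝ]).re - 1) * ((a : ℍ[ℝ]).re + 1) = 0 := by linarith
    rcases mul_eq_zero.mp hr with hr | hr
    · refine ⟨false, Subtype.ext (quaternion_ext_iff'.mpr ?_)⟩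
      simp [signSU2, h1, h2, h3]
      linarith
    · refine ⟨true, Subtype.ext (quaternion_ext_iff'.mpr ?_)⟩
      simp [signSU2, h1, h2, h3]
      linarith
  · rintro ⟨b, rfl⟩
    cases b <;> simp [signSU2]

theorem signSU2_injective : Injective signSU2 := by
  have h : signSU2 true ≠ signSU2 false := by
    intro h
    have h1 := congrArg (fun a : SU2 => (a : ℍ[ℝ]).re) h
    simp [signSU2] at h1
    linarith
  intro a b hab
  cases a <;> cases b
  · rfl
  · exact absurd hab.symm h
  · exact absurd hab h
  · rfl

theorem signSU2_mem_center (b : Bool) : signSU2 b ∈ Subgroup.center SU2 :=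
  SU2.mem_center_iff_exists.mpr ⟨b, rfl⟩

theorem commute_signSU2 (b : Bool) (a : SU2) : Commute (signSU2 b) a :=
  (Subgroup.mem_center_iff.mp (signSU2_mem_center b) a).symm

/-- The central representations of the surface group. -/
def centralRep (ε : Fin 4 → Bool) : RepF2 :=
  ⟨fun i => signSU2 (ε i), by
    refine ⟨?_, by simp⟩
    rintro r rfl
    have h : ∀ a b : Bool, signSU2 a * signSU2 b * (signSU2 a)⁻¹ * (signSU2 b)⁻¹ = 1 := by
      intro a b
      rw [(commute_signSU2 a _).eq]
      group
    simp [h]⟩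

theorem ncard_cenLocus : (cenLocus relsF2 ∅).ncard = 16 := by
  have e : cenLocus relsF2 ∅ = (fun ε => (centralRep ε).cls) '' univ := by
    ext x
    obtain ⟨A, rfl⟩ := Rep.exists_cls_eq x
    rw [Rep.cls_mem_cenLocus]
    constructor
    · intro h
      rw [Rep.isCentral_iff] at h
      choose ε hε using fun i => SU2.mem_center_iff_exists.mp (h i)
      refine ⟨ε, mem_univ _, ?_⟩
      change (centralRep ε).cls = _
      congr 1
      exact Subtype.ext (funext fun i => (hε i).symm)
    · rintro ⟨ε, -, hε⟩
      have h1 : (centralRep ε).IsCentral :=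
        (Rep.isCentral_iff _).mpr fun i => signSU2_mem_center _
      rw [← Rep.cls_mem_cenLocus, ← hε]
      exact Rep.cls_mem_cenLocus.mpr h1
  rw [e, ncard_image_of_injective]
  · rw [ncard_univ, Nat.card_eq_fintype_card]
    rfl
  · intro ε ε' h
    obtain ⟨g, hg⟩ := Rep.cls_eq_iff.mp h
    funext i
    apply signSU2_injective
    have h1 : signSU2 (ε' i) = g * signSU2 (ε i) * g⁻¹ :=
      congrArg (fun B : RepF2 => B.1 i) hg
    rw [← (commute_signSU2 (ε i) g).eq, mul_inv_cancel_right] at h1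
    exact h1.symm

/-! ### The map `p*` and the strata -/

theorem SU2.mul_mem_center_of_commute {a b : SU2} (ha : (a : ℍ[ℝ]).re = 0)
    (hb : (b : ℍ[ℝ]).re = 0) (h : Commute a b) : a * b ∈ Subgroup.center SU2 := by
  rw [SU2.mem_center_iff, imVec_eq_zero]
  rw [SU2.commute_coe_iff, commute_iff_cross] at h
  change ((a : ℍ[ℝ]) * b).imI = 0 ∧ ((a : ℍ[ℝ]) * b).imJ = 0 ∧ ((a : ℍ[ℝ]) * b).imK = 0
  simp only [Quaternion.imI_mul, Quaternion.imJ_mul, Quaternion.imK_mul, ha, hb]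
  obtain ⟨h1, h2, h3⟩ := h
  refine ⟨?_, ?_, ?_⟩ <;> linarith

theorem commute_iff_of_mul_mem_center {G : Type} [Group G] {a b : G}
    (h : a * b ∈ Subgroup.center G) (c : G) : Commute a c ↔ Commute b c := by
  have h1 : Commute (a * b) c := (Subgroup.mem_center_iff.mp h c).symm
  constructor
  · intro h2
    have : b = a⁻¹ * (a * b) := by group
    rw [this]
    exact h2.inv_left.mul_left h1
  · intro h2
    have : a = (a * b) * b⁻¹ := by group
    rw [this]
    exact h1.mul_left h2.inv_left

/-- The values of `p*` are products of neighbouring generators, up to inversion. If `ab` is central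
then `a` and `b` have the same centraliser, so central values give all generators the same
centraliser. Conversely the product of two commuting imaginary units is real. -/
theorem pRep_isCentral_iff (A : RepS6) : (pRep A).IsCentral ↔ ¬ A.IsNonabelian := by
  have hre := RepS6.re_eq_zero A
  rw [Rep.isCentral_iff, Rep.isNonabelian_iff]
  push Not
  constructor
  · intro h
    have h0 : A.1 0 * A.1 1 ∈ Subgroup.center SU2 := h 0
    have h1 : A.1 1 * A.1 2 ∈ Subgroup.center SU2 := by
      have := inv_mem (h 1)
      simpa [pRep] using this
    have h2 : A.1 3 * A.1 4 ∈ Subgroup.center SU2 := h 2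
    have h3 : A.1 4 * A.1 5 ∈ Subgroup.center SU2 := by
      have := inv_mem (h 3)
      simpa [pRep] using this
    -- The values of `p*` link the generators only within each triple; the relator supplies the link
    -- between the triples.
    have h4 : A.1 2 * A.1 5 ∈ Subgroup.center SU2 := by
      have e : A.1 2 * A.1 5 = ((A.1 0 * A.1 1) * (A.1 3 * A.1 4))⁻¹ := by
        rw [eq_inv_iff_mul_eq_one]
        refine Eq.trans ?_ (RepS6.prod_eq_one A)
        have c0 : ∀ g, g * (A.1 0 * A.1 1) = (A.1 0 * A.1 1) * g := Subgroup.mem_center_iff.mp h0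
        have c2 : ∀ g, g * (A.1 3 * A.1 4) = (A.1 3 * A.1 4) * g := Subgroup.mem_center_iff.mp h2
        calc A.1 2 * A.1 5 * (A.1 0 * A.1 1 * (A.1 3 * A.1 4)) =
              A.1 2 * A.1 5 * (A.1 0 * A.1 1) * (A.1 3 * A.1 4) := by simp only [mul_assoc]
          _ = (A.1 0 * A.1 1) * (A.1 2 * (A.1 5 * (A.1 3 * A.1 4))) := by
              rw [c0]; simp only [mul_assoc]
          _ = _ := by rw [c2]; simp only [mul_assoc]
      rw [e]
      exact inv_mem (mul_mem h0 h2)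
    have key : ∀ i c, Commute (A.1 i) c ↔ Commute (A.1 5) c := by
      have k2 := commute_iff_of_mul_mem_center h4
      have k1 : ∀ c, Commute (A.1 1) c ↔ Commute (A.1 5) c := fun c =>
        (commute_iff_of_mul_mem_center h1 c).trans (k2 c)
      have k4 := commute_iff_of_mul_mem_center h3
      intro i c
      fin_cases i
      · exact (commute_iff_of_mul_mem_center h0 c).trans (k1 c)
      · exact k1 c
      · exact k2 c
      · exact (commute_iff_of_mul_mem_center h2 c).trans (k4 c)
      · exact k4 c
      · exact Iff.rfl
    intro i j
    rw [key i]
    exact ((key j _).mpr (Commute.refl _)).symm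
  · intro h i
    have hinv : ∀ i j, (A.1 i)⁻¹ * (A.1 j)⁻¹ ∈ Subgroup.center SU2 := fun i j => by
      rw [← mul_inv_rev]
      exact inv_mem (SU2.mul_mem_center_of_commute (hre j) (hre i) (h j i))
    fin_cases i
    · exact SU2.mul_mem_center_of_commute (hre 0) (hre 1) (h 0 1)
    · exact hinv 2 1
    · exact SU2.mul_mem_center_of_commute (hre 3) (hre 4) (h 3 4)
    · exact hinv 5 4

theorem pStar_cls (A : RepS6) : pStar A.cls = (pRep A).cls := rfl

theorem preimage_pStar : pStar ⁻¹' (cenLocus relsF2 ∅)ᶜ = starLocus relsS6 meridians := by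
  ext x
  obtain ⟨A, rfl⟩ := Rep.exists_cls_eq x
  rw [mem_preimage, mem_compl_iff, pStar_cls, Rep.cls_mem_cenLocus, pRep_isCentral_iff, not_not,
    Rep.cls_mem_starLocus]

theorem continuous_pRep : Continuous pRep := by
  refine Continuous.subtype_mk ?_ _
  have h : ∀ i, Continuous fun A : RepS6 => A.1 i := fun i =>
    (continuous_apply i).comp continuous_subtype_val
  refine continuous_pi fun i => ?_
  fin_cases i
  · exact (h 0).mul (h 1)
  · exact (h 2).inv.mul (h 1).inv
  · exact (h 3).mul (h 4)
  · exact (h 5).inv.mul (h 4).inv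

theorem continuous_pStar : Continuous pStar := continuous_pRep.quotient_map' _

theorem isClosedMap_pStar : IsClosedMap pStar := continuous_pStar.isClosedMap

/-- The map `p*` between the non-abelian and the non-central loci. -/
def pStarBar (x : ChiS6Star) : ChiF2Noncentral :=
  ⟨pStar x.1, by rw [← mem_preimage, preimage_pStar]; exact x.2⟩

theorem continuous_pStarBar : Continuous pStarBar :=
  Continuous.subtype_mk (continuous_pStar.comp continuous_subtype_val) _

/-- A continuous map from a compact space to a Hausdorff one is closed, and so is its restriction to
a full preimage. -/
theorem isClosedMap_pStarBar : IsClosedMap pStarBar := by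
  intro C hC
  obtain ⟨K, hK, rfl⟩ := isClosed_induced_iff.mp hC
  refine isClosed_induced_iff.mpr ⟨pStar '' K, isClosedMap_pStar _ hK, ?_⟩
  ext ⟨y, hy⟩
  constructor
  · rintro ⟨x, hx, rfl⟩
    have hs : x ∈ starLocus relsS6 meridians := by
      rw [← preimage_pStar]
      exact hy
    exact ⟨⟨x, hs⟩, hx, rfl⟩
  · rintro ⟨x, hx, hxy⟩
    exact ⟨x.1, hx, congrArg Subtype.val hxy⟩

end SU2Char

namespace SU2Char

/-! ### The fibers of `p*` -/

/-- The tuple over `b` determined by the product `y` of its first three entries. -/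
def tupleOf (b : Fin 4 → SU2) (y : SU2) : Fin 6 → SU2 :=
  ![y * b 1, (b 1)⁻¹ * y⁻¹ * b 0, (b 0)⁻¹ * y, y⁻¹ * b 3, (b 3)⁻¹ * y * b 2, (b 2)⁻¹ * y⁻¹]

theorem prod_inv_eq (A : RepS6) : (A.1 0 * A.1 1 * A.1 2)⁻¹ = A.1 3 * A.1 4 * A.1 5 := by
  rw [inv_eq_iff_mul_eq_one]
  have h := RepS6.prod_eq_one A
  simpa only [mul_assoc] using h

/-- Each generator is a word in `y = x₁x₂x₃` and the values of `p*`, because the last three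
generators have product `y⁻¹`. The fibres of `p*` are thus described by `y` alone. -/
theorem eq_tupleOf (A : RepS6) : A.1 = tupleOf (pRep A).1 (A.1 0 * A.1 1 * A.1 2) := by
  have h := prod_inv_eq A
  have h' : A.1 0 * A.1 1 * A.1 2 = (A.1 3 * A.1 4 * A.1 5)⁻¹ := by rw [← h, inv_inv]
  funext i
  fin_cases i
  · change A.1 0 = A.1 0 * A.1 1 * A.1 2 * ((A.1 2)⁻¹ * (A.1 1)⁻¹)
    group
  · change A.1 1 = ((A.1 2)⁻¹ * (A.1 1)⁻¹)⁻¹ * (A.1 0 * A.1 1 * A.1 2)⁻¹ * (A.1 0 * A.1 1)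
    group
  · change A.1 2 = (A.1 0 * A.1 1)⁻¹ * (A.1 0 * A.1 1 * A.1 2)
    group
  · change A.1 3 = (A.1 0 * A.1 1 * A.1 2)⁻¹ * ((A.1 5)⁻¹ * (A.1 4)⁻¹)
    rw [h]
    group
  · change A.1 4 = ((A.1 5)⁻¹ * (A.1 4)⁻¹)⁻¹ * (A.1 0 * A.1 1 * A.1 2) * (A.1 3 * A.1 4)
    rw [h']
    group
  · change A.1 5 = (A.1 3 * A.1 4)⁻¹ * (A.1 0 * A.1 1 * A.1 2)⁻¹
    rw [h]
    group

theorem tupleOf_neg (b : Fin 4 → SU2) (y : SU2) (i : Fin 6) : tupleOf b (-y) i = -tupleOf b y i := by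
  have h : (-y)⁻¹ = -y⁻¹ := by
    rw [inv_eq_iff_mul_eq_one, neg_mul_neg, mul_inv_cancel]
  fin_cases i <;> simp [tupleOf, h]

theorem tupleOf_conj {b : Fin 4 → SU2} {q y z : SU2} (hy : q * y = z * q)
    (hb : ∀ i, Commute q (b i)) (i : Fin 6) : tupleOf b z i = q * tupleOf b y i * q⁻¹ := by
  have h1 : MulAut.conj q y = z := by
    rw [MulAut.conj_apply, hy, mul_inv_cancel_right]
  have h2 : ∀ i, MulAut.conj q (b i) = b i := fun i => by
    rw [MulAut.conj_apply, (hb i).eq, mul_inv_cancel_right]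
  change _ = MulAut.conj q (tupleOf b y i)
  fin_cases i <;> simp only [tupleOf, Fin.zero_eta, Fin.mk_one, Fin.reduceFinMk, Matrix.cons_val,
    map_mul, map_inv, h1, h2]

/-- The commutator of the first two values of `p*`, as a square. -/
theorem commutator_eq {a b c : SU2} (ha : a⁻¹ = -a) (hb : b⁻¹ = -b) (hc : c⁻¹ = -c) :
    (a * b) * (c⁻¹ * b⁻¹) * (a * b)⁻¹ * (c⁻¹ * b⁻¹)⁻¹ = -((a * b * c) * (a * b * c)) := by
  have hbb : b * b = -1 := by
    have h1 : b * b⁻¹ = 1 := mul_inv_cancel b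
    rw [hb, mul_neg] at h1
    rw [← h1, neg_neg]
  calc (a * b) * (c⁻¹ * b⁻¹) * (a * b)⁻¹ * (c⁻¹ * b⁻¹)⁻¹ =
        a * b * c⁻¹ * (b⁻¹ * b⁻¹) * a⁻¹ * b * c := by group
    _ = -((a * b * c) * (a * b * c)) := by
        rw [ha, hb, hc, neg_mul_neg, hbb]
        simp [mul_assoc]

theorem SU2.mul_self_eq (y : SU2) :
    (y : ℍ[ℝ]) * y = (2 * (y : ℍ[ℝ]).re) • (y : ℍ[ℝ]) - 1 := by
  have hn := SU2.normSq y
  rw [Quaternion.normSq_def'] at hn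
  rw [quaternion_ext_iff']
  simp only [Quaternion.re_mul, Quaternion.imI_mul, Quaternion.imJ_mul, Quaternion.imK_mul,
    Quaternion.re_sub, Quaternion.imI_sub, Quaternion.imJ_sub, Quaternion.imK_sub,
    Quaternion.re_smul, Quaternion.imI_smul, Quaternion.imJ_smul, Quaternion.imK_smul,
    Quaternion.re_one, Quaternion.imI_one, Quaternion.imJ_one, Quaternion.imK_one, smul_eq_mul]
  refine ⟨?_, ?_, ?_, ?_⟩ <;> linarith

/-- A square root of a unit quaternion other than `-1` is unique up to sign. -/
theorem SU2.eq_or_eq_neg_of_mul_self_eq {y z : SU2} (h : y * y = z * z)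
    (hy : (y : ℍ[ℝ]).re ≠ 0) : z = y ∨ z = -y := by
  have h1 : (y : ℍ[ℝ]) * y = (z : ℍ[ℝ]) * z := congrArg Subtype.val h
  rw [SU2.mul_self_eq, SU2.mul_self_eq, sub_left_inj] at h1
  have h2 := (quaternion_ext_iff'.mp h1).1
  rw [Quaternion.re_smul, Quaternion.re_smul, smul_eq_mul, smul_eq_mul] at h2
  have h3 : (z : ℍ[ℝ]).re ^ 2 = (y : ℍ[ℝ]).re ^ 2 := by linarith
  have h4 : (2 * (y : ℍ[ℝ]).re) ≠ 0 := mul_ne_zero two_ne_zero hy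
  rcases sq_eq_sq_iff_eq_or_eq_neg.mp h3 with h5 | h5
  · left
    rw [h5] at h1
    exact (Subtype.ext (smul_right_injective _ h4 h1)).symm
  · right
    rw [h5, mul_neg, neg_smul, ← smul_neg] at h1
    have h6 : (y : ℍ[ℝ]) = -(z : ℍ[ℝ]) := smul_right_injective _ h4 h1
    apply Subtype.ext
    change (z : ℍ[ℝ]) = -(y : ℍ[ℝ])
    rw [h6, neg_neg]

theorem SU2.re_eq_zero_of_mul_self_eq {y z : SU2} (h : y * y = z * z)
    (hy : (y : ℍ[ℝ]).re = 0) : (z : ℍ[ℝ]).re = 0 := by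
  have h1 : (y : ℍ[ℝ]) * y = (z : ℍ[ℝ]) * z := congrArg Subtype.val h
  rw [SU2.mul_self_eq, SU2.mul_self_eq, sub_left_inj] at h1
  have h2 := (quaternion_ext_iff'.mp h1).1
  rw [Quaternion.re_smul, Quaternion.re_smul, smul_eq_mul, smul_eq_mul, hy] at h2
  have h3 : (z : ℍ[ℝ]).re ^ 2 = 0 := by linarith
  exact pow_eq_zero_iff two_ne_zero |>.mp h3

/-- If the product of the first three values is imaginary, then conjugation by it inverts the
values of `p*`. -/
theorem inverts_of_re_eq_zero (A : RepS6) {y : SU2} (hy : y = A.1 0 * A.1 1 * A.1 2)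
    (h : (y : ℍ[ℝ]).re = 0) (i : Fin 4) : y * (pRep A).1 i = ((pRep A).1 i)⁻¹ * y := by
  have hA := eq_tupleOf A
  rw [← hy] at hA
  have hinv := inv_eq_neg_of_re_eq_zero h
  have hx : ∀ k, (tupleOf (pRep A).1 y k)⁻¹ = -tupleOf (pRep A).1 y k := fun k => by
    rw [← congrFun hA k]
    exact inv_eq_neg_of_re_eq_zero (RepS6.re_eq_zero A k)
  have hl : ∀ b : SU2, (y * b)⁻¹ = -(y * b) → y * b = b⁻¹ * y := by
    intro b hb
    rw [mul_inv_rev, hinv, mul_neg] at hb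
    exact (neg_injective hb).symm
  have hr : ∀ b : SU2, (b⁻¹ * y)⁻¹ = -(b⁻¹ * y) → y * b = b⁻¹ * y := by
    intro b hb
    rw [mul_inv_rev, hinv, inv_inv, neg_mul] at hb
    exact neg_injective hb
  have hneg : ∀ b : SU2, (-b)⁻¹ = -b⁻¹ := fun b => by
    rw [inv_eq_iff_mul_eq_one, neg_mul_neg, mul_inv_cancel]
  fin_cases i
  · exact hr _ (hx 2)
  · exact hl _ (hx 0)
  · refine hr _ ?_
    have h1 := hx 5
    change (((pRep A).1 2)⁻¹ * y⁻¹)⁻¹ = -(((pRep A).1 2)⁻¹ * y⁻¹) at h1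
    rw [hinv, mul_neg, hneg] at h1
    exact neg_injective h1
  · refine hl _ ?_
    have h1 := hx 3
    change (y⁻¹ * (pRep A).1 3)⁻¹ = -(y⁻¹ * (pRep A).1 3) at h1
    rw [hinv, neg_mul, hneg] at h1
    exact neg_injective h1

/-- By `commutator_eq` the square of `y` is determined by the image, so `y` is unique up to sign
unless it is imaginary. In that case `y` and `z` both invert all the values of `p*`, and the element
conjugating one to the other can be taken to commute with these values. -/
theorem cls_eq_or_of_pRep_eq {A A' : RepS6} (h : pRep A' = pRep A) :
    A'.cls = A.cls ∨ A'.cls = (nuRep A).cls := by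
  set y := A.1 0 * A.1 1 * A.1 2 with hy
  set z := A'.1 0 * A'.1 1 * A'.1 2 with hz
  have hA := eq_tupleOf A
  have hA' := eq_tupleOf A'
  rw [← hy] at hA
  rw [← hz, h] at hA'
  have hi := fun i => inv_eq_neg_of_re_eq_zero (RepS6.re_eq_zero A i)
  have hi' := fun i => inv_eq_neg_of_re_eq_zero (RepS6.re_eq_zero A' i)
  have hsq : y * y = z * z := by
    have h1 := commutator_eq (hi 0) (hi 1) (hi 2)
    have h2 := commutator_eq (hi' 0) (hi' 1) (hi' 2)
    have h3 := congrArg (fun B : RepF2 => B.1 0 * B.1 1 * (B.1 0)⁻¹ * (B.1 1)⁻¹) h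
    exact neg_injective (h1.symm.trans (h3.symm.trans h2))
  have hneg : z = -y → A'.cls = (nuRep A).cls := by
    intro hzy
    congr 1
    apply Subtype.ext
    funext i
    rw [congrFun hA' i, hzy, tupleOf_neg, ← congrFun hA i]
    rfl
  by_cases hre : (y : ℍ[ℝ]).re = 0
  · have hrez := SU2.re_eq_zero_of_mul_self_eq hsq hre
    by_cases hzy : z = -y
    · exact Or.inr (hneg hzy)
    · left
      obtain ⟨q, hq, hqc⟩ := SU2.exists_conj_of_re_eq_zero hre hrez hzy
      -- Two successive inversions cancel, so `z * y` commutes with the values of `p*`; `q` is built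
      -- from `z * y`.
      have hb : ∀ i, Commute q ((pRep A).1 i) := by
        intro i
        refine (hqc _ ?_).symm
        have h1 := inverts_of_re_eq_zero A hy hre i
        have h2 := inverts_of_re_eq_zero A' hz hrez i
        rw [h] at h2
        set b := (pRep A).1 i
        have h3 : z * b⁻¹ = b * z := by
          rw [mul_inv_eq_iff_eq_mul, mul_assoc, h2, mul_inv_cancel_left]
        change b * (z * y) = z * y * b
        rw [mul_assoc z y b, h1, ← mul_assoc z b⁻¹ y, h3, mul_assoc b z y]
      refine (Rep.cls_eq_iff.mpr ⟨q, ?_⟩).symm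
      apply Subtype.ext
      funext i
      rw [congrFun hA' i, tupleOf_conj hq hb, ← congrFun hA i]
      rfl
  · rcases SU2.eq_or_eq_neg_of_mul_self_eq hsq hre with hzy | hzy
    · left
      congr 1
      apply Subtype.ext
      rw [hA', hzy, ← hA]
    · exact Or.inr (hneg hzy)

theorem pRep_conj (g : SU2) (A : RepS6) : pRep (A.conj g) = (pRep A).conj g := by
  apply Subtype.ext
  funext i
  fin_cases i <;> simp [pRep, Rep.conj, mul_assoc]

theorem pRep_nuRep (A : RepS6) : pRep (nuRep A) = pRep A := by
  have h : ∀ a : SU2, (-a)⁻¹ = -a⁻¹ := fun a => by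
    rw [inv_eq_iff_mul_eq_one, neg_mul_neg, mul_inv_cancel]
  apply Subtype.ext
  funext i
  fin_cases i <;> simp [pRep, nuRep, h]

theorem pStarBar_eq_iff (x x' : ChiS6Star) :
    pStarBar x = pStarBar x' ↔ x' = x ∨ x' = nuStar x := by
  obtain ⟨x, hx⟩ := x
  obtain ⟨x', hx'⟩ := x'
  obtain ⟨A, rfl⟩ := Rep.exists_cls_eq x
  obtain ⟨A', rfl⟩ := Rep.exists_cls_eq x'
  simp only [Subtype.ext_iff, pStarBar, nuStar]
  change (pRep A).cls = (pRep A').cls ↔ A'.cls = A.cls ∨ A'.cls = (nuRep A).cls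
  constructor
  · intro h
    obtain ⟨g, hg⟩ := Rep.cls_eq_iff.mp h
    rw [← pRep_conj] at hg
    rw [← Rep.cls_conj g A]
    have : (nuRep A).cls = (nuRep (A.conj g)).cls :=
      congrArg nu (Rep.cls_conj g A).symm
    rw [this]
    exact cls_eq_or_of_pRep_eq hg
  · rintro (h | h)
    · exact congrArg pStar h.symm
    · rw [← pRep_nuRep]
      exact congrArg pStar h.symm

/-! ### Surjectivity of `p*` -/

/-- The conditions on `y` for the tuple over `r, s, …` to be traceless. -/
def Balanced (y r s : SU2) : Prop :=
  ((y * s : SU2) : ℍ[ℝ]).re = 0 ∧ ((r⁻¹ * y : SU2) : ℍ[ℝ]).re = 0 ∧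
    ((r⁻¹ * y * s : SU2) : ℍ[ℝ]).re = 0

theorem SU2.re_mul_comm' (a b : SU2) : ((a * b : SU2) : ℍ[ℝ]).re = ((b * a : SU2) : ℍ[ℝ]).re :=
  SU2.re_mul_comm _ _

theorem SU2.re_inv (a : SU2) : ((a⁻¹ : SU2) : ℍ[ℝ]).re = (a : ℍ[ℝ]).re := by
  rw [SU2.coe_inv, Quaternion.re_star]

/-- Take the normalisation of `1 - c`. Each required real part is then a multiple of a difference of
real parts of two conjugate elements, or of two elements with the same inverse-free trace by
cyclicity. -/
theorem exists_balanced_of_ne_one {c : SU2} (hc : c ≠ 1) :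
    ∃ y : SU2, ∀ r s : SU2, r * s * r⁻¹ * s⁻¹ = c → Balanced y r s := by
  set p : ℍ[ℝ] := 1 - c with hp
  have hp0 : p ≠ 0 := fun h => hc (Subtype.ext (sub_eq_zero.mp h).symm)
  let y : SU2 := ⟨‖p‖⁻¹ • p, by
    rw [mem_sphere_zero_iff_norm, norm_smul, norm_inv, norm_norm,
      inv_mul_cancel₀ (norm_ne_zero_iff.mpr hp0)]⟩
  have key : ∀ a b : SU2, ((a * y * b : SU2) : ℍ[ℝ]).re =
      ‖p‖⁻¹ * (((a * b : SU2) : ℍ[ℝ]).re - ((a * c * b : SU2) : ℍ[ℝ]).re) := by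
    intro a b
    change ((a : ℍ[ℝ]) * (‖p‖⁻¹ • p) * b).re =
      ‖p‖⁻¹ * (((a : ℍ[ℝ]) * b).re - ((a : ℍ[ℝ]) * c * b).re)
    rw [mul_smul_comm, smul_mul_assoc, Quaternion.re_smul, smul_eq_mul, hp, mul_sub, sub_mul,
      mul_one, Quaternion.re_sub]
  refine ⟨y, fun r s h => ⟨?_, ?_, ?_⟩⟩
  · have h1 := key 1 s
    have e : 1 * c * s = r * s * r⁻¹ := by rw [← h]; group
    rw [e, SU2.re_conj, one_mul, one_mul, sub_self, mul_zero] at h1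
    exact h1
  · have h1 := key r⁻¹ 1
    have e : r⁻¹ * c * 1 = s * r⁻¹ * s⁻¹ := by rw [← h]; group
    rw [e, SU2.re_conj, mul_one, mul_one, sub_self, mul_zero] at h1
    exact h1
  · have h1 := key r⁻¹ s
    have e : r⁻¹ * c * s = s * r⁻¹ := by rw [← h]; group
    rw [e, SU2.re_mul_comm' s, sub_self, mul_zero] at h1
    exact h1

theorem exists_smul_eq_of_commute {m w : ℍ[ℝ]} (hm : imVec m ≠ 0) (h : Commute m w) :
    ∃ t : ℝ, imVec w = t • imVec m := by
  rw [commute_iff_cross] at h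
  obtain ⟨h1, h2, h3⟩ := h
  by_cases hI : m.imI = 0
  · by_cases hJ : m.imJ = 0
    · have hK : m.imK ≠ 0 := fun hK => hm (imVec_eq_zero.mpr ⟨hI, hJ, hK⟩)
      refine ⟨w.imK / m.imK, ?_⟩
      ext i
      fin_cases i <;> simp [imVec] <;> field_simp <;> linarith
    · refine ⟨w.imJ / m.imJ, ?_⟩
      ext i
      fin_cases i <;> simp [imVec] <;> field_simp <;> linarith
  · refine ⟨w.imI / m.imI, ?_⟩
    ext i
    fin_cases i <;> simp [imVec] <;> field_simp <;> linarith

/-- Commuting elements have imaginary parts on a common axis `e`, as do `r⁻¹` and `s * r⁻¹`. The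
product of an imaginary `y` orthogonal to `e` with any of these has real part zero. -/
theorem exists_balanced_of_commute {r s : SU2} (h : Commute r s) :
    ∃ e : Fin 3 → ℝ, ∀ y : SU2, (y : ℍ[ℝ]).re = 0 → imVec (y : ℍ[ℝ]) ⬝ᵥ e = 0 →
      Balanced y r s := by
  obtain ⟨e, h1, h2, h3⟩ : ∃ e : Fin 3 → ℝ, (∃ t : ℝ, imVec (s : ℍ[ℝ]) = t • e) ∧
      (∃ t : ℝ, imVec ((r⁻¹ : SU2) : ℍ[ℝ]) = t • e) ∧
      ∃ t : ℝ, imVec ((s * r⁻¹ : SU2) : ℍ[ℝ]) = t • e := by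
    have hcom : ∀ m : SU2, imVec (m : ℍ[ℝ]) ≠ 0 → ∀ w : SU2, Commute m w →
        ∃ t : ℝ, imVec (w : ℍ[ℝ]) = t • imVec (m : ℍ[ℝ]) := fun m hm w hw =>
      exists_smul_eq_of_commute hm (SU2.commute_coe_iff.mp hw)
    by_cases hr : imVec (r : ℍ[ℝ]) = 0
    · by_cases hs : imVec (s : ℍ[ℝ]) = 0
      · rw [← SU2.mem_center_iff] at hr hs
        have z1 := SU2.mem_center_iff.mp hs
        have z2 := SU2.mem_center_iff.mp (inv_mem hr)
        have z3 := SU2.mem_center_iff.mp (mul_mem hs (inv_mem hr))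
        exact ⟨0, ⟨0, by rw [z1]; simp⟩, ⟨0, by rw [z2]; simp⟩, ⟨0, by rw [z3]; simp⟩⟩
      · exact ⟨_, hcom s hs s (Commute.refl s), hcom s hs _ h.symm.inv_right,
          hcom s hs _ ((Commute.refl s).mul_right h.symm.inv_right)⟩
    · exact ⟨_, hcom r hr s h, hcom r hr _ (Commute.refl r).inv_right,
        hcom r hr _ (h.mul_right (Commute.refl r).inv_right)⟩
  refine ⟨e, fun y hy hye => ?_⟩
  have key : ∀ w : SU2, (∃ t : ℝ, imVec (w : ℍ[ℝ]) = t • e) →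
      ((y * w : SU2) : ℍ[ℝ]).re = 0 := by
    rintro w ⟨t, ht⟩
    have e1 : ((y : ℍ[ℝ]) * w).re = -(imVec (y : ℍ[ℝ]) ⬝ᵥ imVec (w : ℍ[ℝ])) := by
      rw [Quaternion.re_mul, hy]
      simp [imVec, dotProduct, Fin.sum_univ_three]
      ring
    change ((y : ℍ[ℝ]) * w).re = 0
    rw [e1, ht, dotProduct_smul, hye]
    simp
  refine ⟨key s h1, ?_, ?_⟩
  · rw [SU2.re_mul_comm']
    exact key _ h2
  · rw [mul_assoc, SU2.re_mul_comm', mul_assoc]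
    exact key _ h3

theorem exists_imaginary_orthogonal (e e' : Fin 3 → ℝ) : ∃ y : SU2, (y : ℍ[ℝ]).re = 0 ∧
    imVec (y : ℍ[ℝ]) ⬝ᵥ e = 0 ∧ imVec (y : ℍ[ℝ]) ⬝ᵥ e' = 0 := by
  let L : (Fin 3 → ℝ) →ₗ[ℝ] ℝ × ℝ :=
    { toFun := fun v => (v ⬝ᵥ e, v ⬝ᵥ e')
      map_add' := fun v w => by simp [add_dotProduct]
      map_smul' := fun c v => by simp [smul_dotProduct] }
  have hL : LinearMap.ker L ≠ ⊥ := LinearMap.ker_ne_bot_of_finrank_lt (by simp)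
  obtain ⟨v, hv, hv0⟩ := Submodule.exists_mem_ne_zero_of_ne_bot hL
  have hv1 : v ⬝ᵥ e = 0 := congrArg Prod.fst hv
  have hv2 : v ⬝ᵥ e' = 0 := congrArg Prod.snd hv
  have hp0 : imQuat v ≠ 0 := fun h => hv0 (by rw [← imVec_imQuat v, h, map_zero])
  refine ⟨⟨‖imQuat v‖⁻¹ • imQuat v, by
    rw [mem_sphere_zero_iff_norm, norm_smul, norm_inv, norm_norm,
      inv_mul_cancel₀ (norm_ne_zero_iff.mpr hp0)]⟩, ?_, ?_, ?_⟩
  · simp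
  · rw [map_smul, imVec_imQuat, smul_dotProduct, hv1, smul_zero]
  · rw [map_smul, imVec_imQuat, smul_dotProduct, hv2, smul_zero]

theorem exists_balanced (B : RepF2) :
    ∃ y : SU2, Balanced y (B.1 0) (B.1 1) ∧ Balanced y (B.1 3) (B.1 2) := by
  have hrel : (B.1 0 * B.1 1 * (B.1 0)⁻¹ * (B.1 1)⁻¹) *
      (B.1 2 * B.1 3 * (B.1 2)⁻¹ * (B.1 3)⁻¹) = 1 := by
    have := B.2.1 _ (mem_singleton _)
    simpa using this
  -- The second pair is taken in the order `s₊, r₊`, which inverts its commutator and makes it equal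
  -- to the first one; a single `y` then serves both pairs.
  have h2 : B.1 3 * B.1 2 * (B.1 3)⁻¹ * (B.1 2)⁻¹ = B.1 0 * B.1 1 * (B.1 0)⁻¹ * (B.1 1)⁻¹ := by
    rw [eq_inv_of_mul_eq_one_left hrel]
    group
  have hcomm : ∀ r s : SU2, r * s * r⁻¹ * s⁻¹ = 1 → Commute r s := by
    intro r s h
    rw [mul_inv_eq_one, mul_inv_eq_iff_eq_mul] at h
    exact h
  by_cases hc : B.1 0 * B.1 1 * (B.1 0)⁻¹ * (B.1 1)⁻¹ = 1
  · obtain ⟨e, he⟩ := exists_balanced_of_commute (hcomm _ _ hc)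
    obtain ⟨e', he'⟩ := exists_balanced_of_commute (hcomm _ _ (h2.trans hc))
    obtain ⟨y, hy, h3, h4⟩ := exists_imaginary_orthogonal e e'
    exact ⟨y, he y hy h3, he' y hy h4⟩
  · obtain ⟨y, hy⟩ := exists_balanced_of_ne_one hc
    exact ⟨y, hy _ _ rfl, hy _ _ h2⟩

/-- The six balancing conditions are the vanishing of the real parts of the entries of `tupleOf`,
some of them up to inversion. -/
theorem exists_pRep_eq (B : RepF2) : ∃ A : RepS6, pRep A = B := by
  obtain ⟨y, ⟨h1, h2, h3⟩, h4, h5, h6⟩ := exists_balanced B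
  have hre : ∀ i, ((tupleOf B.1 y i : SU2) : ℍ[ℝ]).re = 0 := by
    intro i
    fin_cases i
    · exact h1
    · refine (SU2.re_inv _).symm.trans (Eq.trans ?_ h3)
      congr 2
      change ((B.1 1)⁻¹ * y⁻¹ * B.1 0)⁻¹ = _
      group
    · exact h2
    · refine (SU2.re_inv _).symm.trans (Eq.trans ?_ h5)
      congr 2
      change (y⁻¹ * B.1 3)⁻¹ = _
      group
    · exact h6
    · refine (SU2.re_inv _).symm.trans (Eq.trans ?_ h4)
      congr 2
      change ((B.1 2)⁻¹ * y⁻¹)⁻¹ = _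
      group
  refine ⟨⟨tupleOf B.1 y, ?_, ?_⟩, ?_⟩
  · rintro r rfl
    simp [tupleOf]
    group
  · rintro _ ⟨i, rfl⟩
    rw [FreeGroup.lift_apply_of]
    exact hre i
  · apply Subtype.ext
    funext i
    fin_cases i <;> simp [pRep, tupleOf] <;> group

theorem surjective_pStarBar : Surjective pStarBar := by
  rintro ⟨y, hy⟩
  obtain ⟨B, rfl⟩ := Rep.exists_cls_eq y
  obtain ⟨A, rfl⟩ := exists_pRep_eq B
  have hA : A.cls ∈ starLocus relsS6 meridians := by
    rw [← preimage_pStar]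
    exact hy
  exact ⟨⟨A.cls, hA⟩, rfl⟩

end SU2Char

namespace SU2Char

open SliceManifold SliceManifold.SliceChart

/-! ### The branched double cover -/

theorem isOpenQuotientMap_mk : IsOpenQuotientMap (Quotient.mk nuSetoid) := by
  refine ⟨Quotient.mk_surjective, continuous_quotient_mk', fun U hU => ?_⟩
  change IsOpen (Quotient.mk nuSetoid ⁻¹' (Quotient.mk nuSetoid '' U))
  have e : Quotient.mk nuSetoid ⁻¹' (Quotient.mk nuSetoid '' U) = U ∪ nuStar ⁻¹' U := by
    ext x
    constructor
    · rintro ⟨y, hy, hyx⟩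
      rcases Quotient.exact hyx with rfl | rfl
      · exact Or.inl hy
      · refine Or.inr ?_
        rw [mem_preimage, nuStar_involutive]
        exact hy
    · rintro (hx | hx)
      · exact ⟨x, hx, rfl⟩
      · exact ⟨nuStar x, hx, Quotient.sound (Or.inr (nuStar_involutive x))⟩
  rw [e]
  exact hU.union (hU.preimage continuous_nuStar)

/-- The homeomorphism induced by `p*`. -/
def quotientHomeo : Quotient nuSetoid ≃ₜ ChiF2Noncentral :=
  Equiv.toHomeomorphOfContinuousClosed
    (Equiv.ofBijective
      (Quotient.lift pStarBar fun x y h => (pStarBar_eq_iff x y).mpr (by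
        rcases h with rfl | rfl
        · exact Or.inl rfl
        · exact Or.inr rfl))
      ⟨by
        rintro ⟨x⟩ ⟨y⟩ h
        rcases (pStarBar_eq_iff x y).mp h with rfl | rfl
        · rfl
        · exact Quotient.sound (Or.inr rfl), fun y => by
        obtain ⟨x, hx⟩ := surjective_pStarBar y
        exact ⟨Quotient.mk _ x, hx⟩⟩)
    (continuous_pStarBar.quotient_lift _)
    (fun C hC => by
      have h := isClosedMap_pStarBar _ (hC.preimage continuous_quotient_mk')
      convert h using 1
      ext y
      constructor
      · rintro ⟨⟨x⟩, hx, rfl⟩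
        exact ⟨x, hx, rfl⟩
      · rintro ⟨x, hx, rfl⟩
        exact ⟨Quotient.mk _ x, hx, rfl⟩)

/-- A linear isomorphism of the model space of the representations with the product of the models
of the orbit space and the orbits. -/
def splitRep : EuclideanSpace ℝ (Fin 9) ≃L[ℝ] E6 × (Fin 3 → ℝ) :=
  ContinuousLinearEquiv.ofFinrankEq (by simp)

/-- A linear isomorphism of the slice model with the ambient space. -/
def splitAmb : ((E6 × (Fin 3 → ℝ)) × ConSpace) ≃L[ℝ] Amb :=
  ContinuousLinearEquiv.ofFinrankEq (finrank_slice.trans finrank_amb.symm)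

/-- The smooth structure on the representations. -/
abbrev repStructure : ChartedSpace (EuclideanSpace ℝ (Fin 9)) RepS6Star :=
  repCharted isEmbedding_incl splitRep exists_sliceChart_at

/-- The smooth structure on the orbit space. -/
abbrev orbitStructure : ChartedSpace E6 ChiS6Star :=
  quotCharted isEmbedding_incl isOpenQuotientMap_cls exists_sliceChart_at

theorem contMDiff_nuStar :
    let := orbitStructure
    ContMDiff (𝓡 6) (𝓡 6) ∞ nuStar :=
  contMDiff_induced isEmbedding_incl isOpenQuotientMap_cls exists_sliceChart_at
    exists_smooth_translate continuous_nuStar (g₀ := fun x => -x) contDiff_neg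
    fun a => ⟨negRep a, rfl, rfl⟩

theorem exists_isFold {x : ChiS6Star} (hx : nuStar x = x) :
    ∃ (S : SliceChart E6 (Fin 3 → ℝ) ConSpace RepS6Star.incl RepS6Star.cls) (D : FoldFrame),
      x ∈ (S.quotChart isEmbedding_incl isOpenQuotientMap_cls).source ∧
        IsFold (S.quotChart isEmbedding_incl isOpenQuotientMap_cls) D := by
  obtain ⟨a, ha, rfl⟩ := exists_planar_lift hx
  exact ha.exists_fold _ _

/-- The family of fold charts meets the hypotheses of `exists_smooth_branched_quotient`: they cover
the fixed points, `ν` acts as `reflectC`, and the transitions have the form given by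
`IsFold.compat`. -/
theorem exists_branched_structure :
    let := orbitStructure
    ∃ _ : ChartedSpace E6 ChiF2Noncentral, IsManifold (𝓡 6) ∞ ChiF2Noncentral ∧
      ContMDiff (𝓡 6) (𝓡 6) ∞ pStarBar := by
  let := orbitStructure
  have : IsManifold (𝓡 6) ∞ ChiS6Star :=
    isManifold_quotCharted isEmbedding_incl isOpenQuotientMap_cls exists_sliceChart_at
      exists_smooth_translate
  have hπ : IsOpenQuotientMap pStarBar :=
    quotientHomeo.isOpenQuotientMap.comp isOpenQuotientMap_mk
  refine exists_smooth_branched_quotient contMDiff_nuStar nuStar_involutive hπ pStarBar_eq_iff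
    {κ | κ ∈ IsManifold.maximalAtlas (𝓡 6) ∞ ChiS6Star ∧ ∃ D, IsFold κ D} (fun κ h => h.1)
    (fun x hx => ?_) (fun κ h x hx => ?_) (fun κ h κ' h' x hx hx' hfix => ?_)
  · obtain ⟨S, D, hS, hD⟩ := exists_isFold hx
    exact ⟨_, ⟨quotChart_mem_maximalAtlas isEmbedding_incl isOpenQuotientMap_cls
      exists_sliceChart_at exists_smooth_translate S, D, hD⟩, hS⟩
  · obtain ⟨-, D, hD⟩ := h
    exact hD.nu x hx
  · obtain ⟨-, D, hD⟩ := h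
    obtain ⟨-, D', hD'⟩ := h'
    exact hD.compat hD' hx hx' hfix

theorem isSubmanifold_fixedPoints :
    let := orbitStructure
    IsSubmanifoldOfCodim 6 2 (fixedPoints nuStar) := by
  intro _ x hx
  obtain ⟨S, D, hS, hD⟩ := exists_isFold hx
  exact ⟨_, quotChart_mem_maximalAtlas isEmbedding_incl isOpenQuotientMap_cls
    exists_sliceChart_at exists_smooth_translate S, hS, hD.image_fixedPoints⟩

end SU2Char

end

/-! ### Assembly -/

theorem mainTheorem10 :
    -- the stratification: sixteen central points, whose complement is the union of the
    -- non-abelian and the abelian non-central locus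
    (SU2Char.cenLocus SU2Char.relsF2 ∅).ncard = 16 ∧
    (SU2Char.cenLocus SU2Char.relsF2 ∅)ᶜ =
      SU2Char.starLocus SU2Char.relsF2 ∅ ∪ SU2Char.ancLocus SU2Char.relsF2 ∅ ∧
    Disjoint (SU2Char.starLocus SU2Char.relsF2 ∅) (SU2Char.ancLocus SU2Char.relsF2 ∅) ∧
    T2Space SU2Char.ChiF2Noncentral ∧ SecondCountableTopology SU2Char.ChiF2Noncentral ∧
    T2Space SU2Char.ChiS6Star ∧ SecondCountableTopology SU2Char.ChiS6Star ∧
    Function.Involutive SU2Char.nuStar ∧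
    -- the map induced by `p*` identifies the orbit space of `ν` with the complement
    ∃ Φ : Quotient SU2Char.nuSetoid ≃ₜ SU2Char.ChiF2Noncentral,
      (∀ x : SU2Char.ChiS6Star,
        ((Φ (Quotient.mk SU2Char.nuSetoid x) : SU2Char.ChiF2Noncentral) : SU2Char.ChiF2) =
          SU2Char.pStar x.1) ∧
      ∃ (_ : ChartedSpace (EuclideanSpace ℝ (Fin 9)) SU2Char.RepS6Star)
        (_ : ChartedSpace (EuclideanSpace ℝ (Fin 6)) SU2Char.ChiS6Star)
        (_ : ChartedSpace (EuclideanSpace ℝ (Fin 6)) SU2Char.ChiF2Noncentral),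
        IsManifold (𝓡 9) ∞ SU2Char.RepS6Star ∧
        IsManifold (𝓡 6) ∞ SU2Char.ChiS6Star ∧
        IsManifold (𝓡 6) ∞ SU2Char.ChiF2Noncentral ∧
        -- the smooth structure of the orbit space `χ*(S², 6)` is the standard one
        Manifold.IsSmoothEmbedding (𝓡 9) 𝓘(ℝ, Fin 6 → ℍ[ℝ]) ∞ SU2Char.RepS6Star.incl ∧
        Manifold.IsSubmersion (𝓡 9) (𝓡 6) ∞ SU2Char.RepS6Star.cls ∧
        -- `ν` is smooth, with fixed point set of codimension two
        ContMDiff (𝓡 6) (𝓡 6) ∞ SU2Char.nuStar ∧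
        (Function.fixedPoints SU2Char.nuStar).Nonempty ∧
        SU2Char.IsSubmanifoldOfCodim 6 2 (Function.fixedPoints SU2Char.nuStar) ∧
        -- the quotient map is smooth for the smooth structure of the complement
        ContMDiff (𝓡 6) (𝓡 6) ∞
          (fun x : SU2Char.ChiS6Star => Φ (Quotient.mk SU2Char.nuSetoid x)) := by
  refine ⟨SU2Char.ncard_cenLocus, SU2Char.compl_cenLocus, SU2Char.disjoint_starLocus_ancLocus,
    inferInstance, inferInstance, inferInstance, inferInstance, SU2Char.nuStar_involutive,
    SU2Char.quotientHomeo, fun x => rfl, ?_⟩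
  obtain ⟨hY, hYm, hp⟩ := SU2Char.exists_branched_structure
  exact ⟨SU2Char.repStructure, SU2Char.orbitStructure, hY,
    SliceManifold.SliceChart.isManifold_repCharted _ _ _,
    SliceManifold.SliceChart.isManifold_quotCharted _ _ _ SU2Char.exists_smooth_translate, hYm,
    SliceManifold.SliceChart.isSmoothEmbedding_incl _ _ _ SU2Char.splitAmb,
    SliceManifold.SliceChart.isSubmersion_quotient _ _ _ SU2Char.exists_smooth_translate _,
    SU2Char.contMDiff_nuStar, SU2Char.fixedPoints_nuStar_nonempty,
    SU2Char.isSubmanifold_fixedPoints, hp⟩
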